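/- **Formulas.** Fix a set $\mathcal A$ of propositional variables. Formulas are generated by $A,B ::= a \mid A\supset B\mid A\wedge B\mid \Box A\mid\Diamond A\mid\Diamond\bot$. Even ($\circ$) and odd ($\bullet$) polarized formulas are generated by $$A^\circ,B^\circ ::= a^\circ\mid A^\circ\otimes B^\circ\mid A^\bullet\multimap B^\circ\mid\Box A^\circ\mid\Diamond A^\circ,\qquad A^\bullet,B^\bullet ::= a^\bullet\mid A^\bullet\otimes B^\bullet\mid A^\circ\multimap B^\bullet\mid\Box A^\bullet\mid\Diamond A^\bullet\mid\Diamond\bot^\bullet .$$ Formula isomorphism $\sim$ is the congruence on polarized formulas generated by $A\otimes B\sim B\otimes A$, $A\otimes(B\otimes C)\sim(A\otimes B)\otimes C$ and $(A\otimes B)\multimap C\sim A\multimap(B\multimap C)$. The deep rules, for an arbitrary one-hole context $\Gamma\{\ \}$, are (premise $\to$ conclusion) $$\Gamma\{\Diamond\bot^\bullet\}\to\Gamma\{(\Diamond A)^\bullet\},\quad \Gamma\{A^\bullet\}\to\Gamma\{(A\otimes B)^\bullet\},\quad \Gamma\{A^\circ\}\to\Gamma\{(B\multimap A)^\circ\},\quad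 \Gamma\{(A\otimes A)^\bullet\}\to\Gamma\{A^\bullet\}.$$ Write $H'\vdash_{\downarrow}H$ if there is a derivation from $H'$ to $H$ with these rules, formulas being taken up to $\sim$. **Arenas.** Consider directed graphs with two kinds of edges $\to$ and $\rightsquigarrow$ and vertices labelled in $\mathcal A\cup\{\Box,\Diamond\}$. A root is a vertex without outgoing $\to$-edge. $G+H$ is disjoint union; $G\mathbin{-\!\triangleright}H$ (resp. $G\mathbin{\sim\!\triangleright}H$) is the disjoint union with, in addition, a $\to$-edge (resp. $\rightsquigarrow$-edge) from every root of $G$ to every root of $H$. The arena of a formula is given by $⟦a⟧=\bullet_a$, $⟦A\supset B⟧=⟦A⟧\mathbin{-\!\triangleright}⟦B⟧$, $⟦A\wedge B⟧=⟦A⟧+⟦B⟧$, $⟦\Diamond\bot⟧=\bullet_\Diamond$, $⟦\Box A⟧=\bullet_\Box\mathbin{\sim\!\triangleright}⟦A⟧$, $⟦\Diamond A⟧=\bullet_\Diamond\mathbin{\sim\!\triangleright}⟦A⟧$. For a polarized formula $H$, $⟦H⟧$ is the arena of the formula obtained by forgetting polarities and reading $\otimes,\multimap$ as $\wedge,\supset$.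 The depth $d(v)$ is the length of a longest $\to$-path from $v$ to a root. A meeting point of $v,w$ is a nearest common $\to^*$-descendant (a common descendant that is not reached by $\to^*$ from a different common descendant). The meeting depth of $v,w$ is the minimal depth of their meeting points, or $-1$ if there is none. Distinct vertices $v,w$ are conjunct, $v\frown w$, if their meeting depth is odd, and disjunct, $v\smile w$, if it is even. **Skew fibrations.** A modal arena homomorphism $f\colon\mathcal H\to\mathcal G$ is a map on vertices that preserves $\to$, $\rightsquigarrow$, depth and labels, and such that whenever $v\rightsquigarrow f(u)$ in $\mathcal G$ there is $w$ in $\mathcal H$ with $w\rightsquigarrow u$ and $f(w)=v$. It is an even skew fibration if it preserves $\frown$, and whenever $f(v)\frown w$ there is $u$ with $v\frown u$ and not $f(u)\frown w$. It is an odd skew fibration if the same holds with $\smile$ in place of $\frown$ (the empty map $\emptyset_{\mathcal G}$ is then an odd skew fibration). **Theorem.** (a) Let $H',H$ be polarized formulas, both even (resp. both odd). Then $H'\vdash_{\downarrow}H$ if and only if there is an even (resp. odd) skew fibration $⟦H'⟧\to⟦H⟧$. (b) Every even or odd skew fibration between arenas of formulas belongs to the smallest families of even and of odd maps such that: isomorphisms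 of arenas are even and odd; $\emptyset_{\mathcal G}$ is odd for every arena $\mathcal G$; if $f,g$ have the same parity $p$, then so does $f+g$; if $f$ has the parity opposite to $p$ and $g$ has parity $p$ and non-empty domain, then $f\mathbin{-\!\triangleright}g$ has parity $p$; if $g$ has parity $p$ and $v$ is a vertex labelled $\Box$ or $\Diamond$, then $\mathrm{id}_v\mathbin{\sim\!\triangleright}g$ has parity $p$; if $f,g$ are odd with the same codomain, then the copairing $[f,g]$ on the disjoint union of their domains is odd; and the composite, through an arena, of two maps of parity $p$ has parity $p$. (Here "arena" means a graph isomorphic to the arena of a formula.) -/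

import Mathlib

/-- The two polarities: `even` is the output polarity `∘`, `odd` is the input polarity `•`. -/
inductive Polarity
  | even
  | odd

def Polarity.flip : Polarity → Polarity
  | .even => .odd
  | .odd => .even

/-- Modal formulas over propositional variables in `α`; `diaBot` is the formula `◇⊥`. -/
inductive Formula (α : Type*)
  | atom (a : α)
  | imp (A B : Formula α)
  | and (A B : Formula α)
  | box (A : Formula α)
  | dia (A : Formula α)
  | diaBot

/-- Polarized formulas. The left-hand side of an implication has the opposite polarity, and
`◇⊥` is available in odd polarity only. -/
inductive PFormula (α : Type*) : Polarity → Type _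
  | atom {p : Polarity} (a : α) : PFormula α p
  | tensor {p : Polarity} (A B : PFormula α p) : PFormula α p
  | limp {p : Polarity} (A : PFormula α p.flip) (B : PFormula α p) : PFormula α p
  | box {p : Polarity} (A : PFormula α p) : PFormula α p
  | dia {p : Polarity} (A : PFormula α p) : PFormula α p
  | diaBot : PFormula α Polarity.odd

namespace PFormula

variable {α : Type*}

/-- The underlying formula: polarities are forgotten, `⊗` becomes `∧` and `⊸` becomes `⊃`. -/
def erase : {p : Polarity} → PFormula α p → Formula α
  | _, atom a => .atom a
  | _, tensor A B => .and A.erase B.erase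
  | _, limp A B => .imp A.erase B.erase
  | _, box A => .box A.erase
  | _, dia A => .dia A.erase
  | _, diaBot => .diaBot

/-- One-hole contexts: `Ctx α q p` is a polarized formula of polarity `p` in which one
subformula of polarity `q` has been replaced by a hole. -/
inductive Ctx (α : Type*) (q : Polarity) : Polarity → Type _
  | hole : Ctx α q q
  | tensorL {p : Polarity} (C : Ctx α q p) (B : PFormula α p) : Ctx α q p
  | tensorR {p : Polarity} (A : PFormula α p) (C : Ctx α q p) : Ctx α q p
  | limpL {p : Polarity} (C : Ctx α q p.flip) (B : PFormula α p) : Ctx α q p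
  | limpR {p : Polarity} (A : PFormula α p.flip) (C : Ctx α q p) : Ctx α q p
  | box {p : Polarity} (C : Ctx α q p) : Ctx α q p
  | dia {p : Polarity} (C : Ctx α q p) : Ctx α q p

/-- Plugging a formula into the hole of a context. -/
def Ctx.fill {q : Polarity} : {p : Polarity} → Ctx α q p → PFormula α q → PFormula α p
  | _, .hole, X => X
  | _, .tensorL C B, X => .tensor (C.fill X) B
  | _, .tensorR A C, X => .tensor A (C.fill X)
  | _, .limpL C B, X => .limp (C.fill X) B
  | _, .limpR A C, X => .limp A (C.fill X)
  | _, .box C, X => .box (C.fill X)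
  | _, .dia C, X => .dia (C.fill X)

/-- The weakening and contraction rules, `Rule premise conclusion`, without their context. -/
inductive Rule : {q : Polarity} → PFormula α q → PFormula α q → Prop
  | weakDia (A : PFormula α .odd) : Rule diaBot (dia A)
  | weakTensor (A B : PFormula α .odd) : Rule A (tensor A B)
  | weakLimp (A : PFormula α .even) (B : PFormula α .odd) :
      Rule A (limp (p := .even) B A)
  | contr (A : PFormula α .odd) : Rule (tensor A A) A

/-- One application of a deep rule, from the premise `H'` to the conclusion `H`. -/
def DeepStep {p : Polarity} (H' H : PFormula α p) : Prop :=
  ∃ (q : Polarity) (C : Ctx α q p) (A' A : PFormula α q),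
    Rule A' A ∧ H' = C.fill A' ∧ H = C.fill A

/-- The equations generating formula isomorphism. -/
inductive IsoRule : {q : Polarity} → PFormula α q → PFormula α q → Prop
  | comm {q : Polarity} (A B : PFormula α q) : IsoRule (tensor A B) (tensor B A)
  | assoc {q : Polarity} (A B C : PFormula α q) :
      IsoRule (tensor A (tensor B C)) (tensor (tensor A B) C)
  | curry {q : Polarity} (A B : PFormula α q.flip) (C : PFormula α q) :
      IsoRule (limp (tensor A B) C) (limp A (limp B C))

/-- Formula isomorphism: the congruence generated by the equations above. -/
def FormulaIso {p : Polarity} : PFormula α p → PFormula α p → Prop :=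
  Relation.EqvGen fun X Y =>
    ∃ (q : Polarity) (C : Ctx α q p) (A B : PFormula α q),
      IsoRule A B ∧ X = C.fill A ∧ Y = C.fill B

/-- There is a derivation from `H'` to `H` with the deep weakening and contraction rules, where
formulas are taken up to formula isomorphism. -/
def Derives {p : Polarity} : PFormula α p → PFormula α p → Prop :=
  Relation.ReflTransGen fun X Y => DeepStep X Y ∨ FormulaIso X Y

end PFormula

/-- The labels of vertices. -/
inductive Label (α : Type*)
  | atom (a : α)
  | box
  | dia

/-- Vertex-labelled directed graphs with two kinds of edges: `v ⟶ w` (`iedge`) and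
`v ⤳ w` (`medge`). -/
structure LGraph (α : Type*) where
  V : Type
  iedge : V → V → Prop
  medge : V → V → Prop
  lab : V → Label α

namespace LGraph

variable {α : Type*}

/-- `v` is a `⟶`-root: it has no outgoing `⟶`-edge. -/
def IsRoot (G : LGraph α) (v : G.V) : Prop := ∀ w, ¬ G.iedge v w

/-- The graph with one vertex, labelled `l`. -/
def single (l : Label α) : LGraph α where
  V := Unit
  iedge _ _ := False
  medge _ _ := False
  lab _ := l

/-- The disjoint union `G + H`. -/
def sum (G H : LGraph α) : LGraph α where
  V := G.V ⊕ H.V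
  iedge
    | .inl u, .inl v => G.iedge u v
    | .inr u, .inr v => H.iedge u v
    | _, _ => False
  medge
    | .inl u, .inl v => G.medge u v
    | .inr u, .inr v => H.medge u v
    | _, _ => False
  lab
    | .inl v => G.lab v
    | .inr v => H.lab v

/-- `G —▷ H`: the disjoint union with a `⟶`-edge from each root of `G` to each root of `H`. -/
def arrow (G H : LGraph α) : LGraph α where
  V := G.V ⊕ H.V
  iedge
    | .inl u, .inl v => G.iedge u v
    | .inr u, .inr v => H.iedge u v
    | .inl u, .inr v => G.IsRoot u ∧ H.IsRoot v
    | .inr _, .inl _ => False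
  medge
    | .inl u, .inl v => G.medge u v
    | .inr u, .inr v => H.medge u v
    | _, _ => False
  lab
    | .inl v => G.lab v
    | .inr v => H.lab v

/-- `G ∼▷ H`: the disjoint union with a `⤳`-edge from each root of `G` to each root of `H`. -/
def squig (G H : LGraph α) : LGraph α where
  V := G.V ⊕ H.V
  iedge
    | .inl u, .inl v => G.iedge u v
    | .inr u, .inr v => H.iedge u v
    | _, _ => False
  medge
    | .inl u, .inl v => G.medge u v
    | .inr u, .inr v => H.medge u v
    | .inl u, .inr v => G.IsRoot u ∧ H.IsRoot v
    | .inr _, .inl _ => False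
  lab
    | .inl v => G.lab v
    | .inr v => H.lab v

/-- Isomorphisms of labelled graphs. -/
structure IsIso {H G : LGraph α} (f : H.V → G.V) : Prop where
  bijective : Function.Bijective f
  iedge_iff : ∀ v w, G.iedge (f v) (f w) ↔ H.iedge v w
  medge_iff : ∀ v w, G.medge (f v) (f w) ↔ H.medge v w
  lab_eq : ∀ v, G.lab (f v) = H.lab v

/-- `v ⟶* w`. -/
def Reach (G : LGraph α) : G.V → G.V → Prop := Relation.ReflTransGen G.iedge

/-- There is a `⟶`-path of length `n` from `v` to `w`. -/
def PathLen (G : LGraph α) : ℕ → G.V → G.V → Prop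
  | 0, v, w => v = w
  | n + 1, v, w => ∃ u, G.iedge v u ∧ G.PathLen n u w

/-- The depth of `v`: the length of a longest `⟶`-path from `v` to a root. -/
noncomputable def depth (G : LGraph α) (v : G.V) : ℕ :=
  sSup {n | ∃ r, G.IsRoot r ∧ G.PathLen n v r}

/-- `u` is a meeting point of `v` and `w`: a nearest common `⟶*`-descendant, that is, one that
is not reached from another common descendant. -/
def IsMeetingPoint (G : LGraph α) (v w u : G.V) : Prop :=
  (G.Reach v u ∧ G.Reach w u) ∧
    ∀ u', G.Reach v u' → G.Reach w u' → G.Reach u' u → u' = u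

open Classical in
/-- The meeting depth: the least depth of a meeting point, or `-1` if there is none. -/
noncomputable def meetingDepth (G : LGraph α) (v w : G.V) : ℤ :=
  if ∃ u, G.IsMeetingPoint v w u then
    ((sInf {n | ∃ u, G.IsMeetingPoint v w u ∧ G.depth u = n} : ℕ) : ℤ)
  else -1

/-- Conjunct vertices: distinct, of odd meeting depth. -/
def Conj (G : LGraph α) (v w : G.V) : Prop := v ≠ w ∧ Odd (G.meetingDepth v w)

/-- Disjunct vertices: distinct, of even meeting depth. -/
def Disj (G : LGraph α) (v w : G.V) : Prop := v ≠ w ∧ Even (G.meetingDepth v w)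

/-- The relation that skew fibrations of a given parity preserve and lift: conjunctness for even
ones and disjunctness for odd ones. -/
def Rel (G : LGraph α) : Polarity → G.V → G.V → Prop
  | .even => G.Conj
  | .odd => G.Disj

/-- Modal arena homomorphisms. -/
structure IsModalHom {H G : LGraph α} (f : H.V → G.V) : Prop where
  iedge : ∀ v w, H.iedge v w → G.iedge (f v) (f w)
  medge : ∀ v w, H.medge v w → G.medge (f v) (f w)
  depth : ∀ v, H.depth v = G.depth (f v)
  lab : ∀ v, H.lab v = G.lab (f v)
  modal : ∀ (v : G.V) (u : H.V), G.medge v (f u) → ∃ w, H.medge w u ∧ f w = v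

/-- Skew fibrations of parity `p`. For `p = odd` the empty map satisfies all the clauses. -/
structure IsSkewFibration (p : Polarity) {H G : LGraph α} (f : H.V → G.V) : Prop
    extends IsModalHom f where
  preserves : ∀ v w, H.Rel p v w → G.Rel p (f v) (f w)
  lifting : ∀ (v : H.V) (w : G.V), G.Rel p (f v) w → ∃ u, H.Rel p v u ∧ ¬ G.Rel p (f u) w

end LGraph

/-- The modal arena of a formula. -/
def Formula.arena {α : Type*} : Formula α → LGraph α
  | .atom a => .single (.atom a)
  | .imp A B => A.arena.arrow B.arena
  | .and A B => A.arena.sum B.arena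
  | .box A => (LGraph.single .box).squig A.arena
  | .dia A => (LGraph.single .dia).squig A.arena
  | .diaBot => .single .dia

/-- The modal arena of a polarized formula. -/
def PFormula.arena {α : Type*} {p : Polarity} (H : PFormula α p) : LGraph α := H.erase.arena

namespace LGraph

variable {α : Type*}

/-- `G` is, up to isomorphism, the modal arena of a formula. -/
def IsArena (G : LGraph α) : Prop := ∃ (F : Formula α) (e : F.arena.V → G.V), IsIso e

/-- `f₁ + f₂`. -/
def sumMap {H₁ G₁ H₂ G₂ : LGraph α} (f₁ : H₁.V → G₁.V) (f₂ : H₂.V → G₂.V) :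
    (H₁.sum H₂).V → (G₁.sum G₂).V := Sum.map f₁ f₂

/-- `f₁ —▷ f₂`. -/
def arrowMap {H₁ G₁ H₂ G₂ : LGraph α} (f₁ : H₁.V → G₁.V) (f₂ : H₂.V → G₂.V) :
    (H₁.arrow H₂).V → (G₁.arrow G₂).V := Sum.map f₁ f₂

/-- `f₁ ∼▷ f₂`. -/
def squigMap {H₁ G₁ H₂ G₂ : LGraph α} (f₁ : H₁.V → G₁.V) (f₂ : H₂.V → G₂.V) :
    (H₁.squig H₂).V → (G₁.squig G₂).V := Sum.map f₁ f₂

/-- The copairing `[f₁, f₂]`. -/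
def copair {H₁ H₂ G : LGraph α} (f₁ : H₁.V → G.V) (f₂ : H₂.V → G.V) :
    (H₁.sum H₂).V → G.V := Sum.elim f₁ f₂

/-- The maps of parity `p` that are built from the basic ones. Identities appear as isomorphisms
because vertices are not named. -/
inductive Built : Polarity → {H G : LGraph α} → (H.V → G.V) → Prop
  | iso {p : Polarity} {H G : LGraph α} {f : H.V → G.V} (hH : H.IsArena) (hf : IsIso f) :
      Built p f
  | empty {H G : LGraph α} {f : H.V → G.V} (hH : IsEmpty H.V) (hG : G.IsArena) : Built .odd f
  | sum {p : Polarity} {H₁ G₁ H₂ G₂ : LGraph α} {f₁ : H₁.V → G₁.V} {f₂ : H₂.V → G₂.V}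
      (h₁ : Built p f₁) (h₂ : Built p f₂) : Built p (sumMap f₁ f₂)
  | arrow {p : Polarity} {H₁ G₁ H₂ G₂ : LGraph α} {f₁ : H₁.V → G₁.V} {f₂ : H₂.V → G₂.V}
      (h₁ : Built p.flip f₁) (h₂ : Built p f₂) (hne : Nonempty H₂.V) :
      Built p (arrowMap f₁ f₂)
  | squig {p : Polarity} {l : Label α} {H G : LGraph α} {f : H.V → G.V}
      (hl : l = .box ∨ l = .dia) (h : Built p f) :
      Built p (squigMap (H₁ := single l) (G₁ := single l) id f)
  | copair {H₁ H₂ G : LGraph α} {f₁ : H₁.V → G.V} {f₂ : H₂.V → G.V}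
      (h₁ : Built .odd f₁) (h₂ : Built .odd f₂) : Built .odd (copair f₁ f₂)
  | comp {p : Polarity} {H K G : LGraph α} {f : H.V → K.V} {g : K.V → G.V}
      (hK : K.IsArena) (hf : Built p f) (hg : Built p g) : Built p (g ∘ f)

end LGraph

/-! Everything passes through one intermediate notion: `Der p F' F f` says that the map `f` between
arenas of formulas is witnessed by a derivation. Derivability of polarized formulas is the existence
of such an `f`; each such `f` is a skew fibration and is built from the basic maps; and, the hard
direction, every skew fibration is such an `f`.

The relations are easy to compute. On `G + H` and `G ∼▷ H` two vertices from different sides never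
meet, so they are conjunct. On `G —▷ H` they meet in a root, so they are disjunct, and inside `G`
all meeting depths increase by one, which exchanges the two relations. Hence each relation is
obtained from those of the parts by relating all cross pairs or none (`sumRel_sum`, `sumRel_squig`,
`sumRel_arrow`).

From derivations to skew fibrations, the obstacle is that the lifting clause is not visibly stable
under composition. It is replaced by the stronger demand that maximal cliques have maximal cliques
as images (`IsCliqueMap`). This composes at once, holds for each rule and passes through all
connectives. It implies lifting: if everything related to `v` had an image related to `w`, so would
a whole maximal clique through `v`; then `w` would belong to its image and be related to itself.

Conversely, a skew fibration is first made surjective. Its image has closure properties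
(`IsSkewSet`) which say, connective by connective, that the only parts missing are those that
weakening may add (`IsSkewSet.isDerRange`). A surjective skew fibration is then decomposed by
induction on the number of vertices of its source (`derBelow`). An odd map out of a conjunction is a
copairing, hence a contraction. Otherwise the main connective of the target forces that of the
source, up to formula isomorphism. Under `∧` the source splits along the preimage of a conjunct,
since edges do not cross it (`Formula.split`). Under `⊃`, consequents are first made
non-implications by uncurrying; conjunctness then keeps the even map from sending the consequent
across the arrow, and disjunctness does this for the antecedent in the odd case. The antecedent that
still has to be divided is split and one part is curried back (`der_of_even_imp`, `der_of_odd_imp`).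
Under a modality, the preimage of the modal vertex must be the top of the source (`exists_modal`).
-/

namespace LGraph

variable {α : Type*}

/-! ### Depth and meeting points in graded graphs -/

/-- Nonempty graphs in which `⟶`-edges lower the depth by one and vertices of positive depth are
not roots. -/
class Good (G : LGraph α) : Prop where
  nonempty : Nonempty G.V
  depth_edge : ∀ v w, G.iedge v w → G.depth v = G.depth w + 1
  exists_edge : ∀ v, G.depth v ≠ 0 → ∃ w, G.iedge v w

/-- Under such a grading every path from `v` to a root has length `d v`, and at least one such path
exists; the supremum defining depth is over a singleton. -/
theorem depth_eq_of_grading {G : LGraph α} (d : G.V → ℕ)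
    (h1 : ∀ v w, G.iedge v w → d v = d w + 1) (h2 : ∀ v, d v ≠ 0 → ∃ w, G.iedge v w) (v : G.V) :
    G.depth v = d v := by
  have root : ∀ v, G.IsRoot v → d v = 0 := fun v hv => by
    by_contra h
    obtain ⟨w, hw⟩ := h2 v h
    exact hv w hw
  have len : ∀ n v r, G.IsRoot r → G.PathLen n v r → n = d v := by
    intro n
    induction n with
    | zero => rintro v r hr rfl; exact (root _ hr).symm
    | succ n ih =>
      rintro v r hr ⟨u, hu, hp⟩
      rw [h1 _ _ hu, ← ih u r hr hp]
  have ex : ∀ n v, d v = n → ∃ r, G.IsRoot r ∧ G.PathLen n v r := by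
    intro n
    induction n with
    | zero =>
      intro v hv
      exact ⟨v, fun w hw => by have := h1 _ _ hw; omega, rfl⟩
    | succ n ih =>
      intro v hv
      obtain ⟨w, hw⟩ := h2 v (by omega)
      obtain ⟨r, hr, hp⟩ := ih w (by have := h1 _ _ hw; omega)
      exact ⟨r, hr, w, hw, hp⟩
  have : {n | ∃ r, G.IsRoot r ∧ G.PathLen n v r} = {d v} := by
    ext n
    constructor
    · rintro ⟨r, hr, hp⟩
      exact len n v r hr hp
    · rintro rfl
      exact ex _ v rfl
  rw [depth, this, csSup_singleton]

theorem Good.of_grading {G : LGraph α} (hne : Nonempty G.V) (d : G.V → ℕ)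
    (h1 : ∀ v w, G.iedge v w → d v = d w + 1) (h2 : ∀ v, d v ≠ 0 → ∃ w, G.iedge v w) :
    G.Good where
  nonempty := hne
  depth_edge v w h := by simpa only [depth_eq_of_grading d h1 h2] using h1 v w h
  exists_edge v h := h2 v (by rwa [depth_eq_of_grading d h1 h2] at h)

theorem isRoot_iff {G : LGraph α} [hG : G.Good] {v : G.V} : G.IsRoot v ↔ G.depth v = 0 := by
  constructor
  · intro h
    by_contra h0
    obtain ⟨w, hw⟩ := hG.exists_edge v h0
    exact h w hw
  · intro h w hw
    have := hG.depth_edge v w hw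
    omega

theorem exists_reach_root {G : LGraph α} [hG : G.Good] (v : G.V) :
    ∃ r, G.IsRoot r ∧ G.Reach v r := by
  induction h : G.depth v generalizing v with
  | zero => exact ⟨v, isRoot_iff.2 h, .refl⟩
  | succ n ih =>
    obtain ⟨w, hw⟩ := hG.exists_edge v (by omega)
    obtain ⟨r, hr, hp⟩ := ih w (by have := hG.depth_edge v w hw; omega)
    exact ⟨r, hr, .head hw hp⟩

theorem exists_root (G : LGraph α) [hG : G.Good] : ∃ r, G.IsRoot r := by
  obtain ⟨v⟩ := hG.nonempty
  obtain ⟨r, hr, -⟩ := exists_reach_root v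
  exact ⟨r, hr⟩

theorem Reach.eq_of_isRoot {G : LGraph α} {v w : G.V} (h : G.Reach v w) (hv : G.IsRoot v) :
    w = v := by
  rcases Relation.ReflTransGen.cases_head h with h | ⟨u, hu, -⟩
  · exact h.symm
  · exact (hv u hu).elim

theorem Reach.depth_le {G : LGraph α} [hG : G.Good] {v w : G.V} (h : G.Reach v w) :
    G.depth w ≤ G.depth v := by
  induction h with
  | refl => exact le_rfl
  | tail _ h ih => have := hG.depth_edge _ _ h; omega

theorem Reach.eq_of_depth_le {G : LGraph α} [hG : G.Good] {v w : G.V} (h : G.Reach v w)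
    (hd : G.depth v ≤ G.depth w) : v = w := by
  rcases Relation.ReflTransGen.cases_head h with h | ⟨u, hu, h⟩
  · exact h
  · have := hG.depth_edge _ _ hu
    have := Reach.depth_le h
    omega

/-- Depths of common descendants are bounded by the depth of `v`, and one of greatest depth is
nearest, because a proper path strictly lowers depth. -/
theorem exists_meetingPoint {G : LGraph α} [hG : G.Good] {v w u : G.V} (h1 : G.Reach v u)
    (h2 : G.Reach w u) : ∃ m, G.IsMeetingPoint v w m := by
  classical
  let S : ℕ → Prop := fun n => ∃ m, G.Reach v m ∧ G.Reach w m ∧ G.depth m = n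
  have hS : ∃ n, S n := ⟨_, u, h1, h2, rfl⟩
  have hb : ∀ n, S n → n ≤ G.depth v := by
    rintro n ⟨m, hm, -, rfl⟩
    exact hm.depth_le
  obtain ⟨m, hm1, hm2, hm⟩ : S (Nat.findGreatest S (G.depth v)) := by
    obtain ⟨n, hn⟩ := hS
    exact Nat.findGreatest_spec (hb n hn) hn
  refine ⟨m, ⟨hm1, hm2⟩, fun u' a b c => c.eq_of_depth_le ?_⟩
  rw [hm]
  exact Nat.le_findGreatest (hb _ ⟨u', a, b, rfl⟩) ⟨u', a, b, rfl⟩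

theorem meetingDepth_of_exists {G : LGraph α} {v w : G.V} (h : ∃ u, G.IsMeetingPoint v w u) :
    G.meetingDepth v w = (sInf {n | ∃ u, G.IsMeetingPoint v w u ∧ G.depth u = n} : ℕ) :=
  if_pos h

theorem meetingDepth_of_not_exists {G : LGraph α} {v w : G.V}
    (h : ¬ ∃ u, G.IsMeetingPoint v w u) : G.meetingDepth v w = -1 :=
  if_neg h

theorem meetingDepth_eq_zero {G : LGraph α} {v w u : G.V} (h : G.IsMeetingPoint v w u)
    (hd : G.depth u = 0) : G.meetingDepth v w = 0 := by
  have h0 : sInf {n | ∃ u, G.IsMeetingPoint v w u ∧ G.depth u = n} = 0 :=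
    Nat.sInf_eq_zero.2 (.inl ⟨u, h, hd⟩)
  rw [meetingDepth_of_exists ⟨u, h⟩, h0, Nat.cast_zero]

theorem meetingDepth_of_disjoint {G : LGraph α} {v w : G.V}
    (h : ∀ u, G.Reach v u → ¬ G.Reach w u) : G.meetingDepth v w = -1 :=
  meetingDepth_of_not_exists fun ⟨u, hu, _⟩ => h u hu.1 hu.2

/-! ### Embeddings closed under outgoing edges -/

/-- Embeddings onto `⟶`-closed sets. -/
structure IsLowerEmb {G K : LGraph α} (e : G.V → K.V) : Prop where
  injective : Function.Injective e
  iedge_iff : ∀ u x, K.iedge (e u) x ↔ ∃ v, x = e v ∧ G.iedge u v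

namespace IsLowerEmb

variable {G K : LGraph α} {e : G.V → K.V}

theorem isRoot_iff (he : IsLowerEmb e) (v : G.V) : K.IsRoot (e v) ↔ G.IsRoot v := by
  constructor
  · exact fun h w hw => h (e w) ((he.iedge_iff _ _).2 ⟨w, rfl, hw⟩)
  · intro h x hx
    obtain ⟨w, -, hw⟩ := (he.iedge_iff _ _).1 hx
    exact h w hw

theorem pathLen_iff (he : IsLowerEmb e) (n : ℕ) (v : G.V) (x : K.V) :
    K.PathLen n (e v) x ↔ ∃ w, x = e w ∧ G.PathLen n v w := by
  induction n generalizing v with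
  | zero =>
    constructor
    · rintro rfl; exact ⟨v, rfl, rfl⟩
    · rintro ⟨w, rfl, rfl⟩; rfl
  | succ n ih =>
    constructor
    · rintro ⟨u, hu, hp⟩
      obtain ⟨u, rfl, hu'⟩ := (he.iedge_iff _ _).1 hu
      obtain ⟨w, rfl, hw⟩ := (ih u).1 hp
      exact ⟨w, rfl, u, hu', hw⟩
    · rintro ⟨w, rfl, u, hu, hp⟩
      exact ⟨e u, (he.iedge_iff _ _).2 ⟨u, rfl, hu⟩, (ih u).2 ⟨w, rfl, hp⟩⟩

theorem depth_eq (he : IsLowerEmb e) (v : G.V) : K.depth (e v) = G.depth v := by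
  unfold depth
  congr 1
  ext n
  constructor
  · rintro ⟨r, hr, hp⟩
    obtain ⟨r, rfl, hp'⟩ := (he.pathLen_iff _ _ _).1 hp
    exact ⟨r, (he.isRoot_iff r).1 hr, hp'⟩
  · rintro ⟨r, hr, hp⟩
    exact ⟨e r, (he.isRoot_iff r).2 hr, (he.pathLen_iff _ _ _).2 ⟨r, rfl, hp⟩⟩

theorem reach_iff (he : IsLowerEmb e) (v : G.V) (x : K.V) :
    K.Reach (e v) x ↔ ∃ w, x = e w ∧ G.Reach v w := by
  constructor
  · intro h
    induction h with
    | refl => exact ⟨v, rfl, .refl⟩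
    | tail _ h ih =>
      obtain ⟨w, rfl, hw⟩ := ih
      obtain ⟨u, rfl, hu⟩ := (he.iedge_iff _ _).1 h
      exact ⟨u, rfl, .tail hw hu⟩
  · rintro ⟨w, rfl, h⟩
    induction h with
    | refl => exact .refl
    | tail _ h ih => exact .tail ih ((he.iedge_iff _ _).2 ⟨_, rfl, h⟩)

theorem reach_iff' (he : IsLowerEmb e) (v w : G.V) : K.Reach (e v) (e w) ↔ G.Reach v w := by
  rw [he.reach_iff]
  constructor
  · rintro ⟨u, hu, h⟩
    rwa [he.injective hu]
  · exact fun h => ⟨w, rfl, h⟩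

theorem isMeetingPoint_iff (he : IsLowerEmb e) (v w : G.V) (x : K.V) :
    K.IsMeetingPoint (e v) (e w) x ↔ ∃ m, x = e m ∧ G.IsMeetingPoint v w m := by
  constructor
  · rintro ⟨⟨h1, h2⟩, h3⟩
    obtain ⟨m, rfl, h1'⟩ := (he.reach_iff _ _).1 h1
    refine ⟨m, rfl, ⟨h1', (he.reach_iff' _ _).1 h2⟩, fun u a b c => he.injective ?_⟩
    exact h3 _ ((he.reach_iff' _ _).2 a) ((he.reach_iff' _ _).2 b) ((he.reach_iff' _ _).2 c)
  · rintro ⟨m, rfl, ⟨h1, h2⟩, h3⟩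
    refine ⟨⟨(he.reach_iff' _ _).2 h1, (he.reach_iff' _ _).2 h2⟩, fun u a b c => ?_⟩
    obtain ⟨u, rfl, a'⟩ := (he.reach_iff _ _).1 a
    rw [he.reach_iff'] at b c
    rw [h3 u a' b c]

/-- All descendants of vertices in the image stay in the image, so meeting points and their depths
agree. This covers every summand except the left side of an arrow, whose roots acquire outgoing
edges. -/
theorem meetingDepth_eq (he : IsLowerEmb e) (v w : G.V) :
    K.meetingDepth (e v) (e w) = G.meetingDepth v w := by
  have h1 : (∃ x, K.IsMeetingPoint (e v) (e w) x) ↔ ∃ m, G.IsMeetingPoint v w m := by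
    simp only [he.isMeetingPoint_iff]
    constructor
    · rintro ⟨_, m, -, h⟩; exact ⟨m, h⟩
    · rintro ⟨m, h⟩; exact ⟨_, m, rfl, h⟩
  have h2 : {n | ∃ x, K.IsMeetingPoint (e v) (e w) x ∧ K.depth x = n} =
      {n | ∃ m, G.IsMeetingPoint v w m ∧ G.depth m = n} := by
    ext n
    simp only [he.isMeetingPoint_iff, Set.mem_ofPred_eq]
    constructor
    · rintro ⟨_, ⟨m, rfl, h⟩, rfl⟩; exact ⟨m, h, (he.depth_eq m).symm⟩
    · rintro ⟨m, h, rfl⟩; exact ⟨_, ⟨m, rfl, h⟩, he.depth_eq m⟩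
  by_cases h : ∃ m, G.IsMeetingPoint v w m
  · rw [meetingDepth_of_exists h, meetingDepth_of_exists (h1.2 h), h2]
  · rw [meetingDepth_of_not_exists h, meetingDepth_of_not_exists (h1.not.2 h)]

theorem rel_iff (he : IsLowerEmb e) (p : Polarity) (v w : G.V) :
    K.Rel p (e v) (e w) ↔ G.Rel p v w := by
  cases p <;> simp only [Rel, Conj, Disj, he.meetingDepth_eq, ne_eq, he.injective.eq_iff]

end IsLowerEmb

theorem IsIso.isLowerEmb {G K : LGraph α} {e : G.V → K.V} (he : IsIso e) : IsLowerEmb e where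
  injective := he.bijective.1
  iedge_iff u x := by
    obtain ⟨y, rfl⟩ := he.bijective.2 x
    rw [he.iedge_iff]
    constructor
    · exact fun h => ⟨y, rfl, h⟩
    · rintro ⟨v, hv, h⟩
      rwa [he.bijective.1 hv]

theorem isLowerEmb_sum_inl (G H : LGraph α) : IsLowerEmb (K := G.sum H) (G := G) Sum.inl where
  injective := Sum.inl_injective
  iedge_iff u x := by
    rcases x with x | x
    · exact ⟨fun h => ⟨x, rfl, h⟩, by rintro ⟨v, hv, h⟩; cases hv; exact h⟩
    · exact ⟨fun h => h.elim, by rintro ⟨v, hv, h⟩; cases hv⟩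

theorem isLowerEmb_sum_inr (G H : LGraph α) : IsLowerEmb (K := G.sum H) (G := H) Sum.inr where
  injective := Sum.inr_injective
  iedge_iff u x := by
    rcases x with x | x
    · exact ⟨fun h => h.elim, by rintro ⟨v, hv, h⟩; cases hv⟩
    · exact ⟨fun h => ⟨x, rfl, h⟩, by rintro ⟨v, hv, h⟩; cases hv; exact h⟩

theorem isLowerEmb_squig_inl (G H : LGraph α) :
    IsLowerEmb (K := G.squig H) (G := G) Sum.inl where
  injective := Sum.inl_injective
  iedge_iff u x := by
    rcases x with x | x
    · exact ⟨fun h => ⟨x, rfl, h⟩, by rintro ⟨v, hv, h⟩; cases hv; exact h⟩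
    · exact ⟨fun h => h.elim, by rintro ⟨v, hv, h⟩; cases hv⟩

theorem isLowerEmb_squig_inr (G H : LGraph α) :
    IsLowerEmb (K := G.squig H) (G := H) Sum.inr where
  injective := Sum.inr_injective
  iedge_iff u x := by
    rcases x with x | x
    · exact ⟨fun h => h.elim, by rintro ⟨v, hv, h⟩; cases hv⟩
    · exact ⟨fun h => ⟨x, rfl, h⟩, by rintro ⟨v, hv, h⟩; cases hv; exact h⟩

theorem isLowerEmb_arrow_inr (G H : LGraph α) :
    IsLowerEmb (K := G.arrow H) (G := H) Sum.inr where
  injective := Sum.inr_injective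
  iedge_iff u x := by
    rcases x with x | x
    · exact ⟨fun h => h.elim, by rintro ⟨v, hv, h⟩; cases hv⟩
    · exact ⟨fun h => ⟨x, rfl, h⟩, by rintro ⟨v, hv, h⟩; cases hv; exact h⟩

/-! ### Depth in compound graphs -/

section Depth

variable {G H : LGraph α}

theorem depth_sum_inl (v : G.V) : (G.sum H).depth (.inl v) = G.depth v :=
  (isLowerEmb_sum_inl G H).depth_eq v

theorem depth_sum_inr (v : H.V) : (G.sum H).depth (.inr v) = H.depth v :=
  (isLowerEmb_sum_inr G H).depth_eq v

theorem depth_squig_inl (v : G.V) : (G.squig H).depth (.inl v) = G.depth v :=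
  (isLowerEmb_squig_inl G H).depth_eq v

theorem depth_squig_inr (v : H.V) : (G.squig H).depth (.inr v) = H.depth v :=
  (isLowerEmb_squig_inr G H).depth_eq v

theorem depth_arrow_inr (v : H.V) : (G.arrow H).depth (.inr v) = H.depth v :=
  (isLowerEmb_arrow_inr G H).depth_eq v

instance good_single (l : Label α) : (single l).Good :=
  .of_grading ⟨()⟩ (fun _ => 0) (fun _ _ h => False.elim h) (fun _ h => (h rfl).elim)

instance good_sum [hG : G.Good] [hH : H.Good] : (G.sum H).Good where
  nonempty := hG.nonempty.map Sum.inl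
  depth_edge := by
    rintro (v | v) (w | w) h
    · simpa only [depth_sum_inl] using hG.depth_edge v w h
    · exact h.elim
    · exact h.elim
    · simpa only [depth_sum_inr] using hH.depth_edge v w h
  exists_edge := by
    rintro (v | v) h
    · rw [depth_sum_inl] at h
      obtain ⟨w, hw⟩ := hG.exists_edge v h
      exact ⟨.inl w, hw⟩
    · rw [depth_sum_inr] at h
      obtain ⟨w, hw⟩ := hH.exists_edge v h
      exact ⟨.inr w, hw⟩

instance good_squig [hG : G.Good] [hH : H.Good] : (G.squig H).Good where
  nonempty := hG.nonempty.map Sum.inl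
  depth_edge := by
    rintro (v | v) (w | w) h
    · simpa only [depth_squig_inl] using hG.depth_edge v w h
    · exact h.elim
    · exact h.elim
    · simpa only [depth_squig_inr] using hH.depth_edge v w h
  exists_edge := by
    rintro (v | v) h
    · rw [depth_squig_inl] at h
      obtain ⟨w, hw⟩ := hG.exists_edge v h
      exact ⟨.inl w, hw⟩
    · rw [depth_squig_inr] at h
      obtain ⟨w, hw⟩ := hH.exists_edge v h
      exact ⟨.inr w, hw⟩

theorem grading_arrow [hG : G.Good] [hH : H.Good] :
    (∀ v w, (G.arrow H).iedge v w →
      Sum.elim (fun x => G.depth x + 1) H.depth v =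
        Sum.elim (fun x => G.depth x + 1) H.depth w + 1) ∧
    ∀ v, Sum.elim (fun x => G.depth x + 1) H.depth v ≠ 0 → ∃ w, (G.arrow H).iedge v w := by
  constructor
  · rintro (v | v) (w | w) h
    · exact congrArg (· + 1) (hG.depth_edge v w h)
    · have := isRoot_iff.1 h.1
      have := isRoot_iff.1 h.2
      simp only [Sum.elim_inl, Sum.elim_inr]
      omega
    · exact h.elim
    · exact hH.depth_edge v w h
  · rintro (v | v) h
    · by_cases hv : G.depth v = 0
      · obtain ⟨r, hr⟩ := exists_root H
        exact ⟨.inr r, isRoot_iff.2 hv, hr⟩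
      · obtain ⟨w, hw⟩ := hG.exists_edge v hv
        exact ⟨.inl w, hw⟩
    · obtain ⟨w, hw⟩ := hH.exists_edge v h
      exact ⟨.inr w, hw⟩

theorem depth_arrow_inl [hG : G.Good] [hH : H.Good] (v : G.V) :
    (G.arrow H).depth (.inl v) = G.depth v + 1 :=
  depth_eq_of_grading (G := G.arrow H) _ grading_arrow.1 grading_arrow.2 (.inl v)

instance good_arrow [hG : G.Good] [hH : H.Good] : (G.arrow H).Good :=
  .of_grading (hG.nonempty.map Sum.inl) _ grading_arrow.1 grading_arrow.2

end Depth

/-! ### Meeting depth in an arrow -/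

section Reach

variable {G H : LGraph α}

theorem reach_arrow_inl_inl {v w : G.V} :
    (G.arrow H).Reach (.inl v) (.inl w) ↔ G.Reach v w := by
  constructor
  · suffices ∀ x y, (G.arrow H).Reach x y → ∀ v w, x = .inl v → y = .inl w → G.Reach v w from
      fun h => this _ _ h v w rfl rfl
    intro x y h
    induction h with
    | refl => rintro v w rfl h; cases h; exact .refl
    | @tail b c _ h ih =>
      rintro v w rfl rfl
      rcases b with b | b
      · exact .tail (ih v b rfl rfl) h
      · exact h.elim
  · intro h
    induction h with
    | refl => exact .refl
    | tail _ h ih => exact .tail ih h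

theorem reach_arrow_inl_inr [hG : G.Good] {v : G.V} {r : H.V} :
    (G.arrow H).Reach (.inl v) (.inr r) ↔ H.IsRoot r := by
  constructor
  · suffices ∀ x y, (G.arrow H).Reach x y → ∀ v r, x = .inl v → y = .inr r → H.IsRoot r from
      fun h => this _ _ h v r rfl rfl
    intro x y h
    induction h with
    | refl => rintro v w rfl h; cases h
    | @tail b c _ h ih =>
      rintro v r rfl rfl
      rcases b with b | b
      · exact h.2
      · exact (ih v b rfl rfl r h).elim
  · intro hr
    obtain ⟨s, hs, h⟩ := exists_reach_root v
    exact .tail (reach_arrow_inl_inl.2 h) ⟨hs, hr⟩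

/-- On the right-hand side, a left vertex reaches exactly the roots. So common descendants are
roots, and any root below `w` is a meeting point of depth 0. -/
theorem meetingDepth_arrow_inl_inr [hG : G.Good] [hH : H.Good] (v : G.V) (w : H.V) :
    (G.arrow H).meetingDepth (.inl v) (.inr w) = 0 ∧
      (G.arrow H).meetingDepth (.inr w) (.inl v) = 0 := by
  obtain ⟨r, hr, hwr⟩ := exists_reach_root w
  have hroot : ∀ u, (G.arrow H).Reach (.inl v) u → (G.arrow H).Reach (.inr w) u →
      (G.arrow H).IsRoot u := by
    intro u h1 h2
    obtain ⟨u, rfl, -⟩ := ((isLowerEmb_arrow_inr G H).reach_iff _ _).1 h2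
    exact ((isLowerEmb_arrow_inr G H).isRoot_iff u).2 (reach_arrow_inl_inr.1 h1)
  have h1 : (G.arrow H).Reach (.inl v) (.inr r) := reach_arrow_inl_inr.2 hr
  have h2 : (G.arrow H).Reach (.inr w) (.inr r) :=
    ((isLowerEmb_arrow_inr G H).reach_iff' _ _).2 hwr
  have hd : (G.arrow H).depth (.inr r) = 0 := by
    rw [depth_arrow_inr]; exact isRoot_iff.1 hr
  constructor
  · exact meetingDepth_eq_zero (u := .inr r)
      ⟨⟨h1, h2⟩, fun u a b c => (c.eq_of_isRoot (hroot u a b)).symm⟩ hd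
  · exact meetingDepth_eq_zero (u := .inr r)
      ⟨⟨h2, h1⟩, fun u a b c => (c.eq_of_isRoot (hroot u b a)).symm⟩ hd

/-- A meeting point inside `G` stays one, at depth greater by one, and it hides the roots of `H`,
which lie below it. Without a meeting point in `G`, the roots of `H` take over at depth 0; the
default `-1` makes this the same formula. -/
theorem meetingDepth_arrow_inl_inl [hG : G.Good] [hH : H.Good] (v w : G.V) :
    (G.arrow H).meetingDepth (.inl v) (.inl w) = G.meetingDepth v w + 1 := by
  by_cases hex : ∃ m, G.IsMeetingPoint v w m
  · obtain ⟨m₀, hm₀⟩ := hex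
    have key : ∀ x, (G.arrow H).IsMeetingPoint (.inl v) (.inl w) x ↔
        ∃ m, x = .inl m ∧ G.IsMeetingPoint v w m := by
      rintro (m | r)
      · constructor
        · rintro ⟨⟨h1, h2⟩, h3⟩
          refine ⟨m, rfl, ⟨reach_arrow_inl_inl.1 h1, reach_arrow_inl_inl.1 h2⟩, fun u a b c => ?_⟩
          exact Sum.inl_injective (h3 (.inl u) (reach_arrow_inl_inl.2 a)
            (reach_arrow_inl_inl.2 b) (reach_arrow_inl_inl.2 c))
        · rintro ⟨_, h, ⟨h1, h2⟩, h3⟩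
          cases h
          refine ⟨⟨reach_arrow_inl_inl.2 h1, reach_arrow_inl_inl.2 h2⟩, ?_⟩
          rintro (u | u) a b c
          · rw [h3 u (reach_arrow_inl_inl.1 a) (reach_arrow_inl_inl.1 b)
              (reach_arrow_inl_inl.1 c)]
          · obtain ⟨x, hx, -⟩ := ((isLowerEmb_arrow_inr G H).reach_iff _ _).1 c
            cases hx
      · constructor
        · rintro ⟨⟨h1, h2⟩, h3⟩
          have := h3 (.inl m₀) (reach_arrow_inl_inl.2 hm₀.1.1) (reach_arrow_inl_inl.2 hm₀.1.2)
            (reach_arrow_inl_inr.2 (reach_arrow_inl_inr.1 h1))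
          cases this
        · rintro ⟨_, h, -⟩
          cases h
    have hset : {n | ∃ u, (G.arrow H).IsMeetingPoint (.inl v) (.inl w) u ∧
        (G.arrow H).depth u = n} =
        (· + 1) '' {n | ∃ u, G.IsMeetingPoint v w u ∧ G.depth u = n} := by
      ext n
      constructor
      · rintro ⟨u, hu, rfl⟩
        obtain ⟨m, rfl, hm⟩ := (key u).1 hu
        exact ⟨_, ⟨m, hm, rfl⟩, (depth_arrow_inl m).symm⟩
      · rintro ⟨_, ⟨m, hm, rfl⟩, rfl⟩
        exact ⟨.inl m, (key _).2 ⟨m, rfl, hm⟩, depth_arrow_inl m⟩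
    have hne : {n | ∃ u, G.IsMeetingPoint v w u ∧ G.depth u = n}.Nonempty := ⟨_, m₀, hm₀, rfl⟩
    have hmin : sInf ((· + 1) '' {n | ∃ u, G.IsMeetingPoint v w u ∧ G.depth u = n}) =
        sInf {n | ∃ u, G.IsMeetingPoint v w u ∧ G.depth u = n} + 1 :=
      (Monotone.map_csInf_of_continuousAt (f := (· + 1 : ℕ → ℕ))
        continuous_of_discreteTopology.continuousAt (fun a b h => Nat.add_le_add_right h 1)
        hne (OrderBot.bddBelow _)).symm
    refine (meetingDepth_of_exists (G := G.arrow H) ⟨.inl m₀, (key _).2 ⟨m₀, rfl, hm₀⟩⟩).trans ?_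
    rw [hset, hmin, meetingDepth_of_exists ⟨m₀, hm₀⟩, Nat.cast_succ]
  · rw [meetingDepth_of_not_exists hex]
    have hno : ∀ u, G.Reach v u → ¬ G.Reach w u := fun u a b => hex (exists_meetingPoint a b)
    obtain ⟨r, hr⟩ := exists_root H
    have hm : (G.arrow H).IsMeetingPoint (.inl v) (.inl w) (.inr r) := by
      refine ⟨⟨reach_arrow_inl_inr.2 hr, reach_arrow_inl_inr.2 hr⟩, ?_⟩
      rintro (u | u) a b c
      · exact (hno u (reach_arrow_inl_inl.1 a) (reach_arrow_inl_inl.1 b)).elim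
      · exact (c.eq_of_isRoot
          (((isLowerEmb_arrow_inr G H).isRoot_iff u).2 (reach_arrow_inl_inr.1 a))).symm
    have hd : (G.arrow H).depth (.inr r) = 0 := by
      rw [depth_arrow_inr]; exact isRoot_iff.1 hr
    exact meetingDepth_eq_zero hm hd

end Reach

/-! ### Conjunctness and disjunctness in compound graphs -/

/-- `R` restricts to `R₁` and `R₂` on the two summands, and the summands are completely related
if `c` holds and completely unrelated otherwise. -/
structure SumRel {V W : Type*} (R : V ⊕ W → V ⊕ W → Prop) (R₁ : V → V → Prop) (R₂ : W → W → Prop)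
    (c : Prop) : Prop where
  ll : ∀ v w, R (.inl v) (.inl w) ↔ R₁ v w
  rr : ∀ v w, R (.inr v) (.inr w) ↔ R₂ v w
  lr : ∀ v w, R (.inl v) (.inr w) ↔ c
  rl : ∀ v w, R (.inr v) (.inl w) ↔ c

section Rel

variable {G H : LGraph α}

theorem rel_irrefl (G : LGraph α) (p : Polarity) (v : G.V) : ¬ G.Rel p v v := by
  cases p <;> exact fun h => h.1 rfl

theorem Rel.ne {p : Polarity} {v w : G.V} (h : G.Rel p v w) : v ≠ w := by
  rintro rfl
  exact rel_irrefl G p v h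

theorem IsMeetingPoint.symm {v w u : G.V} (h : G.IsMeetingPoint v w u) :
    G.IsMeetingPoint w v u :=
  ⟨h.1.symm, fun u' a b c => h.2 u' b a c⟩

theorem meetingDepth_comm (v w : G.V) : G.meetingDepth v w = G.meetingDepth w v := by
  have h : ∀ u, G.IsMeetingPoint v w u ↔ G.IsMeetingPoint w v u :=
    fun u => ⟨IsMeetingPoint.symm, IsMeetingPoint.symm⟩
  by_cases hex : ∃ u, G.IsMeetingPoint v w u
  · rw [meetingDepth_of_exists hex, meetingDepth_of_exists (hex.imp fun u => (h u).1)]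
    simp only [h]
  · rw [meetingDepth_of_not_exists hex,
      meetingDepth_of_not_exists fun ⟨u, hu⟩ => hex ⟨u, (h u).2 hu⟩]

theorem Rel.symm {p : Polarity} {v w : G.V} (h : G.Rel p v w) : G.Rel p w v := by
  cases p
  · exact ⟨h.1.symm, meetingDepth_comm v w ▸ h.2⟩
  · exact ⟨h.1.symm, meetingDepth_comm v w ▸ h.2⟩

/-- The default `-1` is odd, so distinct vertices that never meet count as conjunct. -/
theorem rel_of_neg_one {v w : G.V} (hne : v ≠ w) (h : G.meetingDepth v w = -1) (p : Polarity) :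
    G.Rel p v w ↔ p = .even := by
  cases p <;> simp [Rel, Conj, Disj, h, hne, Int.even_iff]

theorem rel_of_zero {v w : G.V} (hne : v ≠ w) (h : G.meetingDepth v w = 0) (p : Polarity) :
    G.Rel p v w ↔ p = .odd := by
  cases p <;> simp [Rel, Conj, Disj, h, hne]

theorem sumRel_sum (G H : LGraph α) (p : Polarity) :
    SumRel ((G.sum H).Rel p) (G.Rel p) (H.Rel p) (p = .even) where
  ll := (isLowerEmb_sum_inl G H).rel_iff p
  rr := (isLowerEmb_sum_inr G H).rel_iff p
  lr v w := rel_of_neg_one Sum.inl_ne_inr (meetingDepth_of_disjoint fun u a b => by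
    obtain ⟨x, rfl, -⟩ := ((isLowerEmb_sum_inl G H).reach_iff _ _).1 a
    obtain ⟨y, hy, -⟩ := ((isLowerEmb_sum_inr G H).reach_iff _ _).1 b
    cases hy) p
  rl v w := rel_of_neg_one Sum.inr_ne_inl (meetingDepth_of_disjoint fun u a b => by
    obtain ⟨x, rfl, -⟩ := ((isLowerEmb_sum_inr G H).reach_iff _ _).1 a
    obtain ⟨y, hy, -⟩ := ((isLowerEmb_sum_inl G H).reach_iff _ _).1 b
    cases hy) p

theorem sumRel_squig (G H : LGraph α) (p : Polarity) :
    SumRel ((G.squig H).Rel p) (G.Rel p) (H.Rel p) (p = .even) where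
  ll := (isLowerEmb_squig_inl G H).rel_iff p
  rr := (isLowerEmb_squig_inr G H).rel_iff p
  lr v w := rel_of_neg_one Sum.inl_ne_inr (meetingDepth_of_disjoint fun u a b => by
    obtain ⟨x, rfl, -⟩ := ((isLowerEmb_squig_inl G H).reach_iff _ _).1 a
    obtain ⟨y, hy, -⟩ := ((isLowerEmb_squig_inr G H).reach_iff _ _).1 b
    cases hy) p
  rl v w := rel_of_neg_one Sum.inr_ne_inl (meetingDepth_of_disjoint fun u a b => by
    obtain ⟨x, rfl, -⟩ := ((isLowerEmb_squig_inr G H).reach_iff _ _).1 a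
    obtain ⟨y, hy, -⟩ := ((isLowerEmb_squig_inl G H).reach_iff _ _).1 b
    cases hy) p

/-- The shift of meeting depth by one on the left exchanges odd and even, which is where `p.flip`
comes from; cross pairs meet at depth 0 and are disjunct. -/
theorem sumRel_arrow (G H : LGraph α) [G.Good] [H.Good] (p : Polarity) :
    SumRel ((G.arrow H).Rel p) (G.Rel p.flip) (H.Rel p) (p = .odd) where
  ll v w := by
    have hne : (Sum.inl v : G.V ⊕ H.V) ≠ Sum.inl w ↔ v ≠ w := by simp
    have hd := meetingDepth_arrow_inl_inl (H := H) v w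
    cases p
    · refine and_congr hne ((iff_of_eq (congrArg Odd hd)).trans ?_)
      rw [Int.odd_add, ← Int.not_even_iff_odd]; simp
    · refine and_congr hne ((iff_of_eq (congrArg Even hd)).trans ?_)
      rw [Int.even_add_one, Int.not_even_iff_odd]
  rr := (isLowerEmb_arrow_inr G H).rel_iff p
  lr v w := rel_of_zero Sum.inl_ne_inr (meetingDepth_arrow_inl_inr v w).1 p
  rl v w := rel_of_zero Sum.inr_ne_inl (meetingDepth_arrow_inl_inr w v).2 p

end Rel

end LGraph

instance Formula.good_arena {α : Type*} (F : Formula α) : F.arena.Good := by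
  induction F with
  | atom a => exact LGraph.good_single _
  | imp A B _ _ => exact LGraph.good_arrow
  | and A B _ _ => exact LGraph.good_sum
  | box A _ => exact LGraph.good_squig
  | dia A _ => exact LGraph.good_squig
  | diaBot => exact LGraph.good_single _

/-! ### Maximal cliques under joins and unions -/

section Cliques

/-- Maximal cliques of a symmetric relation. -/
structure IsMaxClique {V : Type*} (R : V → V → Prop) (K : Set V) : Prop where
  clique : ∀ x ∈ K, ∀ y ∈ K, x ≠ y → R x y
  maximal : ∀ w, (∀ x ∈ K, x ≠ w → R x w) → w ∈ K

theorem exists_isMaxClique {V : Type*} {R : V → V → Prop} (hR : ∀ x y, R x y → R y x) (v : V) :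
    ∃ K, IsMaxClique R K ∧ v ∈ K := by
  obtain ⟨K, hK, hv⟩ := (Set.subsingleton_singleton (a := v)).isChain (r := R).exists_maxChain
  refine ⟨K, ⟨fun x hx y hy hxy => (hK.1 hx hy hxy).elim id (hR _ _), fun w hw => ?_⟩, hv rfl⟩
  have hc : IsChain R (insert w K) := hK.1.insert fun b hb hwb => .inr (hw b hb hwb.symm)
  rw [hK.2 hc (Set.subset_insert w K)]
  exact Set.mem_insert w K

theorem IsMaxClique.nonempty {V : Type*} [hV : Nonempty V] {R : V → V → Prop} {K : Set V}
    (hK : IsMaxClique R K) : K.Nonempty := by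
  by_contra h
  obtain ⟨v⟩ := hV
  exact h ⟨v, hK.maximal v fun x hx => (h ⟨x, hx⟩).elim⟩

variable {V W V' W' : Type*} {R : V ⊕ W → V ⊕ W → Prop} {R₁ : V → V → Prop} {R₂ : W → W → Prop}
  {S : V' ⊕ W' → V' ⊕ W' → Prop} {S₁ : V' → V' → Prop} {S₂ : W' → W' → Prop} {c : Prop}
  {f₁ : V → V'} {f₂ : W → W'}

namespace LGraph.SumRel

theorem preserves_map (hR : SumRel R R₁ R₂ c) (hS : SumRel S S₁ S₂ c)
    (h₁ : ∀ v w, R₁ v w → S₁ (f₁ v) (f₁ w)) (h₂ : ∀ v w, R₂ v w → S₂ (f₂ v) (f₂ w)) :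
    ∀ v w, R v w → S (Sum.map f₁ f₂ v) (Sum.map f₁ f₂ w) := by
  rintro (v | v) (w | w) h
  · exact (hS.ll _ _).2 (h₁ _ _ ((hR.ll _ _).1 h))
  · exact (hS.lr _ _).2 ((hR.lr _ _).1 h)
  · exact (hS.rl _ _).2 ((hR.rl _ _).1 h)
  · exact (hS.rr _ _).2 (h₂ _ _ ((hR.rr _ _).1 h))

/-- A lifting witness cannot come from the other summand: its relation to `v` would force `c`, and
then its image would be related to `w` as well. -/
theorem lifting_left (hR : SumRel R R₁ R₂ c) (hS : SumRel S S₁ S₂ c)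
    (h : ∀ v w, S (Sum.map f₁ f₂ v) w → ∃ u, R v u ∧ ¬ S (Sum.map f₁ f₂ u) w) (v : V) (w : V')
    (hv : S₁ (f₁ v) w) : ∃ u, R₁ v u ∧ ¬ S₁ (f₁ u) w := by
  obtain ⟨u | u, h1, h2⟩ := h (.inl v) (.inl w) ((hS.ll _ _).2 hv)
  · exact ⟨u, (hR.ll _ _).1 h1, fun h => h2 ((hS.ll _ _).2 h)⟩
  · exact (h2 ((hS.rl _ _).2 ((hR.lr _ _).1 h1))).elim

theorem lifting_right (hR : SumRel R R₁ R₂ c) (hS : SumRel S S₁ S₂ c)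
    (h : ∀ v w, S (Sum.map f₁ f₂ v) w → ∃ u, R v u ∧ ¬ S (Sum.map f₁ f₂ u) w) (v : W) (w : W')
    (hv : S₂ (f₂ v) w) : ∃ u, R₂ v u ∧ ¬ S₂ (f₂ u) w := by
  obtain ⟨u | u, h1, h2⟩ := h (.inr v) (.inr w) ((hS.rr _ _).2 hv)
  · exact (h2 ((hS.lr _ _).2 ((hR.rl _ _).1 h1))).elim
  · exact ⟨u, (hR.rr _ _).1 h1, fun h => h2 ((hS.rr _ _).2 h)⟩

/-- If cross pairs are related, a maximal clique consists of one from each side; otherwise a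
nonempty clique lies on a single side. The hypothesis `h` excludes only a clique living on the wrong
side. -/
theorem isMaxClique_preimage_inl (hR : SumRel R R₁ R₂ c) {K : Set (V ⊕ W)}
    (hK : IsMaxClique R K) (h : c ∨ ∃ v, .inl v ∈ K) : IsMaxClique R₁ (Sum.inl ⁻¹' K) where
  clique x hx y hy hxy := (hR.ll _ _).1 (hK.clique _ hx _ hy (by simpa using hxy))
  maximal w hw := by
    refine hK.maximal _ ?_
    rintro (x | x) hx hne
    · exact (hR.ll _ _).2 (hw x hx (by simpa using hne))
    · rcases h with h | ⟨v, hv⟩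
      · exact (hR.rl _ _).2 h
      · exact (hR.rl _ _).2 ((hR.rl x v).1 (hK.clique _ hx _ hv (by simp)))

theorem isMaxClique_preimage_inr (hR : SumRel R R₁ R₂ c) {K : Set (V ⊕ W)}
    (hK : IsMaxClique R K) (h : c ∨ ∃ v, .inr v ∈ K) : IsMaxClique R₂ (Sum.inr ⁻¹' K) where
  clique x hx y hy hxy := (hR.rr _ _).1 (hK.clique _ hx _ hy (by simpa using hxy))
  maximal w hw := by
    refine hK.maximal _ ?_
    rintro (x | x) hx hne
    · rcases h with h | ⟨v, hv⟩
      · exact (hR.lr _ _).2 h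
      · exact (hR.lr _ _).2 ((hR.lr x v).1 (hK.clique _ hx _ hv (by simp)))
    · exact (hR.rr _ _).2 (hw x hx (by simpa using hne))

/-- The two trace cliques are mapped separately and reassembled. Nonemptiness provides a vertex of
`K`: when cross pairs are unrelated, it prevents extending the image by a vertex of the opposite
side. -/
theorem isMaxClique_map [Nonempty V] [Nonempty W] (hR : SumRel R R₁ R₂ c)
    (hS : SumRel S S₁ S₂ c) (h₁ : ∀ K, IsMaxClique R₁ K → IsMaxClique S₁ (f₁ '' K))
    (h₂ : ∀ K, IsMaxClique R₂ K → IsMaxClique S₂ (f₂ '' K)) (K : Set (V ⊕ W))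
    (hK : IsMaxClique R K) : IsMaxClique S (Sum.map f₁ f₂ '' K) := by
  have k₁ : (c ∨ ∃ v, .inl v ∈ K) → IsMaxClique S₁ (f₁ '' (Sum.inl ⁻¹' K)) :=
    fun h => h₁ _ (hR.isMaxClique_preimage_inl hK h)
  have k₂ : (c ∨ ∃ v, .inr v ∈ K) → IsMaxClique S₂ (f₂ '' (Sum.inr ⁻¹' K)) :=
    fun h => h₂ _ (hR.isMaxClique_preimage_inr hK h)
  constructor
  · rintro _ ⟨x | x, hx, rfl⟩ _ ⟨y | y, hy, rfl⟩ hne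
    · exact (hS.ll _ _).2 ((k₁ (.inr ⟨x, hx⟩)).clique _ ⟨x, hx, rfl⟩ _ ⟨y, hy, rfl⟩
        fun h => hne (congrArg Sum.inl h))
    · exact (hS.lr _ _).2 ((hR.lr x y).1 (hK.clique _ hx _ hy (by simp)))
    · exact (hS.rl _ _).2 ((hR.rl x y).1 (hK.clique _ hx _ hy (by simp)))
    · exact (hS.rr _ _).2 ((k₂ (.inr ⟨x, hx⟩)).clique _ ⟨x, hx, rfl⟩ _ ⟨y, hy, rfl⟩
        fun h => hne (congrArg Sum.inr h))
  · rintro (w | w) hw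
    · have hc : c ∨ ∃ v, .inl v ∈ K := by
        by_cases hc : c
        · exact .inl hc
        · obtain ⟨x | x, hx⟩ := hK.nonempty
          · exact .inr ⟨x, hx⟩
          · exact (hc ((hS.rl (f₂ x) w).1 (hw _ ⟨.inr x, hx, rfl⟩ (by simp)))).elim
      obtain ⟨v, hv, rfl⟩ := (k₁ hc).maximal w (by
        rintro _ ⟨x, hx, rfl⟩ hne
        exact (hS.ll _ _).1 (hw _ ⟨.inl x, hx, rfl⟩ (by simpa using hne)))
      exact ⟨.inl v, hv, rfl⟩
    · have hc : c ∨ ∃ v, .inr v ∈ K := by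
        by_cases hc : c
        · exact .inl hc
        · obtain ⟨x | x, hx⟩ := hK.nonempty
          · exact (hc ((hS.lr (f₁ x) w).1 (hw _ ⟨.inl x, hx, rfl⟩ (by simp)))).elim
          · exact .inr ⟨x, hx⟩
      obtain ⟨v, hv, rfl⟩ := (k₂ hc).maximal w (by
        rintro _ ⟨x, hx, rfl⟩ hne
        exact (hS.rr _ _).1 (hw _ ⟨.inr x, hx, rfl⟩ (by simpa using hne)))
      exact ⟨.inr v, hv, rfl⟩

end LGraph.SumRel

end Cliques

/-! ### Modal homomorphisms between compound arenas -/

namespace LGraph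

variable {α : Type*} {H G K H₁ H₂ G₁ G₂ : LGraph α}

instance [hG : G.Good] : Nonempty G.V := hG.nonempty

theorem IsModalHom.isRoot_iff [H.Good] [G.Good] {f : H.V → G.V} (hf : IsModalHom f) {v : H.V} :
    G.IsRoot (f v) ↔ H.IsRoot v := by
  rw [LGraph.isRoot_iff, LGraph.isRoot_iff, hf.depth]

theorem IsModalHom.comp {f : H.V → K.V} {g : K.V → G.V} (hg : IsModalHom g)
    (hf : IsModalHom f) : IsModalHom (g ∘ f) where
  iedge v w h := hg.iedge _ _ (hf.iedge _ _ h)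
  medge v w h := hg.medge _ _ (hf.medge _ _ h)
  depth v := (hf.depth v).trans (hg.depth _)
  lab v := (hf.lab v).trans (hg.lab _)
  modal v u h := by
    obtain ⟨w, hw, rfl⟩ := hg.modal v _ h
    obtain ⟨x, hx, rfl⟩ := hf.modal w u hw
    exact ⟨x, hx, rfl⟩

theorem isModalHom_id : IsModalHom (id : G.V → G.V) where
  iedge _ _ h := h
  medge _ _ h := h
  depth _ := rfl
  lab _ := rfl
  modal v _ h := ⟨v, h, rfl⟩

theorem IsIso.isModalHom {f : H.V → G.V} (hf : IsIso f) : IsModalHom f where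
  iedge v w := (hf.iedge_iff v w).2
  medge v w := (hf.medge_iff v w).2
  depth v := (hf.isLowerEmb.depth_eq v).symm
  lab v := (hf.lab_eq v).symm
  modal v u h := by
    obtain ⟨w, rfl⟩ := hf.bijective.2 v
    exact ⟨w, (hf.medge_iff _ _).1 h, rfl⟩

theorem isModalHom_sumMap_iff {f₁ : H₁.V → G₁.V} {f₂ : H₂.V → G₂.V} :
    IsModalHom (sumMap f₁ f₂) ↔ IsModalHom f₁ ∧ IsModalHom f₂ := by
  constructor
  · intro h
    refine ⟨⟨fun v w e => h.iedge (.inl v) (.inl w) e, fun v w e => h.medge (.inl v) (.inl w) e,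
      fun v => depth_sum_inl v ▸ (h.depth (.inl v)).trans (depth_sum_inl _),
      fun v => h.lab (.inl v), fun v u e => ?_⟩,
      ⟨fun v w e => h.iedge (.inr v) (.inr w) e, fun v w e => h.medge (.inr v) (.inr w) e,
      fun v => depth_sum_inr v ▸ (h.depth (.inr v)).trans (depth_sum_inr _),
      fun v => h.lab (.inr v), fun v u e => ?_⟩⟩
    · obtain ⟨w | w, hw, he⟩ := h.modal (.inl v) (.inl u) e
      · exact ⟨w, hw, Sum.inl_injective he⟩
      · exact hw.elim
    · obtain ⟨w | w, hw, he⟩ := h.modal (.inr v) (.inr u) e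
      · exact hw.elim
      · exact ⟨w, hw, Sum.inr_injective he⟩
  · rintro ⟨h₁, h₂⟩
    constructor
    · rintro (v | v) (w | w) h
      exacts [h₁.iedge _ _ h, h.elim, h.elim, h₂.iedge _ _ h]
    · rintro (v | v) (w | w) h
      exacts [h₁.medge _ _ h, h.elim, h.elim, h₂.medge _ _ h]
    · rintro (v | v)
      · exact (depth_sum_inl v).trans ((h₁.depth v).trans (depth_sum_inl _).symm)
      · exact (depth_sum_inr v).trans ((h₂.depth v).trans (depth_sum_inr _).symm)
    · rintro (v | v)
      exacts [h₁.lab v, h₂.lab v]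
    · rintro (v | v) (u | u) h
      · obtain ⟨w, hw, rfl⟩ := h₁.modal v u h
        exact ⟨.inl w, hw, rfl⟩
      · exact h.elim
      · exact h.elim
      · obtain ⟨w, hw, rfl⟩ := h₂.modal v u h
        exact ⟨.inr w, hw, rfl⟩

/-- Preservation of depth sends roots to roots, so the new edges are preserved with no further
condition. -/
theorem isModalHom_arrowMap_iff [H₁.Good] [H₂.Good] [G₁.Good] [G₂.Good] {f₁ : H₁.V → G₁.V}
    {f₂ : H₂.V → G₂.V} :
    IsModalHom (arrowMap f₁ f₂) ↔ IsModalHom f₁ ∧ IsModalHom f₂ := by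
  constructor
  · intro h
    refine ⟨⟨fun v w e => h.iedge (.inl v) (.inl w) e, fun v w e => h.medge (.inl v) (.inl w) e,
      fun v => Nat.succ_injective ((depth_arrow_inl v).symm.trans
        ((h.depth (.inl v)).trans (depth_arrow_inl _))),
      fun v => h.lab (.inl v), fun v u e => ?_⟩,
      ⟨fun v w e => h.iedge (.inr v) (.inr w) e, fun v w e => h.medge (.inr v) (.inr w) e,
      fun v => (depth_arrow_inr v).symm.trans ((h.depth (.inr v)).trans (depth_arrow_inr _)),
      fun v => h.lab (.inr v), fun v u e => ?_⟩⟩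
    · obtain ⟨w | w, hw, he⟩ := h.modal (.inl v) (.inl u) e
      · exact ⟨w, hw, Sum.inl_injective he⟩
      · exact hw.elim
    · obtain ⟨w | w, hw, he⟩ := h.modal (.inr v) (.inr u) e
      · exact hw.elim
      · exact ⟨w, hw, Sum.inr_injective he⟩
  · rintro ⟨h₁, h₂⟩
    constructor
    · rintro (v | v) (w | w) h
      exacts [h₁.iedge _ _ h, ⟨h₁.isRoot_iff.2 h.1, h₂.isRoot_iff.2 h.2⟩, h.elim,
        h₂.iedge _ _ h]
    · rintro (v | v) (w | w) h
      exacts [h₁.medge _ _ h, h.elim, h.elim, h₂.medge _ _ h]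
    · rintro (v | v)
      · exact (depth_arrow_inl v).trans
          ((congrArg (· + 1) (h₁.depth v)).trans (depth_arrow_inl _).symm)
      · exact (depth_arrow_inr v).trans ((h₂.depth v).trans (depth_arrow_inr _).symm)
    · rintro (v | v)
      exacts [h₁.lab v, h₂.lab v]
    · rintro (v | v) (u | u) h
      · obtain ⟨w, hw, rfl⟩ := h₁.modal v u h
        exact ⟨.inl w, hw, rfl⟩
      · exact h.elim
      · exact h.elim
      · obtain ⟨w, hw, rfl⟩ := h₂.modal v u h
        exact ⟨.inr w, hw, rfl⟩

theorem isModalHom_squigMap_iff [H.Good] [G.Good] {f : H.V → G.V} {l : Label α} :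
    IsModalHom (squigMap (H₁ := single l) (G₁ := single l) id f) ↔ IsModalHom f := by
  constructor
  · intro h
    refine ⟨fun v w e => h.iedge (.inr v) (.inr w) e, fun v w e => h.medge (.inr v) (.inr w) e,
      fun v => (depth_squig_inr v).symm.trans ((h.depth (.inr v)).trans (depth_squig_inr _)),
      fun v => h.lab (.inr v), fun v u e => ?_⟩
    obtain ⟨w | w, hw, he⟩ := h.modal (.inr v) (.inr u) e
    · cases he
    · exact ⟨w, hw, Sum.inr_injective he⟩
  · intro h
    constructor
    · rintro (v | v) (w | w) e
      exacts [e.elim, e.elim, e.elim, h.iedge _ _ e]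
    · rintro (v | v) (w | w) e
      exacts [e.elim, ⟨e.1, h.isRoot_iff.2 e.2⟩, e.elim, h.medge _ _ e]
    · rintro (v | v)
      · exact (depth_squig_inl v).trans (depth_squig_inl (G := single l) v).symm
      · exact (depth_squig_inr v).trans ((h.depth v).trans (depth_squig_inr _).symm)
    · rintro (v | v)
      exacts [rfl, h.lab v]
    · rintro (v | v) (u | u) e
      · exact e.elim
      · exact ⟨.inl v, ⟨e.1, h.isRoot_iff.1 e.2⟩, rfl⟩
      · exact e.elim
      · obtain ⟨w, hw, rfl⟩ := h.modal v u e
        exact ⟨.inr w, hw, rfl⟩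

theorem isModalHom_copair_iff {f₁ : H₁.V → G.V} {f₂ : H₂.V → G.V} :
    IsModalHom (copair f₁ f₂) ↔ IsModalHom f₁ ∧ IsModalHom f₂ := by
  constructor
  · intro h
    refine ⟨⟨fun v w e => h.iedge (.inl v) (.inl w) e, fun v w e => h.medge (.inl v) (.inl w) e,
      fun v => (depth_sum_inl v).symm.trans (h.depth (.inl v)),
      fun v => h.lab (.inl v), fun v u e => ?_⟩,
      ⟨fun v w e => h.iedge (.inr v) (.inr w) e, fun v w e => h.medge (.inr v) (.inr w) e,
      fun v => (depth_sum_inr v).symm.trans (h.depth (.inr v)),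
      fun v => h.lab (.inr v), fun v u e => ?_⟩⟩
    · obtain ⟨w | w, hw, he⟩ := h.modal v (.inl u) e
      · exact ⟨w, hw, he⟩
      · exact hw.elim
    · obtain ⟨w | w, hw, he⟩ := h.modal v (.inr u) e
      · exact hw.elim
      · exact ⟨w, hw, he⟩
  · rintro ⟨h₁, h₂⟩
    constructor
    · rintro (v | v) (w | w) h
      exacts [h₁.iedge _ _ h, h.elim, h.elim, h₂.iedge _ _ h]
    · rintro (v | v) (w | w) h
      exacts [h₁.medge _ _ h, h.elim, h.elim, h₂.medge _ _ h]
    · rintro (v | v)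
      · exact (depth_sum_inl v).trans (h₁.depth v)
      · exact (depth_sum_inr v).trans (h₂.depth v)
    · rintro (v | v)
      exacts [h₁.lab v, h₂.lab v]
    · rintro v (u | u) h
      · obtain ⟨w, hw, rfl⟩ := h₁.modal v u h
        exact ⟨.inl w, hw, rfl⟩
      · obtain ⟨w, hw, rfl⟩ := h₂.modal v u h
        exact ⟨.inr w, hw, rfl⟩

/-! ### Components of skew fibrations are skew fibrations -/

section Restrict

variable {p : Polarity}

theorem IsSkewFibration.of_sumMap {f₁ : H₁.V → G₁.V} {f₂ : H₂.V → G₂.V}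
    (h : IsSkewFibration p (sumMap f₁ f₂)) : IsSkewFibration p f₁ ∧ IsSkewFibration p f₂ := by
  have hm := isModalHom_sumMap_iff.1 h.toIsModalHom
  have hR := sumRel_sum H₁ H₂ p
  have hS := sumRel_sum G₁ G₂ p
  exact ⟨⟨hm.1, fun v w e => (hS.ll _ _).1 (h.preserves (.inl v) (.inl w) ((hR.ll _ _).2 e)),
    hR.lifting_left hS h.lifting⟩,
    ⟨hm.2, fun v w e => (hS.rr _ _).1 (h.preserves (.inr v) (.inr w) ((hR.rr _ _).2 e)),
    hR.lifting_right hS h.lifting⟩⟩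

theorem IsSkewFibration.of_arrowMap [H₁.Good] [H₂.Good] [G₁.Good] [G₂.Good] {f₁ : H₁.V → G₁.V}
    {f₂ : H₂.V → G₂.V} (h : IsSkewFibration p (arrowMap f₁ f₂)) :
    IsSkewFibration p.flip f₁ ∧ IsSkewFibration p f₂ := by
  have hm := isModalHom_arrowMap_iff.1 h.toIsModalHom
  have hR := sumRel_arrow H₁ H₂ p
  have hS := sumRel_arrow G₁ G₂ p
  exact ⟨⟨hm.1, fun v w e => (hS.ll _ _).1 (h.preserves (.inl v) (.inl w) ((hR.ll _ _).2 e)),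
    hR.lifting_left hS h.lifting⟩,
    ⟨hm.2, fun v w e => (hS.rr _ _).1 (h.preserves (.inr v) (.inr w) ((hR.rr _ _).2 e)),
    hR.lifting_right hS h.lifting⟩⟩

theorem IsSkewFibration.of_squigMap [H.Good] [G.Good] {f : H.V → G.V} {l : Label α}
    (h : IsSkewFibration p (squigMap (H₁ := single l) (G₁ := single l) id f)) :
    IsSkewFibration p f := by
  have hR := sumRel_squig (single l) H p
  have hS := sumRel_squig (single l) G p
  exact ⟨isModalHom_squigMap_iff.1 h.toIsModalHom,
    fun v w e => (hS.rr _ _).1 (h.preserves (.inr v) (.inr w) ((hR.rr _ _).2 e)),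
    hR.lifting_right hS h.lifting⟩

theorem IsSkewFibration.of_copair {f₁ : H₁.V → G.V} {f₂ : H₂.V → G.V}
    (h : IsSkewFibration .odd (copair f₁ f₂)) :
    IsSkewFibration .odd f₁ ∧ IsSkewFibration .odd f₂ := by
  have hm := isModalHom_copair_iff.1 h.toIsModalHom
  have hR := sumRel_sum H₁ H₂ .odd
  refine ⟨⟨hm.1, fun v w e => h.preserves (.inl v) (.inl w) ((hR.ll _ _).2 e), fun v w e => ?_⟩,
    ⟨hm.2, fun v w e => h.preserves (.inr v) (.inr w) ((hR.rr _ _).2 e), fun v w e => ?_⟩⟩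
  · obtain ⟨u | u, h1, h2⟩ := h.lifting (.inl v) w e
    · exact ⟨u, (hR.ll _ _).1 h1, h2⟩
    · cases (hR.lr _ _).1 h1
  · obtain ⟨u | u, h1, h2⟩ := h.lifting (.inr v) w e
    · cases (hR.rl _ _).1 h1
    · exact ⟨u, (hR.rr _ _).1 h1, h2⟩

end Restrict

/-! ### Clique maps -/

/-- Modal arena homomorphisms that preserve cliques and maximal cliques. -/
structure IsCliqueMap (p : Polarity) {H G : LGraph α} (f : H.V → G.V) : Prop
    extends IsModalHom f where
  preserves : ∀ v w, H.Rel p v w → G.Rel p (f v) (f w)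
  maxClique : ∀ K, IsMaxClique (H.Rel p) K → IsMaxClique (G.Rel p) (f '' K)

/-- If lifting failed at `v` and `w`, the image of a maximal clique through `v` would be entirely
related to `w`. Maximality puts `w` in that image, against irreflexivity. -/
theorem IsCliqueMap.isSkewFibration {p : Polarity} {f : H.V → G.V} (hf : IsCliqueMap p f) :
    IsSkewFibration p f where
  toIsModalHom := hf.toIsModalHom
  preserves := hf.preserves
  lifting v w h := by
    obtain ⟨K, hK, hv⟩ := exists_isMaxClique (R := H.Rel p) (fun _ _ h => h.symm) v
    by_contra! hcon
    have hall : ∀ x ∈ K, G.Rel p (f x) w := fun x hx => by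
      by_cases hxv : v = x
      · exact hxv ▸ h
      · exact hcon x (hK.clique v hv x hx hxv)
    obtain ⟨x, hx, rfl⟩ := (hf.maxClique K hK).maximal w (by
      rintro _ ⟨x, hx, rfl⟩ -
      exact hall x hx)
    exact rel_irrefl G p _ (hall x hx)

theorem IsCliqueMap.comp {p : Polarity} {f : H.V → K.V} {g : K.V → G.V} (hg : IsCliqueMap p g)
    (hf : IsCliqueMap p f) : IsCliqueMap p (g ∘ f) where
  toIsModalHom := hg.toIsModalHom.comp hf.toIsModalHom
  preserves v w h := hg.preserves _ _ (hf.preserves _ _ h)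
  maxClique C hC := by
    rw [Set.image_comp]
    exact hg.maxClique _ (hf.maxClique _ hC)

theorem IsIso.isCliqueMap {p : Polarity} {f : H.V → G.V} (hf : IsIso f) : IsCliqueMap p f where
  toIsModalHom := hf.isModalHom
  preserves v w := (hf.isLowerEmb.rel_iff p v w).2
  maxClique C hC := by
    constructor
    · rintro _ ⟨x, hx, rfl⟩ _ ⟨y, hy, rfl⟩ hne
      exact (hf.isLowerEmb.rel_iff p x y).2 (hC.clique x hx y hy fun h => hne (congrArg f h))
    · intro w hw
      obtain ⟨w, rfl⟩ := hf.bijective.2 w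
      refine ⟨w, hC.maximal w fun x hx hne => ?_, rfl⟩
      exact (hf.isLowerEmb.rel_iff p x w).1 (hw _ ⟨x, hx, rfl⟩ fun h => hne (hf.bijective.1 h))

section CliqueMap

variable {p : Polarity}

theorem IsCliqueMap.sumMap [H₁.Good] [H₂.Good] {f₁ : H₁.V → G₁.V} {f₂ : H₂.V → G₂.V}
    (h₁ : IsCliqueMap p f₁) (h₂ : IsCliqueMap p f₂) : IsCliqueMap p (sumMap f₁ f₂) where
  toIsModalHom := isModalHom_sumMap_iff.2 ⟨h₁.toIsModalHom, h₂.toIsModalHom⟩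
  preserves := (sumRel_sum H₁ H₂ p).preserves_map (sumRel_sum G₁ G₂ p) h₁.preserves h₂.preserves
  maxClique :=
    (sumRel_sum H₁ H₂ p).isMaxClique_map (sumRel_sum G₁ G₂ p) h₁.maxClique h₂.maxClique

theorem IsCliqueMap.arrowMap [H₁.Good] [H₂.Good] [G₁.Good] [G₂.Good] {f₁ : H₁.V → G₁.V}
    {f₂ : H₂.V → G₂.V} (h₁ : IsCliqueMap p.flip f₁) (h₂ : IsCliqueMap p f₂) :
    IsCliqueMap p (arrowMap f₁ f₂) where
  toIsModalHom := isModalHom_arrowMap_iff.2 ⟨h₁.toIsModalHom, h₂.toIsModalHom⟩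
  preserves :=
    (sumRel_arrow H₁ H₂ p).preserves_map (sumRel_arrow G₁ G₂ p) h₁.preserves h₂.preserves
  maxClique :=
    (sumRel_arrow H₁ H₂ p).isMaxClique_map (sumRel_arrow G₁ G₂ p) h₁.maxClique h₂.maxClique

theorem IsCliqueMap.squigMap [H.Good] [G.Good] {f : H.V → G.V} {l : Label α}
    (h : IsCliqueMap p f) :
    IsCliqueMap p (squigMap (H₁ := single l) (G₁ := single l) id f) where
  toIsModalHom := isModalHom_squigMap_iff.2 h.toIsModalHom
  preserves := (sumRel_squig (single l) H p).preserves_map (sumRel_squig (single l) G p)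
    (fun _ _ h => h) h.preserves
  maxClique := (sumRel_squig (single l) H p).isMaxClique_map (sumRel_squig (single l) G p)
    (fun K hK => by rwa [Set.image_id]) h.maxClique

/-- With unrelated sides, a nonempty clique cannot be enlarged across. This is what makes each
weakening rule a clique map in its own polarity. -/
theorem SumRel.isMaxClique_image_inl {V W : Type*} [Nonempty V] {R : V ⊕ W → V ⊕ W → Prop}
    {R₁ : V → V → Prop} {R₂ : W → W → Prop} {c : Prop} (h : SumRel R R₁ R₂ c) (hc : ¬ c)
    (K : Set V) (hK : IsMaxClique R₁ K) : IsMaxClique R (Sum.inl '' K) := by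
  constructor
  · rintro _ ⟨x, hx, rfl⟩ _ ⟨y, hy, rfl⟩ hne
    exact (h.ll _ _).2 (hK.clique x hx y hy fun h => hne (congrArg _ h))
  · rintro (w | w) hw
    · exact ⟨w, hK.maximal w fun x hx hne =>
        (h.ll _ _).1 (hw _ ⟨x, hx, rfl⟩ (by simpa using hne)), rfl⟩
    · obtain ⟨x, hx⟩ := hK.nonempty
      exact (hc ((h.lr x w).1 (hw _ ⟨x, hx, rfl⟩ (by simp)))).elim

theorem SumRel.isMaxClique_image_inr {V W : Type*} [Nonempty W] {R : V ⊕ W → V ⊕ W → Prop}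
    {R₁ : V → V → Prop} {R₂ : W → W → Prop} {c : Prop} (h : SumRel R R₁ R₂ c) (hc : ¬ c)
    (K : Set W) (hK : IsMaxClique R₂ K) : IsMaxClique R (Sum.inr '' K) := by
  constructor
  · rintro _ ⟨x, hx, rfl⟩ _ ⟨y, hy, rfl⟩ hne
    exact (h.rr _ _).2 (hK.clique x hx y hy fun h => hne (congrArg _ h))
  · rintro (w | w) hw
    · obtain ⟨x, hx⟩ := hK.nonempty
      exact (hc ((h.rl x w).1 (hw _ ⟨x, hx, rfl⟩ (by simp)))).elim
    · exact ⟨w, hK.maximal w fun x hx hne =>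
        (h.rr _ _).1 (hw _ ⟨x, hx, rfl⟩ (by simpa using hne)), rfl⟩

theorem isModalHom_sum_inl (G H : LGraph α) :
    IsModalHom (H := G) (G := G.sum H) Sum.inl where
  iedge _ _ h := h
  medge _ _ h := h
  depth v := (depth_sum_inl v).symm
  lab _ := rfl
  modal v u h := by
    rcases v with v | v
    · exact ⟨v, h, rfl⟩
    · exact h.elim

theorem isModalHom_arrow_inr (G H : LGraph α) :
    IsModalHom (H := H) (G := G.arrow H) Sum.inr where
  iedge _ _ h := h
  medge _ _ h := h
  depth v := (depth_arrow_inr v).symm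
  lab _ := rfl
  modal v u h := by
    rcases v with v | v
    · exact h.elim
    · exact ⟨v, h, rfl⟩

theorem isModalHom_squig_inl (l : Label α) (H : LGraph α) :
    IsModalHom (H := single l) (G := (single l).squig H) Sum.inl where
  iedge _ _ h := h
  medge _ _ h := h
  depth v := (depth_squig_inl v).symm
  lab _ := rfl
  modal v u h := by
    rcases v with v | v
    · exact ⟨v, h, rfl⟩
    · exact h.elim

theorem isCliqueMap_sum_inl (G H : LGraph α) [G.Good] :
    IsCliqueMap .odd (H := G) (G := G.sum H) Sum.inl where
  toIsModalHom := isModalHom_sum_inl G H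
  preserves v w := ((sumRel_sum G H .odd).ll v w).2
  maxClique := (sumRel_sum G H .odd).isMaxClique_image_inl nofun

theorem isCliqueMap_arrow_inr (G H : LGraph α) [G.Good] [H.Good] :
    IsCliqueMap .even (H := H) (G := G.arrow H) Sum.inr where
  toIsModalHom := isModalHom_arrow_inr G H
  preserves v w := ((sumRel_arrow G H .even).rr v w).2
  maxClique := (sumRel_arrow G H .even).isMaxClique_image_inr nofun

theorem isCliqueMap_squig_inl (l : Label α) (H : LGraph α) :
    IsCliqueMap .odd (H := single l) (G := (single l).squig H) Sum.inl where
  toIsModalHom := isModalHom_squig_inl l H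
  preserves v w := ((sumRel_squig (single l) H .odd).ll v w).2
  maxClique := (sumRel_squig (single l) H .odd).isMaxClique_image_inl nofun

/-- For disjunctness the two copies of `G` are unrelated, so a maximal clique lies in one copy and
is mapped to itself. -/
theorem isCliqueMap_codiagonal (G : LGraph α) [hG : G.Good] :
    IsCliqueMap .odd (copair (id : G.V → G.V) (id : G.V → G.V)) where
  toIsModalHom := isModalHom_copair_iff.2 ⟨isModalHom_id, isModalHom_id⟩
  preserves := by
    have hR := sumRel_sum G G .odd
    rintro (v | v) (w | w) h
    · exact (hR.ll _ _).1 h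
    · cases (hR.lr _ _).1 h
    · cases (hR.rl _ _).1 h
    · exact (hR.rr _ _).1 h
  maxClique K hK := by
    have hR := sumRel_sum G G .odd
    have : Nonempty (G.sum G).V := good_sum.nonempty
    obtain ⟨v | v, hv⟩ := hK.nonempty
    · have : copair id id '' K = Sum.inl ⁻¹' K := by
        ext x
        constructor
        · rintro ⟨y | y, hy, rfl⟩
          · exact hy
          · cases (hR.lr _ _).1 (hK.clique _ hv _ hy Sum.inl_ne_inr)
        · exact fun hx => ⟨.inl x, hx, rfl⟩
      rw [this]
      exact hR.isMaxClique_preimage_inl hK (.inr ⟨v, hv⟩)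
    · have : copair id id '' K = Sum.inr ⁻¹' K := by
        ext x
        constructor
        · rintro ⟨y | y, hy, rfl⟩
          · cases (hR.rl _ _).1 (hK.clique _ hv _ hy Sum.inr_ne_inl)
          · exact hy
        · exact fun hx => ⟨.inr x, hx, rfl⟩
      rw [this]
      exact hR.isMaxClique_preimage_inr hK (.inr ⟨v, hv⟩)

end CliqueMap

end LGraph

section

open LGraph

variable {α : Type*}

/-! ### Arena isomorphisms for commutativity, associativity and currying -/

section Rearrangement

variable (A B C : Formula α)

/-- The isomorphism of arenas for the commutativity of `∧`. -/
def andComm : (A.and B).arena.V ≃ (B.and A).arena.V := Equiv.sumComm _ _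

/-- The isomorphism of arenas for the associativity of `∧`. -/
def andAssoc : ((A.and B).and C).arena.V ≃ (A.and (B.and C)).arena.V := Equiv.sumAssoc _ _ _

/-- The isomorphism of arenas for currying. -/
def impCurry : (Formula.imp (A.and B) C).arena.V ≃ (A.imp (B.imp C)).arena.V :=
  Equiv.sumAssoc _ _ _

theorem isIso_andComm : IsIso (andComm A B) where
  bijective := (andComm A B).bijective
  iedge_iff := by rintro (_ | _) (_ | _) <;> exact Iff.rfl
  medge_iff := by rintro (_ | _) (_ | _) <;> exact Iff.rfl
  lab_eq := by rintro (_ | _) <;> rfl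

theorem isIso_andAssoc : IsIso (andAssoc A B C) where
  bijective := (andAssoc A B C).bijective
  iedge_iff := by rintro ((_ | _) | _) ((_ | _) | _) <;> exact Iff.rfl
  medge_iff := by rintro ((_ | _) | _) ((_ | _) | _) <;> exact Iff.rfl
  lab_eq := by rintro ((_ | _) | _) <;> rfl

theorem isIso_impCurry : IsIso (impCurry A B C) where
  bijective := (impCurry A B C).bijective
  iedge_iff := by
    have h1 : ∀ v, (A.and B).arena.IsRoot (.inl v) ↔ A.arena.IsRoot v :=
      (isLowerEmb_sum_inl A.arena B.arena).isRoot_iff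
    have h2 : ∀ v, (A.and B).arena.IsRoot (.inr v) ↔ B.arena.IsRoot v :=
      (isLowerEmb_sum_inr A.arena B.arena).isRoot_iff
    have h3 : ∀ v, (B.imp C).arena.IsRoot (.inr v) ↔ C.arena.IsRoot v :=
      (isLowerEmb_arrow_inr B.arena C.arena).isRoot_iff
    -- Antecedent vertices are not roots, so the nested arrow creates no edge from `A` to `B`, just
    -- as in the disjoint union.
    have h4 : ∀ v, ¬ (B.imp C).arena.IsRoot (.inl v) := fun v h => by
      have h0 : (B.arena.arrow C.arena).depth (.inl v) = 0 := isRoot_iff.1 h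
      rw [depth_arrow_inl] at h0
      cases h0
    rintro ((v | v) | v) ((w | w) | w)
    · exact Iff.rfl
    · exact ⟨fun h => (h4 w h.2).elim, fun h => h.elim⟩
    · exact and_congr (h1 v).symm (h3 w)
    · exact Iff.rfl
    · exact Iff.rfl
    · exact and_congr (h2 v).symm Iff.rfl
    · exact Iff.rfl
    · exact Iff.rfl
    · exact Iff.rfl
  medge_iff := by rintro ((_ | _) | _) ((_ | _) | _) <;> exact Iff.rfl
  lab_eq := by rintro ((_ | _) | _) <;> rfl

end Rearrangement

theorem LGraph.IsIso.symm {G H : LGraph α} {e : G.V ≃ H.V} (he : IsIso e) : IsIso e.symm where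
  bijective := e.symm.bijective
  iedge_iff v w := by simpa using (he.iedge_iff (e.symm v) (e.symm w)).symm
  medge_iff v w := by simpa using (he.medge_iff (e.symm v) (e.symm w)).symm
  lab_eq v := by simpa using (he.lab_eq (e.symm v)).symm

theorem LGraph.IsIso.trans {G H K : LGraph α} {e : G.V → H.V} {f : H.V → K.V} (he : IsIso e)
    (hf : IsIso f) : IsIso (f ∘ e) where
  bijective := hf.bijective.comp he.bijective
  iedge_iff _ _ := (hf.iedge_iff _ _).trans (he.iedge_iff _ _)
  medge_iff _ _ := (hf.medge_iff _ _).trans (he.medge_iff _ _)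
  lab_eq _ := (hf.lab_eq _).trans (he.lab_eq _)

/-! ### Maps witnessed by derivations -/

/-- The maps between arenas of formulas that are witnessed by a derivation with the deep weakening
and contraction rules and formula isomorphism. -/
inductive Der : Polarity → (F' F : Formula α) → (F'.arena.V → F.arena.V) → Prop
  | refl (p : Polarity) (F : Formula α) : Der p F F id
  | comp {p : Polarity} {F K G : Formula α} {f : F.arena.V → K.arena.V}
      {g : K.arena.V → G.arena.V} (hf : Der p F K f) (hg : Der p K G g) : Der p F G (g ∘ f)
  | and {p : Polarity} {A A' B B' : Formula α} {f : A.arena.V → A'.arena.V}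
      {g : B.arena.V → B'.arena.V} (hf : Der p A A' f) (hg : Der p B B' g) :
      Der p (A.and B) (A'.and B') (sumMap f g)
  | imp {p : Polarity} {A A' B B' : Formula α} {f : A.arena.V → A'.arena.V}
      {g : B.arena.V → B'.arena.V} (hf : Der p.flip A A' f) (hg : Der p B B' g) :
      Der p (A.imp B) (A'.imp B') (arrowMap f g)
  | box {p : Polarity} {A A' : Formula α} {f : A.arena.V → A'.arena.V} (hf : Der p A A' f) :
      Der p A.box A'.box (squigMap (H₁ := single .box) (G₁ := single .box) id f)
  | dia {p : Polarity} {A A' : Formula α} {f : A.arena.V → A'.arena.V} (hf : Der p A A' f) :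
      Der p A.dia A'.dia (squigMap (H₁ := single .dia) (G₁ := single .dia) id f)
  | comm (p : Polarity) (A B : Formula α) : Der p (A.and B) (B.and A) (andComm A B)
  | assoc (p : Polarity) (A B C : Formula α) :
      Der p ((A.and B).and C) (A.and (B.and C)) (andAssoc A B C)
  | assocSymm (p : Polarity) (A B C : Formula α) :
      Der p (A.and (B.and C)) ((A.and B).and C) (andAssoc A B C).symm
  | curry (p : Polarity) (A B C : Formula α) :
      Der p (.imp (A.and B) C) (A.imp (B.imp C)) (impCurry A B C)
  | currySymm (p : Polarity) (A B C : Formula α) :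
      Der p (A.imp (B.imp C)) (.imp (A.and B) C) (impCurry A B C).symm
  | weakDia (A : Formula α) : Der .odd .diaBot A.dia Sum.inl
  | weakAnd (A B : Formula α) : Der .odd A (A.and B) Sum.inl
  | weakImp (A B : Formula α) : Der .even A (B.imp A) Sum.inr
  | contr (A : Formula α) : Der .odd (A.and A) A (copair (H₁ := A.arena) (H₂ := A.arena) id id)

namespace Der

theorem isCliqueMap {p : Polarity} {F' F : Formula α} {f : F'.arena.V → F.arena.V}
    (h : Der p F' F f) : IsCliqueMap p f := by
  induction h with
  | refl p F =>
    exact ⟨isModalHom_id, fun _ _ h => h, fun K hK => by rwa [Set.image_id]⟩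
  | comp _ _ ihf ihg => exact ihg.comp ihf
  | and _ _ ihf ihg => exact ihf.sumMap ihg
  | imp _ _ ihf ihg => exact ihf.arrowMap ihg
  | box _ ih => exact ih.squigMap
  | dia _ ih => exact ih.squigMap
  | comm p A B => exact (isIso_andComm A B).isCliqueMap
  | assoc p A B C => exact (isIso_andAssoc A B C).isCliqueMap
  | assocSymm p A B C => exact (isIso_andAssoc A B C).symm.isCliqueMap
  | curry p A B C => exact (isIso_impCurry A B C).isCliqueMap
  | currySymm p A B C => exact (isIso_impCurry A B C).symm.isCliqueMap
  | weakDia A => exact isCliqueMap_squig_inl _ _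
  | weakAnd A B => exact isCliqueMap_sum_inl _ _
  | weakImp A B => exact isCliqueMap_arrow_inr _ _
  | contr A => exact isCliqueMap_codiagonal _

end Der

/-! ### Derivation maps are built from the basic maps -/

section Built

/-- The graph without vertices. -/
def emptyGraph (α : Type*) : LGraph α where
  V := Empty
  iedge _ _ := False
  medge _ _ := False
  lab := Empty.elim

theorem isArena_arena (F : Formula α) : F.arena.IsArena :=
  ⟨F, id, Function.bijective_id, fun _ _ => Iff.rfl, fun _ _ => Iff.rfl, fun _ => rfl⟩

theorem isIso_sum_empty (G : LGraph α) :
    IsIso (H := G) (G := G.sum (emptyGraph α)) Sum.inl where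
  bijective := ⟨Sum.inl_injective, by
    rintro (v | v)
    · exact ⟨v, rfl⟩
    · exact Empty.elim v⟩
  iedge_iff _ _ := Iff.rfl
  medge_iff _ _ := Iff.rfl
  lab_eq _ := rfl

theorem isIso_empty_arrow (G : LGraph α) :
    IsIso (H := G) (G := (emptyGraph α).arrow G) Sum.inr where
  bijective := ⟨Sum.inr_injective, by
    rintro (v | v)
    · exact Empty.elim v
    · exact ⟨v, rfl⟩⟩
  iedge_iff _ _ := Iff.rfl
  medge_iff _ _ := Iff.rfl
  lab_eq _ := rfl

theorem isIso_squig_empty (G : LGraph α) :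
    IsIso (H := G) (G := G.squig (emptyGraph α)) Sum.inl where
  bijective := ⟨Sum.inl_injective, by
    rintro (v | v)
    · exact ⟨v, rfl⟩
    · exact Empty.elim v⟩
  iedge_iff _ _ := Iff.rfl
  medge_iff _ _ := Iff.rfl
  lab_eq _ := rfl

theorem built_empty (F : Formula α) :
    Built .odd (H := emptyGraph α) (G := F.arena) Empty.elim :=
  .empty (inferInstanceAs (IsEmpty Empty)) (isArena_arena F)

theorem built_id (p : Polarity) (F : Formula α) : Built p (id : F.arena.V → F.arena.V) :=
  .iso (isArena_arena F)
    ⟨Function.bijective_id, fun _ _ => Iff.rfl, fun _ _ => Iff.rfl, fun _ => rfl⟩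

/-- A weakening is an isomorphism that adjoins the empty graph, followed by the compound of an
identity with the empty map. The intermediate graph is an arena because adjoining nothing does not
change it up to isomorphism. -/
theorem Der.built {p : Polarity} {F' F : Formula α} {f : F'.arena.V → F.arena.V}
    (h : Der p F' F f) : Built p f := by
  induction h with
  | refl p F => exact built_id p F
  | comp _ _ ihf ihg => exact .comp (isArena_arena _) ihf ihg
  | and _ _ ihf ihg => exact .sum ihf ihg
  | @imp p A A' B B' f g _ _ ihf ihg => exact .arrow ihf ihg B.good_arena.nonempty
  | box _ ih => exact .squig (.inl rfl) ih
  | dia _ ih => exact .squig (.inr rfl) ih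
  | comm p A B => exact .iso (isArena_arena _) (isIso_andComm A B)
  | assoc p A B C => exact .iso (isArena_arena _) (isIso_andAssoc A B C)
  | assocSymm p A B C => exact .iso (isArena_arena _) (isIso_andAssoc A B C).symm
  | curry p A B C => exact .iso (isArena_arena _) (isIso_impCurry A B C)
  | currySymm p A B C => exact .iso (isArena_arena _) (isIso_impCurry A B C).symm
  | weakDia A =>
    have h1 := isIso_squig_empty (single (α := α) .dia)
    exact .comp (K := (single .dia).squig (emptyGraph α)) ⟨.diaBot, _, h1⟩
      (.iso (isArena_arena .diaBot) h1) (.squig (.inr rfl) (built_empty A))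
  | weakAnd A B =>
    have h1 := isIso_sum_empty A.arena
    exact .comp (K := A.arena.sum (emptyGraph α)) ⟨A, _, h1⟩
      (.iso (isArena_arena A) h1) (.sum (built_id _ A) (built_empty B))
  | weakImp A B =>
    have h1 := isIso_empty_arrow A.arena
    exact .comp (K := (emptyGraph α).arrow A.arena) ⟨A, _, h1⟩
      (.iso (isArena_arena A) h1) (.arrow (p := .even) (built_empty B) (built_id _ A) A.good_arena.nonempty)
  | contr A => exact .copair (built_id _ A) (built_id _ A)

end Built

/-! ### Derivation maps and derivability of polarized formulas -/

namespace PFormula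

theorem erase_injective {p : Polarity} :
    Function.Injective (erase : PFormula α p → Formula α) := by
  intro X
  induction X with
  | atom a => intro Y h; cases Y <;> simp_all [erase]
  | tensor A B ihA ihB =>
    intro Y h
    cases Y <;> simp only [erase, Formula.and.injEq, reduceCtorEq] at h
    rw [ihA h.1, ihB h.2]
  | limp A B ihA ihB =>
    intro Y h
    cases Y <;> simp only [erase, Formula.imp.injEq, reduceCtorEq] at h
    rw [ihA h.1, ihB h.2]
  | box A ih =>
    intro Y h
    cases Y <;> simp only [erase, Formula.box.injEq, reduceCtorEq] at h
    rw [ih h]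
  | dia A ih =>
    intro Y h
    cases Y <;> simp only [erase, Formula.dia.injEq, reduceCtorEq] at h
    rw [ih h]
  | diaBot => intro Y h; cases Y <;> simp_all [erase]

theorem Derives.congr {p p' : Polarity} (φ : PFormula α p → PFormula α p')
    (c : ∀ q, Ctx α q p → Ctx α q p')
    (hc : ∀ q (C : Ctx α q p) X, (c q C).fill X = φ (C.fill X)) {X Y : PFormula α p}
    (h : Derives X Y) : Derives (φ X) (φ Y) := by
  refine Relation.ReflTransGen.lift φ ?_ X Y h
  rintro X Y (⟨q, C, A', A, hr, rfl, rfl⟩ | h)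
  · exact .inl ⟨q, c q C, A', A, hr, (hc _ _ _).symm, (hc _ _ _).symm⟩
  · right
    induction h with
    | rel X Y h =>
      obtain ⟨q, C, A, B, hr, rfl, rfl⟩ := h
      exact .rel _ _ ⟨q, c q C, A, B, hr, (hc _ _ _).symm, (hc _ _ _).symm⟩
    | refl X => exact .refl _
    | symm _ _ _ ih => exact .symm _ _ ih
    | trans _ _ _ _ _ ih₁ ih₂ => exact .trans _ _ _ ih₁ ih₂

theorem Derives.of_rule {p : Polarity} {X Y : PFormula α p} (h : Rule X Y) : Derives X Y :=
  .single (.inl ⟨p, .hole, X, Y, h, rfl, rfl⟩)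

theorem Derives.of_iso {p : Polarity} {X Y : PFormula α p} (h : IsoRule X Y) : Derives X Y :=
  .single (.inr (.rel _ _ ⟨p, .hole, X, Y, h, rfl, rfl⟩))

theorem Derives.of_iso_symm {p : Polarity} {X Y : PFormula α p} (h : IsoRule X Y) :
    Derives Y X :=
  .single (.inr (.symm _ _ (.rel _ _ ⟨p, .hole, X, Y, h, rfl, rfl⟩)))

theorem Derives.tensor {p : Polarity} {A A' B B' : PFormula α p} (hA : Derives A A')
    (hB : Derives B B') : Derives (tensor A B) (tensor A' B') :=
  (hA.congr (PFormula.tensor · B) (fun _ C => .tensorL C B) fun _ _ _ => rfl).trans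
    (hB.congr (PFormula.tensor A' ·) (fun _ C => .tensorR A' C) fun _ _ _ => rfl)

theorem Derives.limp {p : Polarity} {A A' : PFormula α p.flip} {B B' : PFormula α p}
    (hA : Derives A A') (hB : Derives B B') : Derives (limp A B) (limp A' B') :=
  (hA.congr (PFormula.limp · B) (fun _ C => .limpL C B) fun _ _ _ => rfl).trans
    (hB.congr (PFormula.limp A' ·) (fun _ C => .limpR A' C) fun _ _ _ => rfl)

theorem Derives.box {p : Polarity} {A A' : PFormula α p} (h : Derives A A') :
    Derives (box A) (box A') :=
  h.congr PFormula.box (fun _ C => .box C) fun _ _ _ => rfl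

theorem Derives.dia {p : Polarity} {A A' : PFormula α p} (h : Derives A A') :
    Derives (dia A) (dia A') :=
  h.congr PFormula.dia (fun _ C => .dia C) fun _ _ _ => rfl

theorem exists_tensor {p : Polarity} {H : PFormula α p} {A B : Formula α}
    (h : H.erase = A.and B) : ∃ A' B', H = tensor A' B' ∧ A'.erase = A ∧ B'.erase = B := by
  cases H <;> simp only [erase, Formula.and.injEq, reduceCtorEq] at h
  exact ⟨_, _, rfl, h⟩

theorem exists_limp {p : Polarity} {H : PFormula α p} {A B : Formula α}
    (h : H.erase = A.imp B) :
    ∃ A' B', H = PFormula.limp A' B' ∧ A'.erase = A ∧ B'.erase = B := by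
  cases H <;> simp only [erase, Formula.imp.injEq, reduceCtorEq] at h
  exact ⟨_, _, rfl, h⟩

theorem exists_box {p : Polarity} {H : PFormula α p} {A : Formula α} (h : H.erase = A.box) :
    ∃ A', H = PFormula.box A' ∧ A'.erase = A := by
  cases H <;> simp only [erase, Formula.box.injEq, reduceCtorEq] at h
  exact ⟨_, rfl, h⟩

theorem exists_dia {p : Polarity} {H : PFormula α p} {A : Formula α} (h : H.erase = A.dia) :
    ∃ A', H = PFormula.dia A' ∧ A'.erase = A := by
  cases H <;> simp only [erase, Formula.dia.injEq, reduceCtorEq] at h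
  exact ⟨_, rfl, h⟩

/-- `Der` speaks of unpolarized formulas, so the intermediate formulas of a composite need
polarities. These are inherited backwards, from conclusion to premise; that the premise is the
expected one follows afterwards from `erase_injective`. -/
theorem exists_derives {p : Polarity} {F' F : Formula α} {f : F'.arena.V → F.arena.V}
    (h : Der p F' F f) (H : PFormula α p) (hH : H.erase = F) :
    ∃ H' : PFormula α p, H'.erase = F' ∧ Derives H' H := by
  induction h with
  | refl p F => exact ⟨H, hH, .refl⟩
  | comp _ _ ihf ihg =>
    obtain ⟨K, hK, d₁⟩ := ihg H hH
    obtain ⟨L, hL, d₂⟩ := ihf K hK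
    exact ⟨L, hL, d₂.trans d₁⟩
  | and _ _ ihf ihg =>
    obtain ⟨A, B, rfl, hA, hB⟩ := exists_tensor hH
    obtain ⟨A', rfl, dA⟩ := ihf A hA
    obtain ⟨B', rfl, dB⟩ := ihg B hB
    exact ⟨_, rfl, dA.tensor dB⟩
  | imp _ _ ihf ihg =>
    obtain ⟨A, B, rfl, hA, hB⟩ := exists_limp hH
    obtain ⟨A', rfl, dA⟩ := ihf A hA
    obtain ⟨B', rfl, dB⟩ := ihg B hB
    exact ⟨_, rfl, dA.limp dB⟩
  | box _ ih =>
    obtain ⟨A, rfl, hA⟩ := exists_box hH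
    obtain ⟨A', rfl, dA⟩ := ih A hA
    exact ⟨_, rfl, dA.box⟩
  | dia _ ih =>
    obtain ⟨A, rfl, hA⟩ := exists_dia hH
    obtain ⟨A', rfl, dA⟩ := ih A hA
    exact ⟨_, rfl, dA.dia⟩
  | comm p A B =>
    obtain ⟨B, A, rfl, rfl, rfl⟩ := exists_tensor hH
    exact ⟨_, rfl, .of_iso (.comm A B)⟩
  | assoc p A B C =>
    obtain ⟨A, D, rfl, rfl, hD⟩ := exists_tensor hH
    obtain ⟨B, C, rfl, rfl, rfl⟩ := exists_tensor hD
    exact ⟨_, rfl, .of_iso_symm (.assoc A B C)⟩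
  | assocSymm p A B C =>
    obtain ⟨D, C, rfl, hD, rfl⟩ := exists_tensor hH
    obtain ⟨A, B, rfl, rfl, rfl⟩ := exists_tensor hD
    exact ⟨_, rfl, .of_iso (.assoc A B C)⟩
  | curry p A B C =>
    obtain ⟨A, D, rfl, rfl, hD⟩ := exists_limp hH
    obtain ⟨B, C, rfl, rfl, rfl⟩ := exists_limp hD
    exact ⟨_, rfl, .of_iso (.curry A B C)⟩
  | currySymm p A B C =>
    obtain ⟨D, C, rfl, hD, rfl⟩ := exists_limp hH
    obtain ⟨A, B, rfl, rfl, rfl⟩ := exists_tensor hD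
    exact ⟨_, rfl, .of_iso_symm (.curry A B C)⟩
  | weakDia A =>
    obtain ⟨A, rfl, rfl⟩ := exists_dia hH
    exact ⟨_, rfl, .of_rule (.weakDia A)⟩
  | weakAnd A B =>
    obtain ⟨A, B, rfl, rfl, rfl⟩ := exists_tensor hH
    exact ⟨_, rfl, .of_rule (.weakTensor A B)⟩
  | weakImp A B =>
    obtain ⟨B, A, rfl, rfl, rfl⟩ := exists_limp hH
    exact ⟨_, rfl, .of_rule (.weakLimp A B)⟩
  | contr A =>
    subst hH
    exact ⟨_, rfl, .of_rule (.contr H)⟩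

theorem Derives.of_der {p : Polarity} {H' H : PFormula α p} {f : H'.arena.V → H.arena.V}
    (h : Der p H'.erase H.erase f) : Derives H' H := by
  obtain ⟨K, hK, d⟩ := exists_derives h H rfl
  rwa [erase_injective hK] at d

theorem exists_der_fill {p q : Polarity} (C : Ctx α q p) {X Y : PFormula α q}
    (h : ∃ f, Der q X.erase Y.erase f) :
    ∃ f, Der p (C.fill X).erase (C.fill Y).erase f := by
  induction C with
  | hole => exact h
  | tensorL C B ih => obtain ⟨f, hf⟩ := ih; exact ⟨_, .and hf (.refl _ _)⟩
  | tensorR A C ih => obtain ⟨f, hf⟩ := ih; exact ⟨_, .and (.refl _ _) hf⟩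
  | limpL C B ih => obtain ⟨f, hf⟩ := ih; exact ⟨_, .imp hf (.refl _ _)⟩
  | limpR A C ih => obtain ⟨f, hf⟩ := ih; exact ⟨_, .imp (.refl _ _) hf⟩
  | box C ih => obtain ⟨f, hf⟩ := ih; exact ⟨_, .box hf⟩
  | dia C ih => obtain ⟨f, hf⟩ := ih; exact ⟨_, .dia hf⟩

theorem exists_der_of_rule {q : Polarity} {X Y : PFormula α q} (h : Rule X Y) :
    ∃ f, Der q X.erase Y.erase f := by
  cases h with
  | weakDia A => exact ⟨_, .weakDia _⟩
  | weakTensor A B => exact ⟨_, .weakAnd _ _⟩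
  | weakLimp A B => exact ⟨_, .weakImp _ _⟩
  | contr A => exact ⟨_, .contr _⟩

theorem exists_der_of_isoRule {q : Polarity} {X Y : PFormula α q} (h : IsoRule X Y) :
    (∃ f, Der q X.erase Y.erase f) ∧ ∃ f, Der q Y.erase X.erase f := by
  cases h with
  | comm A B => exact ⟨⟨_, .comm _ _ _⟩, ⟨_, .comm _ _ _⟩⟩
  | assoc A B C => exact ⟨⟨_, .assocSymm _ _ _ _⟩, ⟨_, .assoc _ _ _ _⟩⟩
  | curry A B C => exact ⟨⟨_, .curry _ _ _ _⟩, ⟨_, .currySymm _ _ _ _⟩⟩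

/-- Both directions are carried along because the generated equivalence is closed under symmetry
while `Der` is not. -/
theorem FormulaIso.exists_der {p : Polarity} {X Y : PFormula α p} (h : FormulaIso X Y) :
    (∃ f, Der p X.erase Y.erase f) ∧ ∃ f, Der p Y.erase X.erase f := by
  induction h with
  | rel X Y h =>
    obtain ⟨q, C, A, B, hr, rfl, rfl⟩ := h
    have := exists_der_of_isoRule hr
    exact ⟨exists_der_fill C this.1, exists_der_fill C this.2⟩
  | refl X => exact ⟨⟨_, .refl _ _⟩, ⟨_, .refl _ _⟩⟩
  | symm _ _ _ ih => exact ih.symm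
  | trans _ _ _ _ _ ih₁ ih₂ =>
    obtain ⟨⟨f, hf⟩, ⟨f', hf'⟩⟩ := ih₁
    obtain ⟨⟨g, hg⟩, ⟨g', hg'⟩⟩ := ih₂
    exact ⟨⟨_, .comp hf hg⟩, ⟨_, .comp hg' hf'⟩⟩

theorem Derives.exists_der {p : Polarity} {X Y : PFormula α p} (h : Derives X Y) :
    ∃ f, Der p X.erase Y.erase f := by
  induction h with
  | refl => exact ⟨_, .refl _ _⟩
  | @tail Y Z _ h ih =>
    obtain ⟨f, hf⟩ := ih
    obtain ⟨g, hg⟩ : ∃ g, Der p Y.erase Z.erase g := by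
      rcases h with ⟨q, C, A', A, hr, rfl, rfl⟩ | h
      · exact exists_der_fill C (exists_der_of_rule hr)
      · exact (FormulaIso.exists_der h).1
    exact ⟨_, .comp hf hg⟩

end PFormula

/-! ### Images of skew fibrations and weakening -/

namespace LGraph

variable {G H K G₁ G₂ H₁ H₂ : LGraph α} {p : Polarity}

/-- Embeddings that preserve and reflect the whole structure. -/
structure IsFullEmb {G K : LGraph α} (e : G.V → K.V) : Prop where
  injective : Function.Injective e
  iedge_iff : ∀ v w, K.iedge (e v) (e w) ↔ G.iedge v w
  medge_iff : ∀ v w, K.medge (e v) (e w) ↔ G.medge v w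
  lab_eq : ∀ v, K.lab (e v) = G.lab v
  depth_eq : ∀ v, K.depth (e v) = G.depth v
  rel_iff : ∀ p v w, K.Rel p (e v) (e w) ↔ G.Rel p v w

theorem SumRel.map_iff {V W V' W' : Type*} {R : V ⊕ W → V ⊕ W → Prop} {R₁ : V → V → Prop}
    {R₂ : W → W → Prop} {S : V' ⊕ W' → V' ⊕ W' → Prop} {S₁ : V' → V' → Prop}
    {S₂ : W' → W' → Prop} {c : Prop} {f₁ : V → V'} {f₂ : W → W'} (hR : SumRel R R₁ R₂ c)
    (hS : SumRel S S₁ S₂ c) (h₁ : ∀ v w, S₁ (f₁ v) (f₁ w) ↔ R₁ v w)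
    (h₂ : ∀ v w, S₂ (f₂ v) (f₂ w) ↔ R₂ v w) :
    ∀ v w, S (Sum.map f₁ f₂ v) (Sum.map f₁ f₂ w) ↔ R v w := by
  rintro (v | v) (w | w)
  · exact (hS.ll _ _).trans ((h₁ _ _).trans (hR.ll _ _).symm)
  · exact (hS.lr _ _).trans (hR.lr _ _).symm
  · exact (hS.rl _ _).trans (hR.rl _ _).symm
  · exact (hS.rr _ _).trans ((h₂ _ _).trans (hR.rr _ _).symm)

namespace IsFullEmb

theorem isRoot_iff [G.Good] [K.Good] {e : G.V → K.V} (he : IsFullEmb e) {v : G.V} :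
    K.IsRoot (e v) ↔ G.IsRoot v := by
  rw [LGraph.isRoot_iff, LGraph.isRoot_iff, he.depth_eq]

theorem comp {e : G.V → H.V} {f : H.V → K.V} (hf : IsFullEmb f) (he : IsFullEmb e) :
    IsFullEmb (f ∘ e) where
  injective := hf.injective.comp he.injective
  iedge_iff _ _ := (hf.iedge_iff _ _).trans (he.iedge_iff _ _)
  medge_iff _ _ := (hf.medge_iff _ _).trans (he.medge_iff _ _)
  lab_eq _ := (hf.lab_eq _).trans (he.lab_eq _)
  depth_eq _ := (hf.depth_eq _).trans (he.depth_eq _)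
  rel_iff p _ _ := (hf.rel_iff p _ _).trans (he.rel_iff p _ _)

theorem sumMap {f₁ : H₁.V → G₁.V} {f₂ : H₂.V → G₂.V} (h₁ : IsFullEmb f₁) (h₂ : IsFullEmb f₂) :
    IsFullEmb (sumMap f₁ f₂) where
  injective := Sum.map_injective.2 ⟨h₁.injective, h₂.injective⟩
  iedge_iff := by
    rintro (v | v) (w | w)
    exacts [h₁.iedge_iff v w, Iff.rfl, Iff.rfl, h₂.iedge_iff v w]
  medge_iff := by
    rintro (v | v) (w | w)
    exacts [h₁.medge_iff v w, Iff.rfl, Iff.rfl, h₂.medge_iff v w]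
  lab_eq := by
    rintro (v | v)
    exacts [h₁.lab_eq v, h₂.lab_eq v]
  depth_eq := by
    rintro (v | v)
    · exact (depth_sum_inl _).trans ((h₁.depth_eq v).trans (depth_sum_inl _).symm)
    · exact (depth_sum_inr _).trans ((h₂.depth_eq v).trans (depth_sum_inr _).symm)
  rel_iff p := (sumRel_sum H₁ H₂ p).map_iff (sumRel_sum G₁ G₂ p) (h₁.rel_iff p) (h₂.rel_iff p)

theorem arrowMap [H₁.Good] [H₂.Good] [G₁.Good] [G₂.Good] {f₁ : H₁.V → G₁.V} {f₂ : H₂.V → G₂.V}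
    (h₁ : IsFullEmb f₁) (h₂ : IsFullEmb f₂) : IsFullEmb (arrowMap f₁ f₂) where
  injective := Sum.map_injective.2 ⟨h₁.injective, h₂.injective⟩
  iedge_iff := by
    rintro (v | v) (w | w)
    exacts [h₁.iedge_iff v w, and_congr h₁.isRoot_iff h₂.isRoot_iff, Iff.rfl, h₂.iedge_iff v w]
  medge_iff := by
    rintro (v | v) (w | w)
    exacts [h₁.medge_iff v w, Iff.rfl, Iff.rfl, h₂.medge_iff v w]
  lab_eq := by
    rintro (v | v)
    exacts [h₁.lab_eq v, h₂.lab_eq v]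
  depth_eq := by
    rintro (v | v)
    · exact (depth_arrow_inl _).trans
        ((congrArg (· + 1) (h₁.depth_eq v)).trans (depth_arrow_inl _).symm)
    · exact (depth_arrow_inr _).trans ((h₂.depth_eq v).trans (depth_arrow_inr _).symm)
  rel_iff p :=
    (sumRel_arrow H₁ H₂ p).map_iff (sumRel_arrow G₁ G₂ p) (h₁.rel_iff _) (h₂.rel_iff p)

theorem squigMap [H.Good] [G.Good] {f : H.V → G.V} {l : Label α} (h : IsFullEmb f) :
    IsFullEmb (squigMap (H₁ := single l) (G₁ := single l) id f) where
  injective := Sum.map_injective.2 ⟨Function.injective_id, h.injective⟩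
  iedge_iff := by
    rintro (v | v) (w | w)
    exacts [Iff.rfl, Iff.rfl, Iff.rfl, h.iedge_iff v w]
  medge_iff := by
    rintro (v | v) (w | w)
    exacts [Iff.rfl, and_congr Iff.rfl h.isRoot_iff, Iff.rfl, h.medge_iff v w]
  lab_eq := by
    rintro (v | v)
    exacts [rfl, h.lab_eq v]
  depth_eq := by
    rintro (v | v)
    · exact (depth_squig_inl (G := single l) v).trans (depth_squig_inl _).symm
    · exact (depth_squig_inr _).trans ((h.depth_eq v).trans (depth_squig_inr _).symm)
  rel_iff p := (sumRel_squig (single l) H p).map_iff (sumRel_squig (single l) G p)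
    (fun _ _ => Iff.rfl) (h.rel_iff p)

theorem sum_inl (G H : LGraph α) : IsFullEmb (G := G) (K := G.sum H) Sum.inl :=
  ⟨Sum.inl_injective, fun _ _ => Iff.rfl, fun _ _ => Iff.rfl, fun _ => rfl, depth_sum_inl,
    fun p => (sumRel_sum G H p).ll⟩

theorem sum_inr (G H : LGraph α) : IsFullEmb (G := H) (K := G.sum H) Sum.inr :=
  ⟨Sum.inr_injective, fun _ _ => Iff.rfl, fun _ _ => Iff.rfl, fun _ => rfl, depth_sum_inr,
    fun p => (sumRel_sum G H p).rr⟩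

theorem arrow_inr (G H : LGraph α) [G.Good] [H.Good] :
    IsFullEmb (G := H) (K := G.arrow H) Sum.inr :=
  ⟨Sum.inr_injective, fun _ _ => Iff.rfl, fun _ _ => Iff.rfl, fun _ => rfl, depth_arrow_inr,
    fun p => (sumRel_arrow G H p).rr⟩

theorem squig_inl (G H : LGraph α) : IsFullEmb (G := G) (K := G.squig H) Sum.inl :=
  ⟨Sum.inl_injective, fun _ _ => Iff.rfl, fun _ _ => Iff.rfl, fun _ => rfl, depth_squig_inl,
    fun p => (sumRel_squig G H p).ll⟩

protected theorem id (G : LGraph α) : IsFullEmb (id : G.V → G.V) :=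
  ⟨Function.injective_id, fun _ _ => Iff.rfl, fun _ _ => Iff.rfl, fun _ => rfl, fun _ => rfl,
    fun _ _ _ => Iff.rfl⟩

end IsFullEmb

/-- The properties of the set of vertices in the image of a skew fibration from the arena of a
formula. -/
structure IsSkewSet (p : Polarity) (G : LGraph α) (S : G.V → Prop) : Prop where
  lifting : ∀ v w, S v → G.Rel p v w → ∃ u, S u ∧ G.Rel p v u ∧ ¬ G.Rel p u w
  modal : ∀ v w, S w → G.medge v w → S v
  descend : ∀ v, S v → ¬ G.IsRoot v → ∃ w, S w ∧ G.iedge v w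
  box : ∀ v, S v → G.lab v = .box → ∃ w, S w ∧ G.medge v w

namespace IsSkewSet

theorem exists_root [G.Good] {S : G.V → Prop} (hS : IsSkewSet p G S) {v : G.V} (hv : S v) :
    ∃ r, S r ∧ G.IsRoot r := by
  induction h : G.depth v generalizing v with
  | zero => exact ⟨v, hv, isRoot_iff.2 h⟩
  | succ n ih =>
    obtain ⟨w, hw, he⟩ := hS.descend v hv (by rw [isRoot_iff]; omega)
    exact ih hw (by have := Good.depth_edge _ _ he; omega)

theorem sum_left {S : (G.sum H).V → Prop} (hS : IsSkewSet p (G.sum H) S) :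
    IsSkewSet p G (fun v => S (.inl v)) where
  lifting v w hv h := by
    have hR := sumRel_sum G H p
    obtain ⟨u | u, h1, h2, h3⟩ := hS.lifting (.inl v) (.inl w) hv ((hR.ll _ _).2 h)
    · exact ⟨u, h1, (hR.ll _ _).1 h2, fun h => h3 ((hR.ll _ _).2 h)⟩
    · exact (h3 ((hR.rl _ _).2 ((hR.lr _ _).1 h2))).elim
  modal v w hw h := hS.modal (.inl v) (.inl w) hw h
  descend v hv h := by
    obtain ⟨w | w, hw, he⟩ := hS.descend (.inl v) hv
      (((isLowerEmb_sum_inl G H).isRoot_iff v).not.2 h)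
    · exact ⟨w, hw, he⟩
    · exact he.elim
  box v hv h := by
    obtain ⟨w | w, hw, he⟩ := hS.box (.inl v) hv h
    · exact ⟨w, hw, he⟩
    · exact he.elim

theorem sum_right {S : (G.sum H).V → Prop} (hS : IsSkewSet p (G.sum H) S) :
    IsSkewSet p H (fun v => S (.inr v)) where
  lifting v w hv h := by
    have hR := sumRel_sum G H p
    obtain ⟨u | u, h1, h2, h3⟩ := hS.lifting (.inr v) (.inr w) hv ((hR.rr _ _).2 h)
    · exact (h3 ((hR.lr _ _).2 ((hR.rl _ _).1 h2))).elim
    · exact ⟨u, h1, (hR.rr _ _).1 h2, fun h => h3 ((hR.rr _ _).2 h)⟩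
  modal v w hw h := hS.modal (.inr v) (.inr w) hw h
  descend v hv h := by
    obtain ⟨w | w, hw, he⟩ := hS.descend (.inr v) hv
      (((isLowerEmb_sum_inr G H).isRoot_iff v).not.2 h)
    · exact he.elim
    · exact ⟨w, hw, he⟩
  box v hv h := by
    obtain ⟨w | w, hw, he⟩ := hS.box (.inr v) hv h
    · exact he.elim
    · exact ⟨w, hw, he⟩

theorem arrow_left [G.Good] [H.Good] {S : (G.arrow H).V → Prop}
    (hS : IsSkewSet p (G.arrow H) S) : IsSkewSet p.flip G (fun v => S (.inl v)) where
  lifting v w hv h := by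
    have hR := sumRel_arrow G H p
    obtain ⟨u | u, h1, h2, h3⟩ := hS.lifting (.inl v) (.inl w) hv ((hR.ll _ _).2 h)
    · exact ⟨u, h1, (hR.ll _ _).1 h2, fun h => h3 ((hR.ll _ _).2 h)⟩
    · exact (h3 ((hR.rl _ _).2 ((hR.lr _ _).1 h2))).elim
  modal v w hw h := hS.modal (.inl v) (.inl w) hw h
  descend v hv h := by
    obtain ⟨w, hw⟩ : ∃ w, G.iedge v w := by simpa [IsRoot] using h
    obtain ⟨w | w, hw, he⟩ := hS.descend (.inl v) hv fun h => h (.inl w) hw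
    · exact ⟨w, hw, he⟩
    · exact (h he.1).elim
  box v hv h := by
    obtain ⟨w | w, hw, he⟩ := hS.box (.inl v) hv h
    · exact ⟨w, hw, he⟩
    · exact he.elim

theorem arrow_right [G.Good] [H.Good] {S : (G.arrow H).V → Prop}
    (hS : IsSkewSet p (G.arrow H) S) : IsSkewSet p H (fun v => S (.inr v)) where
  lifting v w hv h := by
    have hR := sumRel_arrow G H p
    obtain ⟨u | u, h1, h2, h3⟩ := hS.lifting (.inr v) (.inr w) hv ((hR.rr _ _).2 h)
    · exact (h3 ((hR.lr _ _).2 ((hR.rl _ _).1 h2))).elim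
    · exact ⟨u, h1, (hR.rr _ _).1 h2, fun h => h3 ((hR.rr _ _).2 h)⟩
  modal v w hw h := hS.modal (.inr v) (.inr w) hw h
  descend v hv h := by
    obtain ⟨w | w, hw, he⟩ := hS.descend (.inr v) hv
      (((isLowerEmb_arrow_inr G H).isRoot_iff v).not.2 h)
    · exact he.elim
    · exact ⟨w, hw, he⟩
  box v hv h := by
    obtain ⟨w | w, hw, he⟩ := hS.box (.inr v) hv h
    · exact he.elim
    · exact ⟨w, hw, he⟩

theorem squig_right {S : (G.squig H).V → Prop} (hS : IsSkewSet p (G.squig H) S) :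
    IsSkewSet p H (fun v => S (.inr v)) where
  lifting v w hv h := by
    have hR := sumRel_squig G H p
    obtain ⟨u | u, h1, h2, h3⟩ := hS.lifting (.inr v) (.inr w) hv ((hR.rr _ _).2 h)
    · exact (h3 ((hR.lr _ _).2 ((hR.rl _ _).1 h2))).elim
    · exact ⟨u, h1, (hR.rr _ _).1 h2, fun h => h3 ((hR.rr _ _).2 h)⟩
  modal v w hw h := hS.modal (.inr v) (.inr w) hw h
  descend v hv h := by
    obtain ⟨w | w, hw, he⟩ := hS.descend (.inr v) hv
      (((isLowerEmb_squig_inr G H).isRoot_iff v).not.2 h)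
    · exact he.elim
    · exact ⟨w, hw, he⟩
  box v hv h := by
    obtain ⟨w | w, hw, he⟩ := hS.box (.inr v) hv h
    · exact he.elim
    · exact ⟨w, hw, he⟩

/-- A vertex of `S` in the body leads down to a root of the body within `S`, and the modal clause
then brings in the modality above it. -/
theorem squig_single [H.Good] {l : Label α} {S : ((single l).squig H).V → Prop}
    (hS : IsSkewSet p ((single l).squig H) S) (hne : ∃ v, S v) (u : Unit) : S (.inl u) := by
  obtain ⟨v | v, hv⟩ := hne
  · exact hv
  · obtain ⟨r, hr, hroot⟩ := hS.squig_right.exists_root hv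
    exact hS.modal (.inl ()) (.inr r) hr ⟨fun _ h => h, hroot⟩

end IsSkewSet

end LGraph

/-- `S` is the image of an embedding that is witnessed by a derivation. -/
def IsDerRange (p : Polarity) (F : Formula α) (S : F.arena.V → Prop) : Prop :=
  ∃ (F' : Formula α) (g : F'.arena.V → F.arena.V),
    Der p F' F g ∧ IsFullEmb g ∧ ∀ x, S x ↔ ∃ y, g y = x

theorem sum_range_map {V W V' W' : Type*} {f : V → V'} {g : W → W'} {S : V' ⊕ W' → Prop}
    (hf : ∀ x, S (.inl x) ↔ ∃ y, f y = x) (hg : ∀ x, S (.inr x) ↔ ∃ y, g y = x) :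
    ∀ x, S x ↔ ∃ y, Sum.map f g y = x := by
  rintro (x | x)
  · rw [hf]
    constructor
    · rintro ⟨y, rfl⟩; exact ⟨.inl y, rfl⟩
    · rintro ⟨y | y, hy⟩
      · exact ⟨y, Sum.inl_injective hy⟩
      · cases hy
  · rw [hg]
    constructor
    · rintro ⟨y, rfl⟩; exact ⟨.inr y, rfl⟩
    · rintro ⟨y | y, hy⟩
      · cases hy
      · exact ⟨y, Sum.inr_injective hy⟩

theorem sum_range_inl {V V' W' : Type*} {f : V → V'} {S : V' ⊕ W' → Prop}
    (hf : ∀ x, S (.inl x) ↔ ∃ y, f y = x) (hg : ∀ x, ¬ S (.inr x)) :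
    ∀ x, S x ↔ ∃ y, Sum.inl (f y) = x := by
  rintro (x | x)
  · simp [hf]
  · simp [hg]

theorem sum_range_inr {W V' W' : Type*} {f : W → W'} {S : V' ⊕ W' → Prop}
    (hf : ∀ x, S (.inr x) ↔ ∃ y, f y = x) (hg : ∀ x, ¬ S (.inl x)) :
    ∀ x, S x ↔ ∃ y, Sum.inr (f y) = x := by
  rintro (x | x)
  · simp [hg]
  · simp [hf]

theorem IsDerRange.of_forall {p : Polarity} {F : Formula α} {S : F.arena.V → Prop}
    (h : ∀ x, S x) : IsDerRange p F S :=
  ⟨F, id, .refl p F, .id _, fun x => ⟨fun _ => ⟨x, rfl⟩, fun _ => h x⟩⟩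

/-- Weakening produces the sets that look like the image of a skew fibration. -/
theorem LGraph.IsSkewSet.isDerRange {p : Polarity} {F : Formula α} {S : F.arena.V → Prop}
    (hS : IsSkewSet p F.arena S) (hne : ∃ v, S v) : IsDerRange p F S := by
  induction F generalizing p with
  | atom a =>
    obtain ⟨v, hv⟩ := hne
    exact .of_forall fun _ => hv
  | diaBot =>
    obtain ⟨v, hv⟩ := hne
    exact .of_forall fun _ => hv
  | and A B ihA ihB =>
    have hA : IsSkewSet p A.arena fun v => S (.inl v) := IsSkewSet.sum_left hS
    have hB : IsSkewSet p B.arena fun v => S (.inr v) := IsSkewSet.sum_right hS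
    have hR := sumRel_sum A.arena B.arena p
    by_cases hneA : ∃ v, S (.inl v)
    · obtain ⟨A', f, df, ef, rf⟩ := ihA hA hneA
      by_cases hneB : ∃ v, S (.inr v)
      · obtain ⟨B', g, dg, eg, rg⟩ := ihB hB hneB
        exact ⟨_, _, .and df dg, ef.sumMap eg, sum_range_map rf rg⟩
      · cases p with
        | odd =>
          exact ⟨_, _, .comp df (.weakAnd A B), (IsFullEmb.sum_inl A.arena B.arena).comp ef,
            sum_range_inl rf fun x hx => hneB ⟨x, hx⟩⟩
        | even =>
          obtain ⟨v, hv⟩ := hneA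
          obtain ⟨w⟩ := B.good_arena.nonempty
          -- In even polarity no conjunct can be missing: lifting against a vertex `w` of the empty
          -- side yields a vertex of `S` not conjunct to `w`, hence on the side of `w`.
          obtain ⟨u | u, h1, h2, h3⟩ := hS.lifting (.inl v) (.inr w) hv ((hR.lr _ _).2 rfl)
          · exact (h3 ((hR.lr _ _).2 rfl)).elim
          · exact (hneB ⟨u, h1⟩).elim
    · have hneB : ∃ v, S (.inr v) := by
        obtain ⟨v | v, hv⟩ := hne
        · exact (hneA ⟨v, hv⟩).elim
        · exact ⟨v, hv⟩
      cases p with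
      | odd =>
        obtain ⟨B', g, dg, eg, rg⟩ := ihB hB hneB
        exact ⟨_, _, .comp dg (.comp (.weakAnd B A) (.comm _ B A)),
          (IsFullEmb.sum_inr A.arena B.arena).comp eg,
          sum_range_inr rg fun x hx => hneA ⟨x, hx⟩⟩
      | even =>
        obtain ⟨v, hv⟩ := hneB
        obtain ⟨w⟩ := A.good_arena.nonempty
        obtain ⟨u | u, h1, h2, h3⟩ := hS.lifting (.inr v) (.inl w) hv ((hR.rl _ _).2 rfl)
        · exact (hneA ⟨u, h1⟩).elim
        · exact (h3 ((hR.rl _ _).2 rfl)).elim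
  | imp A B ihA ihB =>
    have hA : IsSkewSet p.flip A.arena fun v => S (.inl v) := IsSkewSet.arrow_left hS
    have hB : IsSkewSet p B.arena fun v => S (.inr v) := IsSkewSet.arrow_right hS
    have hR := sumRel_arrow A.arena B.arena p
    -- The consequent is never missing, since `S` contains a root and all roots of an arrow lie in
    -- the consequent.
    have hneB : ∃ v, S (.inr v) := by
      obtain ⟨v, hv⟩ := hne
      obtain ⟨r | r, hr, hroot⟩ := hS.exists_root hv
      · have h0 : (A.arena.arrow B.arena).depth (.inl r) = 0 := isRoot_iff.1 hroot
        rw [depth_arrow_inl] at h0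
        cases h0
      · exact ⟨r, hr⟩
    obtain ⟨B', g, dg, eg, rg⟩ := ihB hB hneB
    by_cases hneA : ∃ v, S (.inl v)
    · obtain ⟨A', f, df, ef, rf⟩ := ihA hA hneA
      exact ⟨_, _, .imp df dg, ef.arrowMap eg, sum_range_map rf rg⟩
    · cases p with
      | even =>
        exact ⟨_, _, .comp dg (.weakImp B A), (IsFullEmb.arrow_inr A.arena B.arena).comp eg,
          sum_range_inr rg fun x hx => hneA ⟨x, hx⟩⟩
      | odd =>
        obtain ⟨v, hv⟩ := hneB
        obtain ⟨w⟩ := A.good_arena.nonempty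
        obtain ⟨u | u, h1, h2, h3⟩ := hS.lifting (.inr v) (.inl w) hv ((hR.rl _ _).2 rfl)
        · exact (hneA ⟨u, h1⟩).elim
        · exact (h3 ((hR.rl _ _).2 rfl)).elim
  | box A ih =>
    have hA : IsSkewSet p A.arena fun v => S (.inr v) := IsSkewSet.squig_right hS
    have h0 : ∀ u, S (.inl u) := IsSkewSet.squig_single hS hne
    have hneA : ∃ v, S (.inr v) := by
      obtain ⟨w | w, hw, he⟩ := hS.box (.inl ()) (h0 ()) rfl
      · exact he.elim
      · exact ⟨w, hw⟩
    obtain ⟨A', f, df, ef, rf⟩ := ih hA hneA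
    exact ⟨_, _, .box df, ef.squigMap,
      sum_range_map (fun x => ⟨fun _ => ⟨x, rfl⟩, fun _ => h0 x⟩) rf⟩
  | dia A ih =>
    have hA : IsSkewSet p A.arena fun v => S (.inr v) := IsSkewSet.squig_right hS
    have h0 : ∀ u, S (.inl u) := IsSkewSet.squig_single hS hne
    have hR := sumRel_squig (single .dia) A.arena p
    by_cases hneA : ∃ v, S (.inr v)
    · obtain ⟨A', f, df, ef, rf⟩ := ih hA hneA
      exact ⟨_, _, .dia df, ef.squigMap,
        sum_range_map (fun x => ⟨fun _ => ⟨x, rfl⟩, fun _ => h0 x⟩) rf⟩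
    · cases p with
      | odd =>
        exact ⟨_, _, .weakDia A, IsFullEmb.squig_inl _ A.arena,
          sum_range_inl (f := id) (fun x => ⟨fun _ => ⟨x, rfl⟩, fun _ => h0 x⟩)
            fun x hx => hneA ⟨x, hx⟩⟩
      | even =>
        obtain ⟨w⟩ := A.good_arena.nonempty
        obtain ⟨u | u, h1, h2, h3⟩ := hS.lifting (.inl ()) (.inr w) (h0 ()) ((hR.lr _ _).2 rfl)
        · exact (h3 ((hR.lr _ _).2 rfl)).elim
        · exact (hneA ⟨u, h1⟩).elim

/-- A box vertex always has a nonempty body, unlike a diamond, which may stand for `◇⊥`. Therefore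
weakening cannot supply the body of a box, in agreement with the rules. -/
theorem Formula.exists_medge_of_box {F : Formula α} {v : F.arena.V} (hv : F.arena.lab v = .box) :
    ∃ w, F.arena.medge v w := by
  induction F with
  | atom a => cases hv
  | diaBot => cases hv
  | and A B ihA ihB =>
    rcases v with v | v
    · obtain ⟨w, hw⟩ := ihA hv; exact ⟨.inl w, hw⟩
    · obtain ⟨w, hw⟩ := ihB hv; exact ⟨.inr w, hw⟩
  | imp A B ihA ihB =>
    rcases v with v | v
    · obtain ⟨w, hw⟩ := ihA hv; exact ⟨.inl w, hw⟩
    · obtain ⟨w, hw⟩ := ihB hv; exact ⟨.inr w, hw⟩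
  | box A ih =>
    rcases v with v | v
    · obtain ⟨r, hr⟩ := exists_root A.arena
      exact ⟨.inr r, fun _ h => h, hr⟩
    · obtain ⟨w, hw⟩ := ih hv; exact ⟨.inr w, hw⟩
  | dia A ih =>
    rcases v with v | v
    · cases hv
    · obtain ⟨w, hw⟩ := ih hv; exact ⟨.inr w, hw⟩

theorem LGraph.IsSkewFibration.isSkewSet_range {p : Polarity} {F' : Formula α} {G : LGraph α}
    [G.Good] {f : F'.arena.V → G.V} (hf : IsSkewFibration p f) :
    IsSkewSet p G (fun x => ∃ y, f y = x) where
  lifting := by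
    rintro _ w ⟨y, rfl⟩ h
    obtain ⟨u, h1, h2⟩ := hf.lifting y w h
    exact ⟨f u, ⟨u, rfl⟩, hf.preserves _ _ h1, h2⟩
  modal := by
    rintro v _ ⟨y, rfl⟩ h
    obtain ⟨w, -, hw⟩ := hf.modal v y h
    exact ⟨w, hw⟩
  descend := by
    rintro _ ⟨y, rfl⟩ h
    rw [hf.isRoot_iff, isRoot_iff] at h
    obtain ⟨w, hw⟩ := Good.exists_edge y h
    exact ⟨f w, ⟨w, rfl⟩, hf.iedge _ _ hw⟩
  box := by
    rintro _ ⟨y, rfl⟩ h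
    obtain ⟨w, hw⟩ := Formula.exists_medge_of_box ((hf.lab y).trans h)
    exact ⟨f w, ⟨w, rfl⟩, hf.medge _ _ hw⟩

/-- A skew fibration is a surjective one followed by weakenings. -/
theorem LGraph.IsSkewFibration.exists_surjective {p : Polarity} {F' F : Formula α}
    {f : F'.arena.V → F.arena.V} (hf : IsSkewFibration p f) :
    ∃ (K : Formula α) (f' : F'.arena.V → K.arena.V) (g : K.arena.V → F.arena.V),
      Der p K F g ∧ IsSkewFibration p f' ∧ Function.Surjective f' ∧ g ∘ f' = f := by
  obtain ⟨v₀⟩ := F'.good_arena.nonempty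
  obtain ⟨K, g, hg, eg, rg⟩ := hf.isSkewSet_range.isDerRange ⟨f v₀, v₀, rfl⟩
  choose f' hf' using fun v => (rg (f v)).1 ⟨v, rfl⟩
  have hrel : ∀ v w, K.arena.Rel p (f' v) w ↔ F.arena.Rel p (f v) (g w) := fun v w => by
    rw [← eg.rel_iff, hf']
  refine ⟨K, f', g, hg, ⟨⟨fun v w h => ?_, fun v w h => ?_, fun v => ?_, fun v => ?_,
    fun v u h => ?_⟩, fun v w h => ?_, fun v w h => ?_⟩, fun x => ?_, funext hf'⟩
  · rw [← eg.iedge_iff, hf', hf']; exact hf.iedge v w h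
  · rw [← eg.medge_iff, hf', hf']; exact hf.medge v w h
  · rw [← eg.depth_eq, hf']; exact hf.depth v
  · rw [← eg.lab_eq, hf']; exact hf.lab v
  · rw [← eg.medge_iff, hf'] at h
    obtain ⟨w, hw, he⟩ := hf.modal _ u h
    exact ⟨w, hw, eg.injective ((hf' w).trans he)⟩
  · rw [hrel, hf']; exact hf.preserves v w h
  · obtain ⟨u, h1, h2⟩ := hf.lifting v (g w) ((hrel v w).1 h)
    exact ⟨u, h1, fun h => h2 ((hrel u w).1 h)⟩
  · obtain ⟨v, hv⟩ := (rg (g x)).2 ⟨x, rfl⟩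
    exact ⟨v, eg.injective ((hf' v).trans hv)⟩

/-! ### Rearranging source and target -/

/-- Isomorphisms of arenas that are witnessed by derivations in both directions. -/
structure IsDerIso (F F' : Formula α) (e : F.arena.V ≃ F'.arena.V) : Prop where
  isIso : IsIso e
  der : ∀ p, Der p F F' e
  der_symm : ∀ p, Der p F' F e.symm

namespace IsDerIso

variable {A A' B B' C : Formula α}

theorem refl (A : Formula α) : IsDerIso A A (.refl _) where
  isIso := ⟨Function.bijective_id, fun _ _ => Iff.rfl, fun _ _ => Iff.rfl, fun _ => rfl⟩
  der p := .refl p A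
  der_symm p := .refl p A

theorem symm {e : A.arena.V ≃ B.arena.V} (h : IsDerIso A B e) : IsDerIso B A e.symm :=
  ⟨h.isIso.symm, h.der_symm, h.der⟩

theorem trans {e : A.arena.V ≃ B.arena.V} {f : B.arena.V ≃ C.arena.V} (he : IsDerIso A B e)
    (hf : IsDerIso B C f) : IsDerIso A C (e.trans f) where
  isIso := he.isIso.trans hf.isIso
  der p := Der.comp (f := e) (g := f) (he.der p) (hf.der p)
  der_symm p := Der.comp (f := f.symm) (g := e.symm) (hf.der_symm p) (he.der_symm p)

theorem and {e : A.arena.V ≃ A'.arena.V} {f : B.arena.V ≃ B'.arena.V} (he : IsDerIso A A' e)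
    (hf : IsDerIso B B' f) : IsDerIso (A.and B) (A'.and B') (e.sumCongr f) where
  isIso := by
    refine ⟨(e.sumCongr f).bijective, ?_, ?_, ?_⟩
    · rintro (v | v) (w | w)
      exacts [he.isIso.iedge_iff v w, Iff.rfl, Iff.rfl, hf.isIso.iedge_iff v w]
    · rintro (v | v) (w | w)
      exacts [he.isIso.medge_iff v w, Iff.rfl, Iff.rfl, hf.isIso.medge_iff v w]
    · rintro (v | v)
      exacts [he.isIso.lab_eq v, hf.isIso.lab_eq v]
  der p := .and (he.der p) (hf.der p)
  der_symm p := .and (he.der_symm p) (hf.der_symm p)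

theorem imp {e : A.arena.V ≃ A'.arena.V} {f : B.arena.V ≃ B'.arena.V} (he : IsDerIso A A' e)
    (hf : IsDerIso B B' f) : IsDerIso (A.imp B) (A'.imp B') (e.sumCongr f) where
  isIso := by
    refine ⟨(e.sumCongr f).bijective, ?_, ?_, ?_⟩
    · rintro (v | v) (w | w)
      exacts [he.isIso.iedge_iff v w,
        and_congr (he.isIso.isLowerEmb.isRoot_iff v) (hf.isIso.isLowerEmb.isRoot_iff w),
        Iff.rfl, hf.isIso.iedge_iff v w]
    · rintro (v | v) (w | w)
      exacts [he.isIso.medge_iff v w, Iff.rfl, Iff.rfl, hf.isIso.medge_iff v w]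
    · rintro (v | v)
      exacts [he.isIso.lab_eq v, hf.isIso.lab_eq v]
  der p := .imp (he.der _) (hf.der p)
  der_symm p := .imp (he.der_symm _) (hf.der_symm p)

theorem comm (A B : Formula α) : IsDerIso (A.and B) (B.and A) (andComm A B) :=
  ⟨isIso_andComm A B, fun p => .comm p A B, fun p => .comm p B A⟩

theorem assoc (A B C : Formula α) :
    IsDerIso ((A.and B).and C) (A.and (B.and C)) (andAssoc A B C) :=
  ⟨isIso_andAssoc A B C, fun p => .assoc p A B C, fun p => .assocSymm p A B C⟩

theorem curry (A B C : Formula α) :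
    IsDerIso (.imp (A.and B) C) (A.imp (B.imp C)) (impCurry A B C) :=
  ⟨isIso_impCurry A B C, fun p => .curry p A B C, fun p => .currySymm p A B C⟩

theorem isSkewFibration_comp {p : Polarity} {K F' F : Formula α} {e : K.arena.V ≃ F'.arena.V}
    (he : IsDerIso K F' e) {f : F'.arena.V → F.arena.V} (hf : IsSkewFibration p f) :
    IsSkewFibration p (f ∘ e) where
  toIsModalHom := hf.toIsModalHom.comp he.isIso.isModalHom
  preserves v w h := hf.preserves _ _ ((he.isIso.isLowerEmb.rel_iff p v w).2 h)
  lifting v w h := by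
    obtain ⟨u, h1, h2⟩ := hf.lifting (e v) w h
    obtain ⟨u, rfl⟩ := e.surjective u
    exact ⟨u, (he.isIso.isLowerEmb.rel_iff p v u).1 h1, h2⟩

theorem comp_isSkewFibration {p : Polarity} {F' F K : Formula α} {e : F.arena.V ≃ K.arena.V}
    (he : IsDerIso F K e) {f : F'.arena.V → F.arena.V} (hf : IsSkewFibration p f) :
    IsSkewFibration p (e ∘ f) where
  toIsModalHom := he.isIso.isModalHom.comp hf.toIsModalHom
  preserves v w h := (he.isIso.isLowerEmb.rel_iff p _ _).2 (hf.preserves v w h)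
  lifting v w h := by
    obtain ⟨w, rfl⟩ := e.surjective w
    obtain ⟨u, h1, h2⟩ := hf.lifting v w ((he.isIso.isLowerEmb.rel_iff p _ _).1 h)
    exact ⟨u, h1, fun h => h2 ((he.isIso.isLowerEmb.rel_iff p _ _).1 h)⟩

theorem der_of_comp {p : Polarity} {K F' F : Formula α} {e : K.arena.V ≃ F'.arena.V}
    (he : IsDerIso K F' e) {f : F'.arena.V → F.arena.V} (h : Der p K F (f ∘ e)) :
    Der p F' F f := by
  have := Der.comp (he.der_symm p) h
  rwa [Function.comp_assoc, Equiv.self_comp_symm, Function.comp_id] at this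

theorem der_of_symm_comp {p : Polarity} {K F' F : Formula α} {e : K.arena.V ≃ F.arena.V}
    (he : IsDerIso K F e) {f : F'.arena.V → F.arena.V} (h : Der p F' K (e.symm ∘ f)) :
    Der p F' F f := by
  have := Der.comp h (he.der p)
  rwa [← Function.comp_assoc, Equiv.self_comp_symm, Function.id_comp] at this

end IsDerIso

/-! ### Connectedness and splitting -/

namespace Formula

/-- `P` does not separate vertices that are joined by an edge. -/
def EdgeClosed (G : LGraph α) (P : G.V → Prop) : Prop :=
  (∀ v w, G.iedge v w → (P v ↔ P w)) ∧ ∀ v w, G.medge v w → (P v ↔ P w)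

theorem EdgeClosed.iff_of_reach {G : LGraph α} {P : G.V → Prop} (hP : EdgeClosed G P) {v w : G.V}
    (h : G.Reach v w) : P v ↔ P w := by
  induction h with
  | refl => exact Iff.rfl
  | tail _ h ih => exact ih.trans (hP.1 _ _ h)

/-- Every vertex leads to a root, and all roots are tied together: by any root of the antecedent in
an implication, by the top vertex in a modal formula. -/
theorem connected_of_not_and {F : Formula α} (hF : ∀ A B, F ≠ .and A B) {P : F.arena.V → Prop}
    (hP : EdgeClosed F.arena P) (v w : F.arena.V) : P v ↔ P w := by
  suffices ∃ Q : Prop, ∀ r, F.arena.IsRoot r → (P r ↔ Q) by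
    obtain ⟨Q, hQ⟩ := this
    have : ∀ v, P v ↔ Q := fun v => by
      obtain ⟨r, hr, h⟩ := exists_reach_root v
      exact (hP.iff_of_reach h).trans (hQ r hr)
    exact (this v).trans (this w).symm
  cases F with
  | atom a => exact ⟨P (), fun _ _ => Iff.rfl⟩
  | diaBot => exact ⟨P (), fun _ _ => Iff.rfl⟩
  | and A B => exact (hF A B rfl).elim
  | imp A B =>
    obtain ⟨a, ha⟩ := exists_root A.arena
    refine ⟨P (.inl a), ?_⟩
    rintro (r | r) hr
    · have h0 : (A.arena.arrow B.arena).depth (.inl r) = 0 := isRoot_iff.1 hr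
      rw [depth_arrow_inl] at h0
      cases h0
    · exact (hP.1 (.inl a) (.inr r)
        ⟨ha, ((isLowerEmb_arrow_inr A.arena B.arena).isRoot_iff r).1 hr⟩).symm
  | box A =>
    refine ⟨P (.inl ()), ?_⟩
    rintro (r | r) hr
    · exact Iff.rfl
    · exact (hP.2 (.inl ()) (.inr r)
        ⟨fun _ h => h, ((isLowerEmb_squig_inr (single .box) A.arena).isRoot_iff r).1 hr⟩).symm
  | dia A =>
    refine ⟨P (.inl ()), ?_⟩
    rintro (r | r) hr
    · exact Iff.rfl
    · exact (hP.2 (.inl ()) (.inr r)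
        ⟨fun _ h => h, ((isLowerEmb_squig_inr (single .dia) A.arena).isRoot_iff r).1 hr⟩).symm

/-- `F` is, up to formula isomorphism, a conjunction along which `P` splits. -/
def Splits (F : Formula α) (P : F.arena.V → Prop) : Prop :=
  ∃ (A B : Formula α) (e : (A.and B).arena.V ≃ F.arena.V),
    IsDerIso _ _ e ∧ (∀ x, P (e (.inl x))) ∧ ∀ y, ¬ P (e (.inr y))

theorem all_or_none {F : Formula α} (hF : ∀ A B, F ≠ .and A B) {P : F.arena.V → Prop}
    (hP : EdgeClosed F.arena P) : (∀ v, P v) ∨ ∀ v, ¬ P v := by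
  obtain ⟨v⟩ := F.good_arena.nonempty
  by_cases h : P v
  · exact .inl fun w => (connected_of_not_and hF hP v w).1 h
  · exact .inr fun w hw => h ((connected_of_not_and hF hP v w).2 hw)

/-- `P` is constant on each conjunct that is not itself a conjunction, so commutativity and
associativity collect the conjuncts inside `P` and those outside it. -/
theorem split (F : Formula α) {P : F.arena.V → Prop} (hP : EdgeClosed F.arena P) :
    (∀ v, P v) ∨ (∀ v, ¬ P v) ∨ F.Splits P := by
  induction F with
  | and A B ihA ihB =>
    have hA : EdgeClosed A.arena fun v => P (.inl v) :=
      ⟨fun v w => hP.1 (.inl v) (.inl w), fun v w => hP.2 (.inl v) (.inl w)⟩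
    have hB : EdgeClosed B.arena fun v => P (.inr v) :=
      ⟨fun v w => hP.1 (.inr v) (.inr w), fun v w => hP.2 (.inr v) (.inr w)⟩
    rcases ihA hA with hA | hA | ⟨A₁, A₂, e, he, h₁, h₂⟩ <;>
    rcases ihB hB with hB | hB | ⟨B₁, B₂, f, hf, k₁, k₂⟩
    · exact .inl (Sum.rec hA hB)
    · exact .inr (.inr ⟨A, B, _, .refl _, hA, hB⟩)
    · exact .inr (.inr ⟨A.and B₁, B₂, _,
        (IsDerIso.assoc _ _ _).trans ((IsDerIso.refl A).and hf),
        Sum.rec hA k₁, k₂⟩)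
    · exact .inr (.inr ⟨B, A, _, .comm _ _, hB, hA⟩)
    · exact .inr (.inl (Sum.rec hA hB))
    · exact .inr (.inr ⟨B₁, A.and B₂, _, ((IsDerIso.refl B₁).and (.comm A B₂)).trans
        ((IsDerIso.assoc _ _ _).symm.trans ((hf.and (.refl A)).trans (.comm _ _))),
        k₁, Sum.rec hA k₂⟩)
    · exact .inr (.inr ⟨A₁.and B, A₂, _, (IsDerIso.assoc _ _ _).trans
        (((IsDerIso.refl A₁).and (.comm B A₂)).trans
        ((IsDerIso.assoc _ _ _).symm.trans (he.and (.refl B)))),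
        Sum.rec h₁ hB, h₂⟩)
    · exact .inr (.inr ⟨A₁, A₂.and B, _, (IsDerIso.assoc _ _ _).symm.trans (he.and (.refl B)),
        h₁, Sum.rec h₂ hB⟩)
    · exact .inr (.inr ⟨A₁.and B₁, A₂.and B₂, _, (IsDerIso.assoc _ _ _).trans
        (((IsDerIso.refl A₁).and ((IsDerIso.assoc _ _ _).symm.trans
        (((IsDerIso.comm B₁ A₂).and (.refl B₂)).trans (.assoc _ _ _)))).trans
        ((IsDerIso.assoc _ _ _).symm.trans (he.and hf))),
        Sum.rec h₁ k₁, Sum.rec h₂ k₂⟩)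
  | _ => exact (all_or_none (by rintro _ _ ⟨⟩) hP).imp_right .inl

/-- Up to currying, an implication has a conclusion that is not an implication. -/
theorem exists_uncurried (A C : Formula α) :
    ∃ (A' B : Formula α) (e : (A'.imp B).arena.V ≃ (A.imp C).arena.V),
      IsDerIso _ _ e ∧ ∀ X Y, B ≠ .imp X Y := by
  induction C generalizing A with
  | imp D E _ ih =>
    obtain ⟨A', B, e, he, hB⟩ := ih D
    by_cases hE : ∀ X Y, E ≠ .imp X Y
    · exact ⟨A.and D, E, _, .curry A D E, hE⟩
    · obtain ⟨A', B, e, he, hB⟩ := ih (A.and D)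
      exact ⟨A', B, _, he.trans (.curry A D E), hB⟩
  | _ => exact ⟨A, _, _, .refl _, nofun⟩

/-- Conjunctness joins every vertex of one conjunct to every vertex of the other, and the top vertex
of a modal formula to its whole body. -/
theorem coconnected_of_not_imp {F : Formula α} (hF : ∀ A B, F ≠ .imp A B) {P : F.arena.V → Prop}
    (hP : ∀ v w, F.arena.Rel .even v w → (P v ↔ P w)) (v w : F.arena.V) : P v ↔ P w := by
  suffices ∃ Q : Prop, ∀ v, P v ↔ Q by
    obtain ⟨Q, hQ⟩ := this
    exact (hQ v).trans (hQ w).symm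
  cases F with
  | atom a => exact ⟨P (), fun _ => Iff.rfl⟩
  | diaBot => exact ⟨P (), fun _ => Iff.rfl⟩
  | imp A B => exact (hF A B rfl).elim
  | and A B =>
    have hR := sumRel_sum A.arena B.arena .even
    obtain ⟨a⟩ := A.good_arena.nonempty
    obtain ⟨b⟩ := B.good_arena.nonempty
    have hlr : ∀ a b, P (.inl a) ↔ P (.inr b) := fun a b =>
      hP (.inl a) (.inr b) ((hR.lr a b).2 rfl)
    refine ⟨P (.inl a), ?_⟩
    rintro (v | v)
    · exact (hlr v b).trans (hlr a b).symm
    · exact (hlr a v).symm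
  | box A =>
    have hR := sumRel_squig (single .box) A.arena .even
    refine ⟨P (.inl ()), ?_⟩
    rintro (v | v)
    · exact Iff.rfl
    · exact (hP (.inl ()) (.inr v) ((hR.lr () v).2 rfl)).symm
  | dia A =>
    have hR := sumRel_squig (single .dia) A.arena .even
    refine ⟨P (.inl ()), ?_⟩
    rintro (v | v)
    · exact Iff.rfl
    · exact (hP (.inl ()) (.inr v) ((hR.lr () v).2 rfl)).symm

theorem exists_not_disj {F : Formula α} (h₁ : ∀ A B, F ≠ .imp A B) (h₂ : ∀ A B, F ≠ .and A B) :
    ∃ c, ∀ u, ¬ F.arena.Rel .odd c u := by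
  cases F with
  | atom a => exact ⟨(), fun _ => rel_irrefl _ _ _⟩
  | diaBot => exact ⟨(), fun _ => rel_irrefl _ _ _⟩
  | imp A B => exact (h₁ A B rfl).elim
  | and A B => exact (h₂ A B rfl).elim
  | box A =>
    have hR := sumRel_squig (single .box) A.arena .odd
    refine ⟨.inl (), ?_⟩
    rintro (v | v) h
    · exact rel_irrefl _ _ _ h
    · cases (hR.lr () v).1 h
  | dia A =>
    have hR := sumRel_squig (single .dia) A.arena .odd
    refine ⟨.inl (), ?_⟩
    rintro (v | v) h
    · exact rel_irrefl _ _ _ h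
    · cases (hR.lr () v).1 h

/-- In a conjunction any root of the other conjunct works; in a modal formula the top vertex does.
-/
theorem exists_root_not_disj {F : Formula α} (hF : ∀ A B, F ≠ .imp A B) (v : F.arena.V) :
    ∃ r, F.arena.IsRoot r ∧ ¬ F.arena.Rel .odd v r := by
  cases F with
  | atom a => exact ⟨(), fun _ h => h, rel_irrefl _ _ _⟩
  | diaBot => exact ⟨(), fun _ h => h, rel_irrefl _ _ _⟩
  | imp A B => exact (hF A B rfl).elim
  | and A B =>
    have hR := sumRel_sum A.arena B.arena .odd
    rcases v with v | v
    · obtain ⟨r, hr⟩ := exists_root B.arena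
      exact ⟨.inr r, ((isLowerEmb_sum_inr A.arena B.arena).isRoot_iff r).2 hr,
        fun h => nomatch (hR.lr v r).1 h⟩
    · obtain ⟨r, hr⟩ := exists_root A.arena
      exact ⟨.inl r, ((isLowerEmb_sum_inl A.arena B.arena).isRoot_iff r).2 hr,
        fun h => nomatch (hR.rl v r).1 h⟩
  | box A =>
    have hR := sumRel_squig (single .box) A.arena .odd
    refine ⟨.inl (), ((isLowerEmb_squig_inl (single .box) A.arena).isRoot_iff ()).2
      fun _ h => h, ?_⟩
    rcases v with v | v
    · exact rel_irrefl _ _ _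
    · exact fun h => nomatch (hR.rl v ()).1 h
  | dia A =>
    have hR := sumRel_squig (single .dia) A.arena .odd
    refine ⟨.inl (), ((isLowerEmb_squig_inl (single .dia) A.arena).isRoot_iff ()).2
      fun _ h => h, ?_⟩
    rcases v with v | v
    · exact rel_irrefl _ _ _
    · exact fun h => nomatch (hR.rl v ()).1 h

/-- A set separated from its complement only by conjunct pairs is closed under `⟶`-edges. -/
theorem iff_of_iedge {F : Formula α} {P : F.arena.V → Prop}
    (hP : ∀ v w, P v → ¬ P w → F.arena.Rel .even v w) :
    ∀ v w, F.arena.iedge v w → (P v ↔ P w) := by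
  have hP' : ∀ v w, ¬ F.arena.Rel .even v w → ¬ F.arena.Rel .even w v → (P v ↔ P w) := by
    intro v w h1 h2
    by_cases hv : P v <;> by_cases hw : P w
    · exact iff_of_true hv hw
    · exact (h1 (hP v w hv hw)).elim
    · exact (h2 (hP w v hw hv)).elim
    · exact iff_of_false hv hw
  induction F with
  | atom a => exact fun _ _ h => h.elim
  | diaBot => exact fun _ _ h => h.elim
  | and A B ihA ihB =>
    have hR := sumRel_sum A.arena B.arena .even
    have iA := ihA (P := fun v => P (.inl v))
      (fun v w a b => (hR.ll v w).1 (hP (.inl v) (.inl w) a b))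
      fun v w a b => hP' (.inl v) (.inl w) (fun h => a ((hR.ll _ _).1 h))
        fun h => b ((hR.ll _ _).1 h)
    have iB := ihB (P := fun v => P (.inr v))
      (fun v w a b => (hR.rr v w).1 (hP (.inr v) (.inr w) a b))
      fun v w a b => hP' (.inr v) (.inr w) (fun h => a ((hR.rr _ _).1 h))
        fun h => b ((hR.rr _ _).1 h)
    rintro (v | v) (w | w) h
    exacts [iA v w h, h.elim, h.elim, iB v w h]
  | imp A B =>
    have hR := sumRel_arrow A.arena B.arena .even
    obtain ⟨a⟩ := A.good_arena.nonempty
    obtain ⟨b⟩ := B.good_arena.nonempty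
    -- Cross pairs of an arrow are never conjunct, so `P` cannot separate them and is constant.
    have hlr : ∀ a b, P (.inl a) ↔ P (.inr b) := fun a b => hP' (.inl a) (.inr b)
      (fun h => nomatch (hR.lr a b).1 h) fun h => nomatch (hR.rl b a).1 h
    have hall : ∀ v, P v ↔ P (.inl a) := by
      rintro (v | v)
      · exact (hlr v b).trans (hlr a b).symm
      · exact (hlr a v).symm
    exact fun v w _ => (hall v).trans (hall w).symm
  | box A ih =>
    have hR := sumRel_squig (single .box) A.arena .even
    have iA := ih (P := fun v => P (.inr v))
      (fun v w a b => (hR.rr v w).1 (hP (.inr v) (.inr w) a b))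
      fun v w a b => hP' (.inr v) (.inr w) (fun h => a ((hR.rr _ _).1 h))
        fun h => b ((hR.rr _ _).1 h)
    rintro (v | v) (w | w) h
    exacts [h.elim, h.elim, h.elim, iA v w h]
  | dia A ih =>
    have hR := sumRel_squig (single .dia) A.arena .even
    have iA := ih (P := fun v => P (.inr v))
      (fun v w a b => (hR.rr v w).1 (hP (.inr v) (.inr w) a b))
      fun v w a b => hP' (.inr v) (.inr w) (fun h => a ((hR.rr _ _).1 h))
        fun h => b ((hR.rr _ _).1 h)
    rintro (v | v) (w | w) h
    exacts [h.elim, h.elim, h.elim, iA v w h]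

instance finite_arena (F : Formula α) : Finite F.arena.V := by
  induction F with
  | atom a => exact inferInstanceAs (Finite Unit)
  | diaBot => exact inferInstanceAs (Finite Unit)
  | and A B _ _ => exact inferInstanceAs (Finite (A.arena.V ⊕ B.arena.V))
  | imp A B _ _ => exact inferInstanceAs (Finite (A.arena.V ⊕ B.arena.V))
  | box A _ => exact inferInstanceAs (Finite (Unit ⊕ A.arena.V))
  | dia A _ => exact inferInstanceAs (Finite (Unit ⊕ A.arena.V))

/-- The number of vertices of the arena. -/
noncomputable def size (F : Formula α) : ℕ := Nat.card F.arena.V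

theorem size_pos (F : Formula α) : 0 < F.size := Nat.card_pos

theorem size_and (A B : Formula α) : (A.and B).size = A.size + B.size := Nat.card_sum

theorem size_imp (A B : Formula α) : (A.imp B).size = A.size + B.size := Nat.card_sum

theorem size_box (A : Formula α) : A.box.size = 1 + A.size :=
  (Nat.card_sum (α := Unit) (β := A.arena.V)).trans (by rw [Nat.card_unique]; rfl)

theorem size_dia (A : Formula α) : A.dia.size = 1 + A.size :=
  (Nat.card_sum (α := Unit) (β := A.arena.V)).trans (by rw [Nat.card_unique]; rfl)

end Formula

theorem IsDerIso.size_eq {A B : Formula α} {e : A.arena.V ≃ B.arena.V} (_ : IsDerIso A B e) :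
    A.size = B.size :=
  Nat.card_congr e

/-! ### Targets with one vertex and modal targets -/

theorem exists_sum_map {V W V' W' : Type*} {f : V ⊕ W → V' ⊕ W'}
    (h₁ : ∀ v, ∃ x, f (.inl v) = .inl x) (h₂ : ∀ w, ∃ y, f (.inr w) = .inr y) :
    ∃ f₁ f₂, f = Sum.map f₁ f₂ := by
  choose f₁ hf₁ using h₁
  choose f₂ hf₂ using h₂
  refine ⟨f₁, f₂, funext ?_⟩
  rintro (v | w)
  exacts [hf₁ v, hf₂ w]

theorem not_isRoot_arrow_inl {G H : LGraph α} [G.Good] [H.Good] (v : G.V) :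
    ¬ (G.arrow H).IsRoot (.inl v) := fun h => by
  have h0 : (G.arrow H).depth (.inl v) = 0 := isRoot_iff.1 h
  rw [depth_arrow_inl] at h0
  cases h0

/-- The only skew fibrations to a graph with one vertex are isomorphisms, up to contraction. -/
theorem LGraph.IsSkewFibration.eq_of_single {p : Polarity} {F' : Formula α} {l : Label α}
    {f : F'.arena.V → (single l).V} (hf : IsSkewFibration p f)
    (hp : p = .odd → ∀ A B, F' ≠ .and A B) :
    (∃ a, F' = .atom a ∧ l = .atom a) ∨ (F' = .diaBot ∧ l = .dia) := by
  cases F' with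
  | atom a => exact .inl ⟨a, rfl, (hf.lab ()).symm⟩
  | diaBot => exact .inr ⟨rfl, (hf.lab ()).symm⟩
  | and A B =>
    cases p with
    | odd => exact (hp rfl A B rfl).elim
    | even =>
      obtain ⟨a⟩ := A.good_arena.nonempty
      obtain ⟨b⟩ := B.good_arena.nonempty
      exact (rel_irrefl _ _ _ (hf.preserves (.inl a) (.inr b)
        (((sumRel_sum A.arena B.arena .even).lr a b).2 rfl))).elim
  | imp A B =>
    obtain ⟨a, ha⟩ := exists_root A.arena
    obtain ⟨b, hb⟩ := exists_root B.arena
    exact (hf.iedge (.inl a) (.inr b) ⟨ha, hb⟩).elim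
  | box A =>
    obtain ⟨a, ha⟩ := exists_root A.arena
    exact (hf.medge (.inl ()) (.inr a) ⟨fun _ h => h, ha⟩).elim
  | dia A =>
    obtain ⟨a, ha⟩ := exists_root A.arena
    exact (hf.medge (.inl ()) (.inr a) ⟨fun _ h => h, ha⟩).elim

section Squig

variable {G H : LGraph α} {l : Label α}

theorem not_medge_squig_inl (v : ((single l).squig G).V) (u : Unit) :
    ¬ ((single l).squig G).medge v (.inl u) := by
  rcases v with v | v <;> exact fun h => h.elim

theorem not_iedge_squig_inl (v : ((single l).squig G).V) (u : Unit) :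
    ¬ ((single l).squig G).iedge v (.inl u) := by
  rcases v with v | v <;> exact fun h => h.elim

theorem isRoot_squig_inl (u : Unit) : ((single l).squig G).IsRoot (.inl u) :=
  ((isLowerEmb_squig_inl (single l) G).isRoot_iff u).2 fun _ h => h

/-- A body vertex sent to the top would be a root of the body; its incoming `⤳`-edge would then map
to one entering the top, and there is none. By surjectivity the top goes to the top. -/
theorem LGraph.IsModalHom.exists_squigMap [G.Good] [H.Good]
    {f : ((single l).squig H).V → ((single l).squig G).V} (hf : IsModalHom f)
    (hsurj : Function.Surjective f) : ∃ g : H.V → G.V, f = squigMap id g := by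
  have hroot : ∀ v, f (.inr v) = .inl () → H.IsRoot v := fun v hv => by
    have h : ((single l).squig G).IsRoot (f (.inr v)) := hv ▸ isRoot_squig_inl ()
    exact ((isLowerEmb_squig_inr (single l) H).isRoot_iff v).1 (hf.isRoot_iff.1 h)
  have hr : ∀ v, ∃ y, f (.inr v) = .inr y := by
    intro v
    rcases hv : f (.inr v) with u | y
    · have := hf.medge (.inl ()) (.inr v) ⟨fun _ h => h, hroot v hv⟩
      rw [hv] at this
      exact (not_medge_squig_inl _ _ this).elim
    · exact ⟨y, rfl⟩
  have hl : ∀ u, ∃ x, f (.inl u) = .inl x := by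
    intro u
    obtain ⟨w | w, hw⟩ := hsurj (.inl ())
    · exact ⟨(), hw⟩
    · obtain ⟨y, hy⟩ := hr w
      cases hw.symm.trans hy
  obtain ⟨f₁, f₂, rfl⟩ := exists_sum_map hl hr
  exact ⟨f₂, rfl⟩

/-- The source of a surjective skew fibration to a modal formula is modal, up to contraction. -/
theorem LGraph.IsSkewFibration.exists_modal {p : Polarity} {F' : Formula α} [G.Good]
    {f : F'.arena.V → ((single l).squig G).V} (hf : IsSkewFibration p f)
    (hp : p = .odd → ∀ A B, F' ≠ .and A B) (hsurj : Function.Surjective f) :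
    ∃ A, (F' = .box A ∧ l = .box) ∨ (F' = .dia A ∧ l = .dia) := by
  obtain ⟨v₀, hv₀⟩ := hsurj (.inl ())
  have hroot : F'.arena.IsRoot v₀ := by
    rw [← hf.isRoot_iff, hv₀]
    exact isRoot_squig_inl ()
  -- Having no incoming edge of either kind, the root `v₀` can be neither a root of a consequent nor
  -- a root of a modal body.
  have hi : ∀ v, ¬ F'.arena.iedge v v₀ := fun v h => by
    have := hf.iedge _ _ h
    rw [hv₀] at this
    exact not_iedge_squig_inl _ _ this
  have hm : ∀ v, ¬ F'.arena.medge v v₀ := fun v h => by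
    have := hf.medge _ _ h
    rw [hv₀] at this
    exact not_medge_squig_inl _ _ this
  cases F' with
  | atom a =>
    obtain ⟨y⟩ : Nonempty G.V := inferInstance
    obtain ⟨v, hv⟩ := hsurj (.inr y)
    cases hv₀.symm.trans hv
  | diaBot =>
    obtain ⟨y⟩ : Nonempty G.V := inferInstance
    obtain ⟨v, hv⟩ := hsurj (.inr y)
    cases hv₀.symm.trans hv
  | imp A B =>
    rcases v₀ with v | v
    · exact (not_isRoot_arrow_inl v hroot).elim
    · obtain ⟨a, ha⟩ := exists_root A.arena
      exact (hi (.inl a)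
        ⟨ha, ((isLowerEmb_arrow_inr A.arena B.arena).isRoot_iff v).1 hroot⟩).elim
  | box A =>
    rcases v₀ with v | v
    · have := hf.lab (.inl v)
      rw [hv₀] at this
      exact ⟨A, .inl ⟨rfl, this.symm⟩⟩
    · exact (hm (.inl ()) ⟨fun _ h => h,
        ((isLowerEmb_squig_inr (single .box) A.arena).isRoot_iff v).1 hroot⟩).elim
  | dia A =>
    rcases v₀ with v | v
    · have := hf.lab (.inl v)
      rw [hv₀] at this
      exact ⟨A, .inr ⟨rfl, this.symm⟩⟩
    · exact (hm (.inl ()) ⟨fun _ h => h,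
        ((isLowerEmb_squig_inr (single .dia) A.arena).isRoot_iff v).1 hroot⟩).elim
  | and A B =>
    cases p with
    | odd => exact (hp rfl A B rfl).elim
    | even =>
      have hR := sumRel_sum A.arena B.arena .even
      -- a second component would contain its own vertex above the modality
      have key : ∀ r : (A.and B).arena.V, (A.and B).arena.IsRoot r →
          (A.and B).arena.Rel .even v₀ r → ∃ w, (A.and B).arena.medge w r ∧ f w = f v₀ := by
        intro r hr hrel
        have hne := (hf.preserves _ _ hrel).ne
        rcases hfr : f r with u | y
        · exact (hne (hv₀.trans hfr.symm)).elim
        · have hry : ((single l).squig G).IsRoot (.inr y) := hfr ▸ hf.isRoot_iff.2 hr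
          obtain ⟨w, hw, he⟩ := hf.modal (.inl ()) r (by
            rw [hfr]
            exact ⟨fun _ h => h, ((isLowerEmb_squig_inr (single l) G).isRoot_iff y).1 hry⟩)
          exact ⟨w, hw, he.trans hv₀.symm⟩
      rcases v₀ with v | v
      · obtain ⟨b, hb⟩ := exists_root B.arena
        obtain ⟨w | w, hw, he⟩ := key (.inr b)
          (((isLowerEmb_sum_inr A.arena B.arena).isRoot_iff b).2 hb) ((hR.lr v b).2 rfl)
        · exact hw.elim
        · exact ((hf.preserves _ _ ((hR.lr v w).2 rfl)).ne he.symm).elim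
      · obtain ⟨a, ha⟩ := exists_root A.arena
        obtain ⟨w | w, hw, he⟩ := key (.inl a)
          (((isLowerEmb_sum_inl A.arena B.arena).isRoot_iff a).2 ha) ((hR.rl v a).2 rfl)
        · exact ((hf.preserves _ _ ((hR.rl v w).2 rfl)).ne he.symm).elim
        · exact hw.elim

end Squig

/-! ### Decomposing skew fibrations by induction on size -/

/-- All skew fibrations from arenas with fewer than `n` vertices are witnessed by derivations. -/
def DerBelow (α : Type*) (n : ℕ) : Prop :=
  ∀ (p : Polarity) (F' F : Formula α) (f : F'.arena.V → F.arena.V),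
    F'.size < n → IsSkewFibration p f → Der p F' F f

section Cases

variable {p : Polarity}

theorem LGraph.IsSkewFibration.der_of_odd_and {A B F : Formula α}
    {f : (A.and B).arena.V → F.arena.V} (hf : IsSkewFibration .odd f)
    (ih : DerBelow α (A.and B).size) : Der .odd (A.and B) F f := by
  have hs := Formula.size_and A B
  have := A.size_pos
  have := B.size_pos
  obtain ⟨f₁, f₂, rfl⟩ : ∃ (f₁ : A.arena.V → F.arena.V) (f₂ : B.arena.V → F.arena.V),
      f = copair f₁ f₂ := ⟨_, _, (Sum.elim_comp_inl_inr f).symm⟩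
  obtain ⟨h₁, h₂⟩ := IsSkewFibration.of_copair hf
  have := Der.comp (.and (ih _ _ _ _ (by omega) h₁) (ih _ _ _ _ (by omega) h₂)) (.contr F)
  refine cast (congrArg _ (funext ?_)) this
  rintro (v | v) <;> rfl

theorem LGraph.IsSkewFibration.der_of_sumMap {A B X Y : Formula α}
    {f : (A.and B).arena.V → (X.and Y).arena.V} (hf : IsSkewFibration p f)
    (h₁ : ∀ v, ∃ x, f (.inl v) = .inl x) (h₂ : ∀ w, ∃ y, f (.inr w) = .inr y)
    (ih : DerBelow α (A.and B).size) : Der p (A.and B) (X.and Y) f := by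
  have hs := Formula.size_and A B
  have := A.size_pos
  have := B.size_pos
  obtain ⟨f₁, f₂, rfl⟩ : ∃ (f₁ : A.arena.V → X.arena.V) (f₂ : B.arena.V → Y.arena.V),
      f = LGraph.sumMap f₁ f₂ := exists_sum_map h₁ h₂
  obtain ⟨k₁, k₂⟩ := IsSkewFibration.of_sumMap hf
  exact .and (ih _ _ _ _ (by omega) k₁) (ih _ _ _ _ (by omega) k₂)

theorem LGraph.IsSkewFibration.der_of_arrowMap {A B X Y : Formula α}
    {f : (A.imp B).arena.V → (X.imp Y).arena.V} (hf : IsSkewFibration p f)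
    (h₁ : ∀ v, ∃ x, f (.inl v) = .inl x) (h₂ : ∀ w, ∃ y, f (.inr w) = .inr y)
    (ih : DerBelow α (A.imp B).size) : Der p (A.imp B) (X.imp Y) f := by
  have hs := Formula.size_imp A B
  have := A.size_pos
  have := B.size_pos
  obtain ⟨f₁, f₂, rfl⟩ : ∃ (f₁ : A.arena.V → X.arena.V) (f₂ : B.arena.V → Y.arena.V),
      f = LGraph.arrowMap f₁ f₂ := exists_sum_map h₁ h₂
  obtain ⟨k₁, k₂⟩ := IsSkewFibration.of_arrowMap hf
  exact .imp (ih _ _ _ _ (by omega) k₁) (ih _ _ _ _ (by omega) k₂)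

theorem edgeClosed_isLeft_sum (X Y : Formula α) :
    Formula.EdgeClosed (X.and Y).arena fun v => ∃ x, v = Sum.inl x := by
  constructor
  · rintro (v | v) (w | w) h
    exacts [⟨fun _ => ⟨w, rfl⟩, fun _ => ⟨v, rfl⟩⟩, h.elim, h.elim,
      ⟨nofun, nofun⟩]
  · rintro (v | v) (w | w) h
    exacts [⟨fun _ => ⟨w, rfl⟩, fun _ => ⟨v, rfl⟩⟩, h.elim, h.elim,
      ⟨nofun, nofun⟩]

theorem LGraph.IsModalHom.edgeClosed {G H : LGraph α} {f : H.V → G.V} (hf : IsModalHom f)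
    {P : G.V → Prop} (hP : Formula.EdgeClosed G P) : Formula.EdgeClosed H fun v => P (f v) :=
  ⟨fun _ _ h => hP.1 _ _ (hf.iedge _ _ h), fun _ _ h => hP.2 _ _ (hf.medge _ _ h)⟩

theorem exists_inr_of_not {V W : Type*} {v : V ⊕ W} (h : ¬ ∃ x, v = Sum.inl x) :
    ∃ y, v = Sum.inr y := by
  rcases v with v | v
  · exact (h ⟨v, rfl⟩).elim
  · exact ⟨v, rfl⟩

/-- The preimage of the left conjunct is crossed by no edge, and surjectivity makes it neither empty
nor everything, so the source is a conjunction up to isomorphism. -/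
theorem LGraph.IsSkewFibration.der_of_and {F' X Y : Formula α}
    {f : F'.arena.V → (X.and Y).arena.V} (hf : IsSkewFibration p f) (hsurj : Function.Surjective f)
    (ih : DerBelow α F'.size) : Der p F' (X.and Y) f := by
  obtain ⟨x⟩ := X.good_arena.nonempty
  obtain ⟨y⟩ := Y.good_arena.nonempty
  obtain ⟨v, hv⟩ := hsurj (.inl x)
  obtain ⟨w, hw⟩ := hsurj (.inr y)
  rcases Formula.split F' (hf.edgeClosed (edgeClosed_isLeft_sum X Y)) with
    h | h | ⟨A, B, e, he, h₁, h₂⟩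
  · obtain ⟨z, hz⟩ := h w
    cases hw.symm.trans hz
  · exact (h v ⟨x, hv⟩).elim
  · refine he.der_of_comp ((he.isSkewFibration_comp hf).der_of_sumMap h₁
      (fun y => exists_inr_of_not (h₂ y)) ?_)
    rwa [he.size_eq]

/-- The source of a surjective skew fibration to an implication is an implication, up to
contraction. -/
theorem LGraph.IsSkewFibration.exists_imp {F' X Y : Formula α}
    {f : F'.arena.V → (X.imp Y).arena.V} (hf : IsSkewFibration p f)
    (hp : p = .odd → ∀ A B, F' ≠ .and A B) (hsurj : Function.Surjective f) :
    ∃ A B, F' = .imp A B := by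
  by_contra! hF
  have hR := sumRel_arrow X.arena Y.arena p
  obtain ⟨x⟩ := X.good_arena.nonempty
  obtain ⟨y⟩ := Y.good_arena.nonempty
  cases p with
  | even =>
    obtain ⟨v, hv⟩ := hsurj (.inl x)
    obtain ⟨w, hw⟩ := hsurj (.inr y)
    -- Conjunct pairs cannot map to the two sides of an implication, where cross pairs are disjunct.
    -- A conjunctness-connected source would therefore miss one side.
    have := Formula.coconnected_of_not_imp hF (P := fun v => ∃ x, f v = .inl x) (by
      intro v w h
      have h' := hf.preserves v w h
      rcases hv : f v with a | a <;> rcases hw : f w with b | b <;> rw [hv, hw] at h'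
      · exact iff_of_true ⟨a, rfl⟩ ⟨b, rfl⟩
      · cases (hR.lr a b).1 h'
      · cases (hR.rl a b).1 h'
      · exact iff_of_false nofun nofun) v w
    obtain ⟨z, hz⟩ := this.1 ⟨x, hv⟩
    cases hw.symm.trans hz
  | odd =>
    -- The vertex `c` has no disjunct partner, yet its image has one on the other side of the
    -- implication; lifting would produce a partner for `c`.
    obtain ⟨c, hc⟩ := Formula.exists_not_disj hF (hp rfl)
    have : ∃ w, (X.imp Y).arena.Rel .odd (f c) w := by
      rcases f c with a | a
      · exact ⟨.inr y, (hR.lr a y).2 rfl⟩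
      · exact ⟨.inl x, (hR.rl a x).2 rfl⟩
    obtain ⟨w, hw⟩ := this
    obtain ⟨u, hu, -⟩ := hf.lifting c w hw
    exact hc u hu

theorem LGraph.IsModalHom.exists_inr_of_isRoot {H : LGraph α} [H.Good] {X Y : Formula α}
    {f : H.V → (X.imp Y).arena.V} (hf : IsModalHom f) {v : H.V} (hv : H.IsRoot v) :
    ∃ y, f v = .inr y := by
  rcases hfv : f v with x | y
  · have := hf.isRoot_iff.2 hv
    rw [hfv] at this
    exact (not_isRoot_arrow_inl (G := X.arena) (H := Y.arena) x this).elim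
  · exact ⟨y, rfl⟩

theorem LGraph.IsSkewFibration.der_of_even_imp {A B X Y : Formula α} (hB : ∀ C D, B ≠ .imp C D)
    {f : (A.imp B).arena.V → (X.imp Y).arena.V} (hf : IsSkewFibration .even f)
    (hsurj : Function.Surjective f) (ih : DerBelow α (A.imp B).size) :
    Der .even (A.imp B) (X.imp Y) f := by
  have hR := sumRel_arrow A.arena B.arena .even
  have hS := sumRel_arrow X.arena Y.arena .even
  obtain ⟨r, hr⟩ := exists_root B.arena
  have hfr := hf.exists_inr_of_isRoot (v := .inr r)
    (((isLowerEmb_arrow_inr A.arena B.arena).isRoot_iff r).2 hr)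
  -- Roots of the consequent go to roots, hence into `Y`; conjunctness-connectedness of `B` carries
  -- this to all of `B`.
  have hfB : ∀ b, ∃ y, f (.inr b) = .inr y := by
    intro b
    refine (Formula.coconnected_of_not_imp hB (P := fun b => ∃ y, f (.inr b) = .inr y) ?_ r b).1
      hfr
    intro v w h
    have h' := hf.preserves (.inr v) (.inr w) ((hR.rr v w).2 h)
    rcases hv : f (.inr v) with a | a <;> rcases hw : f (.inr w) with b | b <;>
      rw [hv, hw] at h'
    · exact iff_of_false nofun nofun
    · cases (hS.lr a b).1 h'
    · cases (hS.rl a b).1 h'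
    · exact iff_of_true ⟨a, rfl⟩ ⟨b, rfl⟩
  -- An image edge from `X` to `Y` would end in a root, so its source edge would end in a root too,
  -- and no antecedent vertex is one.
  have hP : Formula.EdgeClosed A.arena fun a => ∃ x, f (.inl a) = .inl x := by
    constructor
    · intro v w h
      have h' := hf.iedge (.inl v) (.inl w) h
      rcases hv : f (.inl v) with a | a <;> rcases hw : f (.inl w) with b | b <;>
        rw [hv, hw] at h'
      · exact iff_of_true ⟨a, hv⟩ ⟨b, hw⟩
      · have hb := ((isLowerEmb_arrow_inr X.arena Y.arena).isRoot_iff b).2 h'.2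
        exact (not_isRoot_arrow_inl (G := A.arena) (H := B.arena) w
          (hf.isRoot_iff.1 (hw ▸ hb))).elim
      · exact h'.elim
      · exact iff_of_false (fun ⟨_, hx⟩ => nomatch hv.symm.trans hx)
          fun ⟨_, hx⟩ => nomatch hw.symm.trans hx
    · intro v w h
      have h' := hf.medge (.inl v) (.inl w) h
      rcases hv : f (.inl v) with a | a <;> rcases hw : f (.inl w) with b | b <;>
        rw [hv, hw] at h'
      · exact iff_of_true ⟨a, hv⟩ ⟨b, hw⟩
      · exact h'.elim
      · exact h'.elim
      · exact iff_of_false (fun ⟨_, hx⟩ => nomatch hv.symm.trans hx)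
          fun ⟨_, hx⟩ => nomatch hw.symm.trans hx
  rcases Formula.split A hP with h | h | ⟨A₁, A₂, e, he, h₁, h₂⟩
  · exact hf.der_of_arrowMap h hfB ih
  · obtain ⟨x⟩ := X.good_arena.nonempty
    obtain ⟨v | v, hv⟩ := hsurj (.inl x)
    · exact (h v ⟨x, hv⟩).elim
    · obtain ⟨y, hy⟩ := hfB v
      cases hv.symm.trans hy
  -- The part `A₂` of the antecedent that is mapped into `Y` is curried into the consequent.
  · have hk := (IsDerIso.curry A₁ A₂ B).symm.trans (he.imp (.refl B))
    refine hk.der_of_comp ((hk.isSkewFibration_comp hf).der_of_arrowMap h₁ ?_ ?_)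
    · rintro (v | v)
      · exact exists_inr_of_not (h₂ v)
      · exact hfB v
    · rwa [hk.size_eq]

theorem LGraph.IsSkewFibration.der_of_odd_imp {A B X Y : Formula α}
    (hY : ∀ C D, Y ≠ .imp C D)
    {f : (A.imp B).arena.V → (X.imp Y).arena.V} (hf : IsSkewFibration .odd f)
    (hsurj : Function.Surjective f) (ih : DerBelow α (A.imp B).size) :
    Der .odd (A.imp B) (X.imp Y) f := by
  have hR := sumRel_arrow A.arena B.arena .odd
  have hS := sumRel_arrow X.arena Y.arena .odd
  have hfAB : ∀ a b, (X.imp Y).arena.Rel .odd (f (.inl a)) (f (.inr b)) := fun a b =>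
    hf.preserves (.inl a) (.inr b) ((hR.lr a b).2 rfl)
  -- Were an antecedent vertex sent to `y` in `Y`, a root of `Y` not disjunct from `y` would be the
  -- image of a vertex of `B`; but vertices of `A` and `B` are disjunct, and so are their images.
  have hfA : ∀ a, ∃ x, f (.inl a) = .inl x := by
    intro a
    rcases ha : f (.inl a) with x | y
    · exact ⟨x, rfl⟩
    · obtain ⟨r, hr, hyr⟩ := Formula.exists_root_not_disj hY y
      have hr' := ((isLowerEmb_arrow_inr X.arena Y.arena).isRoot_iff r).2 hr
      obtain ⟨v | v, hv⟩ := hsurj (.inr r)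
      · exact (not_isRoot_arrow_inl (G := A.arena) (H := B.arena) v
          (hf.isRoot_iff.1 (hv ▸ hr'))).elim
      · have := hfAB a v
        rw [ha, hv] at this
        exact (hyr ((hS.rr y r).1 this)).elim
  let P : X.arena.V → Prop := fun x => ∃ a, f (.inl a) = .inl x
  have hnP : ∀ x, ¬ P x → ∃ b, f (.inr b) = .inl x := fun x hx => by
    obtain ⟨v | v, hv⟩ := hsurj (.inl x)
    · exact (hx ⟨v, hv⟩).elim
    · exact ⟨v, hv⟩
  have hfB : ∀ b x, f (.inr b) = .inl x → ¬ P x := by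
    rintro b x hb ⟨a, ha⟩
    exact (hfAB a b).ne (ha.trans hb.symm)
  -- Vertices of `X` outside `P` come from `B`, so they are disjunct from those in `P` within the
  -- arrow, that is, conjunct in `X`; hence no `⟶`-edge crosses. For `⤳`-edges the modal clause
  -- gives a preimage of the edge inside `A` or inside `B`.
  have hP : Formula.EdgeClosed X.arena P := by
    refine ⟨Formula.iff_of_iedge ?_, ?_⟩
    · rintro v w ⟨a, ha⟩ hw
      obtain ⟨b, hb⟩ := hnP w hw
      have := hfAB a b
      rw [ha, hb] at this
      exact (hS.ll v w).1 this
    · intro v w h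
      constructor
      · rintro ⟨a, ha⟩
        by_contra hw
        obtain ⟨b, hb⟩ := hnP w hw
        obtain ⟨u | u, hu, he⟩ := hf.modal (.inl v) (.inr b) (by rw [hb]; exact h)
        · exact hu.elim
        · exact hfB u v he ⟨a, ha⟩
      · rintro ⟨a, ha⟩
        obtain ⟨u | u, hu, he⟩ := hf.modal (.inl v) (.inl a) (by rw [ha]; exact h)
        · exact ⟨u, he⟩
        · exact hu.elim
  rcases Formula.split X hP with h | h | ⟨X₁, X₂, e, he, h₁, h₂⟩
  · refine hf.der_of_arrowMap hfA (fun b => exists_inr_of_not ?_) ih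
    rintro ⟨x, hx⟩
    exact hfB b x hx (h x)
  · obtain ⟨a⟩ := A.good_arena.nonempty
    obtain ⟨x, hx⟩ := hfA a
    exact (h x ⟨a, hx⟩).elim
  -- Here it is the target that is regrouped: `X₂`, reached only from `B`, is curried into the
  -- consequent.
  · have hk := (IsDerIso.curry X₁ X₂ Y).symm.trans (he.imp (.refl Y))
    refine hk.der_of_symm_comp ((hk.symm.comp_isSkewFibration hf).der_of_arrowMap ?_ ?_ ih)
    · intro a
      obtain ⟨x, hx⟩ := hfA a
      obtain ⟨z, rfl⟩ := e.surjective x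
      rcases z with z | z
      · refine ⟨z, (Equiv.symm_apply_eq _).2 ?_⟩
        exact hx
      · exact (h₂ z ⟨a, hx⟩).elim
    · intro b
      rcases hb : f (.inr b) with x | y
      · obtain ⟨z, rfl⟩ := e.surjective x
        rcases z with z | z
        · exact (hfB b _ hb (h₁ z)).elim
        · refine ⟨.inl z, (Equiv.symm_apply_eq _).2 ?_⟩
          exact hb
      · refine ⟨.inr y, (Equiv.symm_apply_eq _).2 ?_⟩
        exact hb

theorem LGraph.IsSkewFibration.der_of_imp {F' X Y : Formula α}
    {f : F'.arena.V → (X.imp Y).arena.V} (hf : IsSkewFibration p f)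
    (hp : p = .odd → ∀ A B, F' ≠ .and A B) (hsurj : Function.Surjective f)
    (ih : DerBelow α F'.size) : Der p F' (X.imp Y) f := by
  obtain ⟨A, C, rfl⟩ := hf.exists_imp hp hsurj
  cases p with
  | even =>
    obtain ⟨A', B, e, he, hB⟩ := Formula.exists_uncurried A C
    refine he.der_of_comp ((he.isSkewFibration_comp hf).der_of_even_imp hB
      (hsurj.comp e.surjective) ?_)
    rwa [he.size_eq]
  | odd =>
    obtain ⟨X', Y', e, he, hY⟩ := Formula.exists_uncurried X Y
    exact he.der_of_symm_comp ((he.symm.comp_isSkewFibration hf).der_of_odd_imp hY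
      (e.symm.surjective.comp hsurj) ih)

end Cases

theorem derBelow (n : ℕ) : DerBelow α n := by
  induction n with
  | zero => exact fun _ _ _ _ h _ => (Nat.not_lt_zero _ h).elim
  | succ n ih =>
    intro p F' G f₀ hn hf₀
    have ih : DerBelow α F'.size := fun p K' K g h hg => ih p K' K g (by omega) hg
    -- The source is unchanged by this factorization, so the size bound survives; only the target
    -- shrinks to the image.
    obtain ⟨F, f, g, hg, hf, hsurj, rfl⟩ := hf₀.exists_surjective
    refine .comp ?_ hg
    -- Contractions are removed before looking at the target: an odd map out of a conjunction can
    -- have any target, and only without them does the target determine the shape of the source.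
    by_cases hp : p = .odd ∧ ∃ A B, F' = .and A B
    · obtain ⟨rfl, A, B, rfl⟩ := hp
      exact hf.der_of_odd_and ih
    have hp : p = .odd → ∀ A B, F' ≠ .and A B := fun h A B hF => hp ⟨h, A, B, hF⟩
    cases F with
    | atom a =>
      rcases IsSkewFibration.eq_of_single hf hp with ⟨b, rfl, h⟩ | ⟨rfl, h⟩
      · cases h
        exact .refl _ _
      · cases h
    | diaBot =>
      rcases IsSkewFibration.eq_of_single hf hp with ⟨b, rfl, h⟩ | ⟨rfl, h⟩
      · cases h
      · exact .refl _ _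
    | and X Y => exact hf.der_of_and hsurj ih
    | imp X Y => exact hf.der_of_imp hp hsurj ih
    | box X =>
      obtain ⟨A, ⟨rfl, -⟩ | ⟨rfl, h⟩⟩ := IsSkewFibration.exists_modal hf hp hsurj
      · obtain ⟨g, rfl⟩ := IsModalHom.exists_squigMap hf.toIsModalHom hsurj
        exact .box (ih _ _ _ _ (by rw [Formula.size_box]; omega) (IsSkewFibration.of_squigMap hf))
      · cases h
    | dia X =>
      obtain ⟨A, ⟨rfl, h⟩ | ⟨rfl, -⟩⟩ := IsSkewFibration.exists_modal hf hp hsurj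
      · cases h
      · obtain ⟨g, rfl⟩ := IsModalHom.exists_squigMap hf.toIsModalHom hsurj
        exact .dia (ih _ _ _ _ (by rw [Formula.size_dia]; omega) (IsSkewFibration.of_squigMap hf))

theorem LGraph.IsSkewFibration.der {p : Polarity} {F' F : Formula α}
    {f : F'.arena.V → F.arena.V} (hf : IsSkewFibration p f) : Der p F' F f :=
  derBelow _ p F' F f (Nat.lt_succ_self _) hf

end

theorem mainTheorem7 {α : Type*} :
    (∀ (p : Polarity) (H' H : PFormula α p),
      PFormula.Derives H' H ↔ ∃ f : H'.arena.V → H.arena.V, LGraph.IsSkewFibration p f) ∧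
    (∀ (p : Polarity) (F' F : Formula α) (f : F'.arena.V → F.arena.V),
      LGraph.IsSkewFibration p f → LGraph.Built p f) := by
  refine ⟨fun p H' H => ⟨fun h => ?_, ?_⟩, fun p F' F f hf => hf.der.built⟩
  · obtain ⟨f, hf⟩ := h.exists_der
    exact ⟨f, hf.isCliqueMap.isSkewFibration⟩
  · rintro ⟨f, hf⟩
    exact .of_der hf.der
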